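/- Let $n\ge 1$, $\mathbb{T}^n=\mathbb{R}^n/\mathbb{Z}^n$ with its normalized Lebesgue measure, and for $T>0$ let $Q_T=\mathbb{T}^n\times(0,T)$. Let $r,q$ satisfy $$\frac{n}{2q}+\frac1r\le 1,\qquad r\in[1,\infty),\ q\in(n/2,\infty]\ \text{ if } n\ge 2;\qquad r\in[1,2],\ q\in[1,\infty]\ \text{ if } n=1 .$$ For every $p\in(1,\infty)$ and every $M\ge 0$ there is a constant $C=C(n,q,r,p,M)$, independent of $T$, such that the following holds for all $T>0$. Let $b\in L^2(Q_T;\mathbb{R}^n)$ be a vector field whose distributional spatial divergence is a function with $\|\mathrm{div}(b)\|_{L^r(0,T;L^q(\mathbb{T}^n))}\le M$, let $\rho_0\in L^2(\mathbb{T}^n)$, and let $\rho\ge 0$ belong to the parabolic class $$\mathcal{H}^1_2(Q_T)=\{u\in L^2(0,T;H^1(\mathbb{T}^n)):\ \partial_t u\in L^2(0,T;H^{-1}(\mathbb{T}^n))\}$$ and be a weak solution of $$\partial_t\rho-\Delta\rho+\mathrm{div}(b(x,t)\rho)=0\ \text{ in } Q_T,\qquad \rho(\cdot,0)=\rho_0\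 \text{ on }\mathbb{T}^n,$$ that is, $$\iint_{Q_T}\big(-\rho\,\partial_t\varphi+D\rho\cdot D\varphi-\rho\, b\cdot D\varphi\big)\,dx\,dt=\int_{\mathbb{T}^n}\rho_0(x)\,\varphi(x,0)\,dx$$ for all smooth $\varphi$ with compact support in $\mathbb{T}^n\times[0,T)$. Then $$\|\rho(\cdot,t)\|_{L^p(\mathbb{T}^n)}\le C\,\|\rho_0\|_{L^p(\mathbb{T}^n)}$$ for almost every $t\in(0,T)$ and, for the representative of $\rho$ in $C([0,T];L^2(\mathbb{T}^n))$, for every $t\in[0,T]$ (the right-hand side may be $+\infty$). -/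

import Mathlib

open MeasureTheory Set
open scoped ENNReal NNReal ContDiff

noncomputable section

/-- The measure of the parabolic cylinder `Q_T = 𝕋ⁿ × (0,T)`, with `𝕋ⁿ = ℝⁿ/ℤⁿ` carrying its Haar
probability measure. Points are written `(t, x)`. -/
def parabolicCylinder (n : ℕ) (T : ℝ) : Measure (ℝ × UnitAddTorus (Fin n)) :=
  (volume.restrict (Ioo 0 T)).prod volume

/-- Smooth functions of `(t, x) ∈ ℝ × 𝕋ⁿ`: the lift to `ℝ × ℝⁿ` is `C^∞`. -/
def IsSmooth {n : ℕ} (φ : ℝ × UnitAddTorus (Fin n) → ℝ) : Prop :=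
  ContDiff ℝ ∞ fun y : ℝ × (Fin n → ℝ) => φ (y.1, fun i => (y.2 i : UnitAddCircle))

/-- The classical time derivative `∂ₜφ`. -/
def timeDeriv {n : ℕ} (φ : ℝ × UnitAddTorus (Fin n) → ℝ) (z : ℝ × UnitAddTorus (Fin n)) : ℝ :=
  deriv (fun s : ℝ => φ (s, z.2)) z.1

/-- The classical spatial gradient `Dφ`. -/
def spaceGrad {n : ℕ} (φ : ℝ × UnitAddTorus (Fin n) → ℝ) (z : ℝ × UnitAddTorus (Fin n)) :
    EuclideanSpace ℝ (Fin n) :=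
  WithLp.toLp 2 fun i => deriv (fun s : ℝ => φ (z.1, z.2 + Pi.single i (s : UnitAddCircle))) 0

/-- `φ ∈ C_c^∞(𝕋ⁿ × (0,T))`. -/
def IsInteriorTest {n : ℕ} (T : ℝ) (φ : ℝ × UnitAddTorus (Fin n) → ℝ) : Prop :=
  IsSmooth φ ∧ ∃ t₀ t₁ : ℝ, 0 < t₀ ∧ t₁ < T ∧ ∀ t x, t < t₀ ∨ t₁ < t → φ (t, x) = 0

/-- `φ ∈ C_c^∞(𝕋ⁿ × [0,T))`: smooth, not necessarily zero at `t = 0`, zero near `t = T`. -/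
def IsInitialTest {n : ℕ} (T : ℝ) (φ : ℝ × UnitAddTorus (Fin n) → ℝ) : Prop :=
  IsSmooth φ ∧ ∃ t₁ : ℝ, t₁ < T ∧ ∀ t x, t₁ < t → φ (t, x) = 0

/-- `d` is the spatial divergence of `b` on `Q_T` in the sense of distributions. -/
def IsWeakDiv {n : ℕ} (T : ℝ) (b : ℝ × UnitAddTorus (Fin n) → EuclideanSpace ℝ (Fin n))
    (d : ℝ × UnitAddTorus (Fin n) → ℝ) : Prop :=
  ∀ φ, IsInteriorTest T φ →
    ∫ z, inner ℝ (b z) (spaceGrad φ z) ∂(parabolicCylinder n T) = -∫ z, d z * φ z ∂(parabolicCylinder n T)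

/-- `G` is the spatial gradient of `ρ` on `Q_T` in the sense of distributions. -/
def IsWeakGrad {n : ℕ} (T : ℝ) (ρ : ℝ × UnitAddTorus (Fin n) → ℝ)
    (G : ℝ × UnitAddTorus (Fin n) → EuclideanSpace ℝ (Fin n)) : Prop :=
  ∀ φ, IsInteriorTest T φ → ∀ i,
    ∫ z, ρ z * spaceGrad φ z i ∂(parabolicCylinder n T) = -∫ z, G z i * φ z ∂(parabolicCylinder n T)

/-- The norm of `L^r(0,T; L^q(𝕋ⁿ))`, for `r < ∞`. -/
def mixedNorm {n : ℕ} (T r : ℝ) (q : ℝ≥0∞) (d : ℝ × UnitAddTorus (Fin n) → ℝ) : ℝ≥0∞ :=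
  (∫⁻ t in Ioo 0 T, eLpNorm (fun x => d (t, x)) q volume ^ r) ^ (1 / r)

/-- `ρ ∈ L²(0,T; H¹(𝕋ⁿ))`, with spatial gradient `G`. -/
def IsL2H1 {n : ℕ} (T : ℝ) (ρ : ℝ × UnitAddTorus (Fin n) → ℝ)
    (G : ℝ × UnitAddTorus (Fin n) → EuclideanSpace ℝ (Fin n)) : Prop :=
  MemLp ρ 2 (parabolicCylinder n T) ∧ MemLp G 2 (parabolicCylinder n T) ∧ IsWeakGrad T ρ G

/-- `∂ₜρ ∈ L²(0,T; H⁻¹(𝕋ⁿ))`: as a distribution on `Q_T`, `∂ₜρ = f + div F` with `f` and `F` square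
integrable on `Q_T`; these distributions are exactly the elements of `L²(0,T; H⁻¹)`, the dual of
`L²(0,T; H¹)`. -/
def HasTimeDerivL2Hneg1 {n : ℕ} (T : ℝ) (ρ : ℝ × UnitAddTorus (Fin n) → ℝ) : Prop :=
  ∃ (f : ℝ × UnitAddTorus (Fin n) → ℝ) (F : ℝ × UnitAddTorus (Fin n) → EuclideanSpace ℝ (Fin n)),
    MemLp f 2 (parabolicCylinder n T) ∧ MemLp F 2 (parabolicCylinder n T) ∧
    ∀ φ, IsInteriorTest T φ →
      -∫ z, ρ z * timeDeriv φ z ∂(parabolicCylinder n T)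
        = ∫ z, (f z * φ z - inner ℝ (F z) (spaceGrad φ z)) ∂(parabolicCylinder n T)

/-- `ρ`, in the parabolic class `{ρ ∈ L²(0,T; H¹), ∂ₜρ ∈ L²(0,T; H⁻¹)}`, is a weak solution of
`∂ₜρ - Δρ + div(bρ) = 0` in `Q_T` with `ρ(·, 0) = ρ₀`. -/
def IsParabolicSolution {n : ℕ} (T : ℝ)
    (b : ℝ × UnitAddTorus (Fin n) → EuclideanSpace ℝ (Fin n))
    (ρ₀ : UnitAddTorus (Fin n) → ℝ) (ρ : ℝ × UnitAddTorus (Fin n) → ℝ) : Prop :=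
  ∃ G : ℝ × UnitAddTorus (Fin n) → EuclideanSpace ℝ (Fin n),
    IsL2H1 T ρ G ∧ HasTimeDerivL2Hneg1 T ρ ∧
    ∀ φ, IsInitialTest T φ →
      ∫ z, (-(ρ z * timeDeriv φ z) + inner ℝ (G z) (spaceGrad φ z)
          - ρ z * inner ℝ (b z) (spaceGrad φ z)) ∂(parabolicCylinder n T)
        = ∫ x, ρ₀ x * φ (0, x)

/-- The exponents allowed for `div b ∈ L^r(0,T; L^q(𝕋ⁿ))`: `n/(2q) + 1/r ≤ 1`, where
`r ∈ [1,∞)`, `q ∈ (n/2,∞]` if `n ≥ 2`, and `r ∈ [1,2]`, `q ∈ [1,∞]` if `n = 1`. -/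
def AdmissibleExponents (n : ℕ) (r : ℝ) (q : ℝ≥0∞) : Prop :=
  (n : ℝ≥0∞) / (2 * q) + 1 / ENNReal.ofReal r ≤ 1 ∧
    ((2 ≤ n ∧ 1 ≤ r ∧ (n : ℝ≥0∞) / 2 < q) ∨ (n = 1 ∧ 1 ≤ r ∧ r ≤ 2 ∧ 1 ≤ q))

end

open Filter Topology

/-! Write `d` for the divergence of `b` and `G` for the gradient of `ρ`. Testing the equation with
`g(ρ)`, where `g = β'`, and moving the derivative in the drift term onto `b` gives `d/dt ∫ β(ρ) + ∫
β''(ρ)|G|² + ∫ (ρ β'(ρ) - β(ρ)) d = 0`. Only the divergence of the drift survives. For `β` close to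
the power `s ^ P` put `w = √β(ρ)`: the dissipation controls `∫ |Dw|²`, because `P > 1`, and the
drift term is at most a multiple of `∫ |d| w²`. The condition `n/(2q) + 1/r ≤ 1` and
Gagliardo–Nirenberg bound the latter by `K ‖d(t)‖_q^r ∫ w²` plus a small multiple of the full `H¹`
energy of `w` (`AdmissibleExponents.exists_lintegral_mul_sq_le`).

Gronwall's lemma applied at this point would leave a factor growing with `T`, because the small
multiple contains `∫ w²`. The remedy is conservation of mass (`IsDriftData.ae_integral_eq`). If `∫
ρ₀ ≤ δ`, then by Markov's inequality `ρ < 2δ` on at least half of the torus at almost every time,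
and a Poincaré inequality for functions controlled on half of the torus (`H1Approx.integral_sq_le`)
bounds `∫ w²` by the dissipation plus a multiple of `δ ^ P`. Thus `Y = ∫ β(ρ)` satisfies `Y' ≤ C
‖d(t)‖_q^r Y - c Y + B δ ^ P` (`AdmissibleExponents.exists_rate_le`). The damped Gronwall lemma
`ae_le_of_rate_le` then gives a bound that involves only `M`. The same `δ` regularizes the power at
the origin, as `(s² + δ²) ^ (P/2)`, and it finally decreases to `‖ρ₀‖_p`, which dominates the mass.

The rest is justification at low regularity. The flux `ρ b` is merely integrable, so it is not an
admissible flux for the `L²` chain rule. The representation `∂ₜρ = f + div F` from the parabolic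
class is used for the chain rule (`IsApproxSeq.ae_integral_comp_sub`), through mollifications that
also see the initial datum. The equation enters separately (`IsDriftData.energy_identity`), tested
with bounded functions of the approximations, and shows that `f` and `F` can be exchanged for
dissipation and divergence. Truncating `β` to quadratic growth keeps every term integrable, since `d
(1 + ρ²)` is integrable (`IsApproxSeq.integrable_mul_sq`). -/

/-- The covering homomorphism `ℝ × ℝⁿ → ℝ × 𝕋ⁿ`. -/
def cylCover (n : ℕ) : ℝ × (Fin n → ℝ) →+ ℝ × UnitAddTorus (Fin n) where
  toFun y := (y.1, fun i => (y.2 i : UnitAddCircle))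
  map_zero' := rfl
  map_add' _ _ := rfl

/-- The derivative in the direction `v` of a function on `ℝ × 𝕋ⁿ`. -/
noncomputable def dirDeriv {n : ℕ} (v : ℝ × (Fin n → ℝ)) (φ : ℝ × UnitAddTorus (Fin n) → ℝ)
    (z : ℝ × UnitAddTorus (Fin n)) : ℝ :=
  deriv (fun s : ℝ => φ (z + cylCover n (s • v))) 0

@[simp] theorem cylCover_fst {n : ℕ} (y : ℝ × (Fin n → ℝ)) : (cylCover n y).1 = y.1 := rfl

@[simp] theorem cylCover_snd {n : ℕ} (y : ℝ × (Fin n → ℝ)) (i : Fin n) :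
    (cylCover n y).2 i = (y.2 i : UnitAddCircle) := rfl

/-! ### Calculus of smooth functions on the cylinder -/

section SmoothCalculus

variable {n : ℕ} {φ ψ : ℝ × UnitAddTorus (Fin n) → ℝ} {v : ℝ × (Fin n → ℝ)}

/-- Smoothness is defined on the covering space; the quotient property is what brings continuity
back down to the torus. -/
theorem isOpenQuotientMap_cylCover (n : ℕ) : IsOpenQuotientMap (cylCover n) :=
  IsOpenQuotientMap.prodMap .id (IsOpenQuotientMap.piMap fun _ => QuotientAddGroup.isOpenQuotientMap_mk)

theorem cylCover_surjective (n : ℕ) : Function.Surjective (cylCover n) :=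
  (isOpenQuotientMap_cylCover n).surjective

theorem isSmooth_iff : IsSmooth φ ↔ ContDiff ℝ ∞ (φ ∘ cylCover n) := Iff.rfl

theorem IsSmooth.continuous (h : IsSmooth φ) : Continuous φ :=
  (isOpenQuotientMap_cylCover n).continuous_comp_iff.1 (isSmooth_iff.1 h).continuous

theorem IsSmooth.dirDeriv_cover (h : IsSmooth φ) (v y : ℝ × (Fin n → ℝ)) :
    dirDeriv v φ (cylCover n y) = fderiv ℝ (φ ∘ cylCover n) y v := by
  have hd : HasFDerivAt (φ ∘ cylCover n) (fderiv ℝ (φ ∘ cylCover n) y) (y + (0 : ℝ) • v) := by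
    simpa using ((isSmooth_iff.1 h).differentiable (by simp) y).hasFDerivAt
  have h1 : HasDerivAt (fun s : ℝ => y + s • v) v 0 := by
    simpa using ((hasDerivAt_id (0 : ℝ)).smul_const v).const_add y
  have := (hd.comp_hasDerivAt (0 : ℝ) h1).deriv
  rw [← this]
  unfold dirDeriv
  congr 1

theorem IsSmooth.smooth_dirDeriv (h : IsSmooth φ) (v : ℝ × (Fin n → ℝ)) : IsSmooth (dirDeriv v φ) := by
  rw [isSmooth_iff]
  have : dirDeriv v φ ∘ cylCover n = fun y => fderiv ℝ (φ ∘ cylCover n) y v :=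
    funext fun y => h.dirDeriv_cover v y
  rw [this]
  exact ((isSmooth_iff.1 h).fderiv_right (m := ∞) (by simp)).clm_apply contDiff_const

theorem IsSmooth.hasDerivAt (h : IsSmooth φ) (z : ℝ × UnitAddTorus (Fin n))
    (v : ℝ × (Fin n → ℝ)) (s : ℝ) :
    HasDerivAt (fun s : ℝ => φ (z + cylCover n (s • v)))
      (dirDeriv v φ (z + cylCover n (s • v))) s := by
  obtain ⟨y, rfl⟩ := cylCover_surjective n z
  have hd : HasFDerivAt (φ ∘ cylCover n) (fderiv ℝ (φ ∘ cylCover n) (y + s • v)) (y + s • v) :=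
    ((isSmooth_iff.1 h).differentiable (by simp) _).hasFDerivAt
  have h1 : HasDerivAt (fun s : ℝ => y + s • v) v s := by
    simpa using ((hasDerivAt_id s).smul_const v).const_add y
  have h2 := hd.comp_hasDerivAt s h1
  rw [← map_add, h.dirDeriv_cover]
  have h3 : (fun s : ℝ => φ (cylCover n y + cylCover n (s • v))) =
      (φ ∘ cylCover n) ∘ fun s : ℝ => y + s • v := by
    ext s
    simp
  rw [h3]
  exact h2

theorem IsSmooth.hasDerivAt_zero (h : IsSmooth φ) (z : ℝ × UnitAddTorus (Fin n))
    (v : ℝ × (Fin n → ℝ)) :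
    HasDerivAt (fun s : ℝ => φ (z + cylCover n (s • v))) (dirDeriv v φ z) 0 := by
  simpa using h.hasDerivAt z v 0

theorem timeDeriv_eq (φ : ℝ × UnitAddTorus (Fin n) → ℝ) (z : ℝ × UnitAddTorus (Fin n)) :
    timeDeriv φ z = dirDeriv (1, 0) φ z := by
  unfold timeDeriv dirDeriv
  have : (fun s : ℝ => φ (z + cylCover n (s • (1, 0)))) = fun s => (fun s => φ (s, z.2)) (z.1 + s) := by
    ext s
    congr 1
    ext <;> simp
  rw [this, deriv_comp_const_add (f := fun s => φ (s, z.2))]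
  simp

theorem spaceGrad_eq (φ : ℝ × UnitAddTorus (Fin n) → ℝ) (z : ℝ × UnitAddTorus (Fin n)) (i : Fin n) :
    spaceGrad φ z i = dirDeriv (0, Pi.single i 1) φ z := by
  unfold spaceGrad dirDeriv
  simp only
  congr 1
  ext s
  congr 1
  ext j
  · simp
  · rcases eq_or_ne j i with rfl | hj
    · simp
    · simp [hj]

theorem IsSmooth.smooth_timeDeriv (h : IsSmooth φ) : IsSmooth (timeDeriv φ) := by
  rw [funext (timeDeriv_eq φ)]
  exact h.smooth_dirDeriv _

theorem IsSmooth.smooth_spaceGrad (h : IsSmooth φ) (i : Fin n) : IsSmooth fun z => spaceGrad φ z i := by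
  simp_rw [spaceGrad_eq]
  exact h.smooth_dirDeriv _

theorem IsSmooth.continuous_spaceGrad (h : IsSmooth φ) : Continuous (spaceGrad φ) :=
  (PiLp.continuous_toLp 2 _).comp (continuous_pi fun i => (h.smooth_spaceGrad i).continuous)

theorem IsSmooth.smooth_comp {g : ℝ → ℝ} (hg : ContDiff ℝ ∞ g) (h : IsSmooth φ) :
    IsSmooth fun z => g (φ z) :=
  ContDiff.comp hg h

theorem IsSmooth.mul (h : IsSmooth φ) (h' : IsSmooth ψ) : IsSmooth fun z => φ z * ψ z :=
  ContDiff.mul h h'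

theorem isSmooth_time {g : ℝ → ℝ} (hg : ContDiff ℝ ∞ g) :
    IsSmooth fun z : ℝ × UnitAddTorus (Fin n) => g z.1 :=
  hg.comp contDiff_fst

theorem IsSmooth.dirDeriv_comp {g : ℝ → ℝ} (hg : ContDiff ℝ ∞ g) (h : IsSmooth φ)
    (v : ℝ × (Fin n → ℝ)) (z : ℝ × UnitAddTorus (Fin n)) :
    dirDeriv v (fun z => g (φ z)) z = deriv g (φ z) * dirDeriv v φ z := by
  have h1 := h.hasDerivAt_zero z v
  have h2 : HasDerivAt g (deriv g (φ z)) (φ (z + cylCover n ((0 : ℝ) • v))) := by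
    simpa using (hg.differentiable (by simp) (φ z)).hasDerivAt
  exact (h2.comp (0 : ℝ) h1).deriv

theorem IsSmooth.dirDeriv_mul (h : IsSmooth φ) (h' : IsSmooth ψ)
    (v : ℝ × (Fin n → ℝ)) (z : ℝ × UnitAddTorus (Fin n)) :
    dirDeriv v (fun z => φ z * ψ z) z =
      dirDeriv v φ z * ψ z + φ z * dirDeriv v ψ z := by
  have := ((h.hasDerivAt_zero z v).fun_mul (h'.hasDerivAt_zero z v)).deriv
  simp only [zero_smul, map_zero, add_zero] at this
  exact this

theorem spaceGrad_time (g : ℝ → ℝ) (z : ℝ × UnitAddTorus (Fin n)) :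
    spaceGrad (fun z : ℝ × UnitAddTorus (Fin n) => g z.1) z = 0 := by
  ext i
  simp [spaceGrad]

theorem IsSmooth.spaceGrad_comp {g : ℝ → ℝ} (hg : ContDiff ℝ ∞ g) (h : IsSmooth φ)
    (z : ℝ × UnitAddTorus (Fin n)) :
    spaceGrad (fun z => g (φ z)) z = deriv g (φ z) • spaceGrad φ z := by
  ext i
  simp [spaceGrad_eq, h.dirDeriv_comp hg]

theorem IsSmooth.spaceGrad_mul (h : IsSmooth φ) (h' : IsSmooth ψ)
    (z : ℝ × UnitAddTorus (Fin n)) :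
    spaceGrad (fun z => φ z * ψ z) z =
      ψ z • spaceGrad φ z + φ z • spaceGrad ψ z := by
  ext i
  simp [spaceGrad_eq, h.dirDeriv_mul h']
  ring

theorem IsSmooth.timeDeriv_comp {g : ℝ → ℝ} (hg : ContDiff ℝ ∞ g) (h : IsSmooth φ)
    (z : ℝ × UnitAddTorus (Fin n)) :
    timeDeriv (fun z => g (φ z)) z = deriv g (φ z) * timeDeriv φ z := by
  simp [timeDeriv_eq, h.dirDeriv_comp hg]

theorem timeDeriv_time (g : ℝ → ℝ) (z : ℝ × UnitAddTorus (Fin n)) :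
    timeDeriv (fun z : ℝ × UnitAddTorus (Fin n) => g z.1) z = deriv g z.1 := rfl

theorem dirDeriv_comp_sub_left (φ : ℝ × UnitAddTorus (Fin n) → ℝ) (v : ℝ × (Fin n → ℝ))
    (z z' : ℝ × UnitAddTorus (Fin n)) :
    dirDeriv v (fun w => φ (z - w)) z' = -dirDeriv v φ (z - z') := by
  unfold dirDeriv
  have : (fun s : ℝ => φ (z - (z' + cylCover n (s • v)))) =
      fun s => (fun s : ℝ => φ (z - z' + cylCover n (s • v))) (-s) := by
    ext s
    simp only [neg_smul, map_neg]
    congr 1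
    abel
  rw [this, deriv_comp_neg (f := fun s : ℝ => φ (z - z' + cylCover n (s • v)))]
  simp

theorem IsSmooth.comp_sub_left (h : IsSmooth φ) (z : ℝ × UnitAddTorus (Fin n)) :
    IsSmooth fun w => φ (z - w) := by
  obtain ⟨y, rfl⟩ := cylCover_surjective n z
  rw [isSmooth_iff] at h ⊢
  have : (fun w => φ (cylCover n y - w)) ∘ cylCover n = (φ ∘ cylCover n) ∘ fun w => y - w := by
    ext w
    simp [map_sub]
  rw [this]
  exact h.comp (contDiff_const.sub contDiff_id)

theorem Continuous.exists_bound_cyl {E : Type*} [NormedAddCommGroup E]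
    {F : ℝ × UnitAddTorus (Fin n) → E} (h : Continuous F) (a b : ℝ) :
    ∃ C : ℝ, 0 ≤ C ∧ ∀ z : ℝ × UnitAddTorus (Fin n), z.1 ∈ Icc a b → ‖F z‖ ≤ C := by
  obtain ⟨C, hC⟩ := (isCompact_Icc.prod isCompact_univ :
    IsCompact (Icc a b ×ˢ (univ : Set (UnitAddTorus (Fin n))))).exists_bound_of_continuousOn
      h.continuousOn
  exact ⟨max C 0, le_max_right _ _, fun z hz => (hC z ⟨hz, mem_univ _⟩).trans (le_max_left _ _)⟩

instance instIsProbabilityMeasureUnitAddCircle :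
    IsProbabilityMeasure (volume : Measure UnitAddCircle) := ⟨by simp⟩

/-- Haar measure is translation invariant, so `s ↦ ∫ φ (t, x + s e)` is constant, and its derivative
at `0` is the integral in question. Every integration by parts on the torus rests on this. -/
theorem IsSmooth.integral_dirDeriv_space (h : IsSmooth φ) (t : ℝ) (e : Fin n → ℝ) :
    ∫ x, dirDeriv (0, e) φ (t, x) = 0 := by
  obtain ⟨C, -, hC⟩ := (h.smooth_dirDeriv (0, e)).continuous.exists_bound_cyl t t
  have key : ∀ s : ℝ, ∀ x : UnitAddTorus (Fin n), (t, x) + cylCover n (s • ((0 : ℝ), e)) =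
      (t, x + (cylCover n (s • ((0 : ℝ), e))).2) := by
    intro s x
    ext <;> simp
  have hcont : ∀ s : ℝ, Continuous fun x : UnitAddTorus (Fin n) =>
      φ ((t, x) + cylCover n (s • ((0 : ℝ), e))) := fun s => by
    have := h.continuous
    fun_prop
  have := (hasDerivAt_integral_of_dominated_loc_of_deriv_le (μ := volume)
    (F := fun (s : ℝ) (x : UnitAddTorus (Fin n)) => φ ((t, x) + cylCover n (s • ((0 : ℝ), e))))
    (F' := fun s x => dirDeriv (0, e) φ ((t, x) + cylCover n (s • ((0 : ℝ), e))))
    (x₀ := 0) (s := univ) (bound := fun _ => C) univ_mem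
    (Eventually.of_forall fun s => (hcont s).aestronglyMeasurable)
    ((hcont 0).integrable_of_hasCompactSupport (HasCompactSupport.of_compactSpace _))
    ?_ ?_ (integrable_const _) ?_).2
  · have hconst : ∀ s : ℝ, ∫ x, φ ((t, x) + cylCover n (s • ((0 : ℝ), e))) = ∫ x, φ (t, x) := by
      intro s
      simp_rw [key]
      exact integral_add_right_eq_self (fun x => φ (t, x)) _
    simp_rw [hconst] at this
    have h0 := this.unique (hasDerivAt_const _ _)
    simpa using h0
  · refine Continuous.aestronglyMeasurable ?_
    have := (h.smooth_dirDeriv (0, e)).continuous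
    fun_prop
  · refine Eventually.of_forall fun x s _ => ?_
    rw [key]
    exact hC _ ⟨le_rfl, le_rfl⟩
  · exact Eventually.of_forall fun x s _ => h.hasDerivAt (t, x) (0, e) s

theorem IsSmooth.integral_spaceGrad (h : IsSmooth φ) (t : ℝ) (i : Fin n) :
    ∫ x, spaceGrad φ (t, x) i = 0 := by
  simp_rw [spaceGrad_eq]
  exact h.integral_dirDeriv_space t _

theorem Continuous.integrable_slice {E : Type*} [NormedAddCommGroup E]
    {F : ℝ × UnitAddTorus (Fin n) → E} (h : Continuous F) (t : ℝ) :
    Integrable fun x => F (t, x) :=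
  (h.comp (Continuous.prodMk_right t)).integrable_of_hasCompactSupport
    (HasCompactSupport.of_compactSpace _)

theorem IsSmooth.hasDerivAt_time (h : IsSmooth φ) (t : ℝ) (x : UnitAddTorus (Fin n)) :
    HasDerivAt (fun s => φ (s, x)) (timeDeriv φ (t, x)) t := by
  have h1 := h.hasDerivAt (0, x) (1, 0) t
  rw [← timeDeriv_eq] at h1
  have : ∀ s : ℝ, ((0 : ℝ), x) + cylCover n (s • (1, 0)) = (s, x) := by
    intro s
    ext <;> simp
  simpa only [this] using h1

theorem IsSmooth.hasDerivAt_integral_time (h : IsSmooth φ) (t : ℝ) :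
    HasDerivAt (fun s => ∫ x, φ (s, x)) (∫ x, timeDeriv φ (t, x)) t := by
  obtain ⟨C, -, hC⟩ := h.smooth_timeDeriv.continuous.exists_bound_cyl (t - 1) (t + 1)
  refine (hasDerivAt_integral_of_dominated_loc_of_deriv_le (μ := volume)
    (F' := fun s x => timeDeriv φ (s, x))
    (s := Icc (t - 1) (t + 1)) (bound := fun _ => C) (Icc_mem_nhds (by linarith) (by linarith))
    (Eventually.of_forall fun s => (h.continuous.integrable_slice s).aestronglyMeasurable)
    (h.continuous.integrable_slice t) (h.smooth_timeDeriv.continuous.integrable_slice t).aestronglyMeasurable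
    (Eventually.of_forall fun x s hs => hC _ hs) (integrable_const _)
    (Eventually.of_forall fun x s _ => h.hasDerivAt_time s x)).2

theorem Continuous.continuous_integral_slice
    {F : ℝ × UnitAddTorus (Fin n) → ℝ} (h : Continuous F) : Continuous fun t => ∫ x, F (t, x) := by
  have := continuous_parametric_integral_of_continuous (X := ℝ)
    (μ := (volume : Measure (UnitAddTorus (Fin n)))) (f := fun t x => F (t, x)) h isCompact_univ
  simpa using this

theorem IsSmooth.integral_slice_sub (h : IsSmooth φ) (s t : ℝ) :
    (∫ x, φ (t, x)) - ∫ x, φ (s, x) = ∫ τ in s..t, ∫ x, timeDeriv φ (τ, x) := by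
  exact (intervalIntegral.integral_eq_sub_of_hasDerivAt
    (fun τ _ => h.hasDerivAt_integral_time τ)
    (h.smooth_timeDeriv.continuous.continuous_integral_slice.intervalIntegrable s t)).symm

end SmoothCalculus

/-! ### Smoothness of parametric convolution integrals -/

section ParametricConvolution

variable {E V α : Type} [NormedAddCommGroup E] [ProperSpace E]
  [NormedAddCommGroup V] [NormedSpace ℝ V] [MeasurableSpace α] {μ : Measure α} {ℓ : α → E}
  {r : α → ℝ} {R : ℝ} {K : E → V}

/-- The kernel may be unbounded, for instance periodic in some directions and arbitrary in time:
since `ℓ` is essentially bounded, only the values of `K` on one compact ball matter. -/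
theorem integrable_smul_comp_sub (hr : Integrable r μ) (hℓ : AEStronglyMeasurable ℓ μ)
    (hb : ∀ᵐ a ∂μ, ‖ℓ a‖ ≤ R) (hK : Continuous K) (y : E) :
    Integrable (fun a => r a • K (y - ℓ a)) μ := by
  obtain ⟨C, hC⟩ := (isCompact_closedBall (0 : E) (‖y‖ + R)).exists_bound_of_continuousOn
    hK.continuousOn
  refine (hr.norm.mul_const C).mono' (hr.aestronglyMeasurable.smul
    (hK.comp_aestronglyMeasurable (aestronglyMeasurable_const.sub hℓ))) ?_
  filter_upwards [hb] with a ha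
  rw [norm_smul]
  gcongr
  refine hC _ ?_
  rw [mem_closedBall_zero_iff]
  exact (norm_sub_le _ _).trans (by gcongr)

variable [NormedSpace ℝ E]

theorem hasFDerivAt_integral_smul_comp_sub (hr : Integrable r μ) (hℓ : AEStronglyMeasurable ℓ μ)
    (hb : ∀ᵐ a ∂μ, ‖ℓ a‖ ≤ R) (hK : ContDiff ℝ 1 K) (y : E) :
    HasFDerivAt (fun y => ∫ a, r a • K (y - ℓ a) ∂μ) (∫ a, r a • fderiv ℝ K (y - ℓ a) ∂μ) y := by
  have hK' : Continuous (fderiv ℝ K) := hK.continuous_fderiv (by simp)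
  obtain ⟨C, hC⟩ := (isCompact_closedBall (0 : E) (‖y‖ + 1 + R)).exists_bound_of_continuousOn
    hK'.continuousOn
  refine hasFDerivAt_integral_of_dominated_of_fderiv_le (s := Metric.ball y 1)
    (F' := fun y a => r a • fderiv ℝ K (y - ℓ a)) (bound := fun a => ‖r a‖ * C)
    (Metric.ball_mem_nhds y one_pos)
    (Eventually.of_forall fun z =>
      (integrable_smul_comp_sub hr hℓ hb hK.continuous z).aestronglyMeasurable)
    (integrable_smul_comp_sub hr hℓ hb hK.continuous y)
    (integrable_smul_comp_sub hr hℓ hb hK' y).aestronglyMeasurable ?_ (hr.norm.mul_const C)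
    (Eventually.of_forall fun a z _ => ?_)
  · filter_upwards [hb] with a ha z hz
    rw [norm_smul]
    gcongr
    refine hC _ ?_
    rw [mem_closedBall_zero_iff]
    have h1 : ‖z‖ ≤ ‖y‖ + 1 := by
      have := norm_sub_norm_le z y
      rw [Metric.mem_ball, dist_eq_norm] at hz
      linarith
    exact (norm_sub_le _ _).trans (by gcongr)
  · have h1 : HasFDerivAt K (fderiv ℝ K (z - ℓ a)) (z - ℓ a) :=
      (hK.differentiable (by simp) _).hasFDerivAt
    exact (h1.comp z ((hasFDerivAt_id z).sub_const (ℓ a))).const_smul (r a)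

/-- The derivative is an integral of the same form with kernel `fderiv ℝ K`. That kernel has values
in a different space, so the induction is uniform in the target `V`. -/
theorem contDiff_integral_smul_comp_sub_nat (m : ℕ) : ∀ {V : Type} [NormedAddCommGroup V]
    [NormedSpace ℝ V] {K : E → V}, Integrable r μ → AEStronglyMeasurable ℓ μ →
    (∀ᵐ a ∂μ, ‖ℓ a‖ ≤ R) → ContDiff ℝ m K → ContDiff ℝ m fun y => ∫ a, r a • K (y - ℓ a) ∂μ := by
  induction m with
  | zero =>
    intro V _ _ K hr hℓ hb hK
    have hK : Continuous K := hK.continuous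
    refine contDiff_zero.2 (continuous_iff_continuousAt.2 fun y => ?_)
    obtain ⟨C, hC⟩ := (isCompact_closedBall (0 : E) (‖y‖ + 1 + R)).exists_bound_of_continuousOn
      hK.continuousOn
    refine continuousAt_of_dominated (bound := fun a => ‖r a‖ * C)
      (Eventually.of_forall fun z => (integrable_smul_comp_sub hr hℓ hb hK z).aestronglyMeasurable)
      ?_ (hr.norm.mul_const C)
      (Eventually.of_forall fun a => by fun_prop)
    filter_upwards [Metric.ball_mem_nhds y one_pos] with z hz
    filter_upwards [hb] with a ha
    rw [norm_smul]
    gcongr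
    refine hC _ ?_
    rw [mem_closedBall_zero_iff]
    have h1 : ‖z‖ ≤ ‖y‖ + 1 := by
      have := norm_sub_norm_le z y
      rw [Metric.mem_ball, dist_eq_norm] at hz
      linarith
    exact (norm_sub_le _ _).trans (by gcongr)
  | succ m ih =>
    intro V _ _ K hr hℓ hb hK
    have h1 : ContDiff ℝ 1 K := hK.of_le (by
      push_cast
      exact le_add_self)
    push_cast at hK ⊢
    rw [contDiff_succ_iff_fderiv] at hK ⊢
    refine ⟨fun y => (hasFDerivAt_integral_smul_comp_sub hr hℓ hb h1 y).differentiableAt,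
      by simp, ?_⟩
    have : (fderiv ℝ fun y => ∫ a, r a • K (y - ℓ a) ∂μ) =
        fun y => ∫ a, r a • fderiv ℝ K (y - ℓ a) ∂μ :=
      funext fun y => (hasFDerivAt_integral_smul_comp_sub hr hℓ hb h1 y).fderiv
    rw [this]
    exact ih hr hℓ hb hK.2.2

theorem contDiff_integral_smul_comp_sub (hr : Integrable r μ) (hℓ : AEStronglyMeasurable ℓ μ)
    (hb : ∀ᵐ a ∂μ, ‖ℓ a‖ ≤ R) (hK : ContDiff ℝ ∞ K) :
    ContDiff ℝ ∞ fun y => ∫ a, r a • K (y - ℓ a) ∂μ :=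
  contDiff_infty.2 fun m => contDiff_integral_smul_comp_sub_nat m hr hℓ hb (contDiff_infty.1 hK m)

end ParametricConvolution

/-! ### Convolution on the cylinder -/

/-- The section of `cylCover n` with values in the fundamental domain `ℝ × [0,1)ⁿ`. -/
noncomputable def cylSection (n : ℕ) (z : ℝ × UnitAddTorus (Fin n)) : ℝ × (Fin n → ℝ) :=
  (z.1, fun i => (AddCircle.measurableEquivIco (1 : ℝ) 0 (z.2 i) : ℝ))

theorem measurable_cylSection (n : ℕ) : Measurable (cylSection n) := by
  refine measurable_fst.prodMk (measurable_pi_lambda _ fun i => ?_)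
  exact measurable_subtype_coe.comp ((AddCircle.measurableEquivIco (1 : ℝ) 0).measurable.comp
    ((measurable_pi_apply i).comp measurable_snd))

theorem cylCover_cylSection {n : ℕ} (z : ℝ × UnitAddTorus (Fin n)) :
    cylCover n (cylSection n z) = z := by
  ext i
  · rfl
  · exact (AddCircle.measurableEquivIco (1 : ℝ) 0).symm_apply_apply (z.2 i)

theorem cylSection_snd_mem {n : ℕ} (z : ℝ × UnitAddTorus (Fin n)) (i : Fin n) :
    (cylSection n z).2 i ∈ Ico (0 : ℝ) 1 := by
  have := (AddCircle.measurableEquivIco (1 : ℝ) 0 (z.2 i)).2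
  simpa [cylSection] using this

theorem norm_cylSection_le {n : ℕ} (z : ℝ × UnitAddTorus (Fin n)) :
    ‖cylSection n z‖ ≤ max |z.1| 1 := by
  rw [Prod.norm_def]
  refine max_le_max le_rfl ?_
  refine (pi_norm_le_iff_of_nonneg zero_le_one).2 fun i => ?_
  obtain ⟨h0, h1⟩ := cylSection_snd_mem z i
  rw [Real.norm_eq_abs, abs_le]
  constructor <;> linarith

/-- Convolution of a kernel on `ℝ × 𝕋ⁿ` with a function. -/
noncomputable def cylConv {n : ℕ} (K f : ℝ × UnitAddTorus (Fin n) → ℝ)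
    (z : ℝ × UnitAddTorus (Fin n)) : ℝ := ∫ w, f w * K (z - w)

section CylConv

variable {n : ℕ} {K f : ℝ × UnitAddTorus (Fin n) → ℝ} {R : ℝ}

/-- On the covering space the convolution becomes an integral `∫ r a • K (y - ℓ a)` over a normed
space. The section is discontinuous, but it only plays the role of the measurable parameter `ℓ`. -/
theorem cylConv_comp_cover (K f : ℝ × UnitAddTorus (Fin n) → ℝ) (y : ℝ × (Fin n → ℝ)) :
    cylConv K f (cylCover n y) = ∫ w, f w • (K ∘ cylCover n) (y - cylSection n w) := by
  simp [cylConv, map_sub, cylCover_cylSection]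

theorem integral_eq_restrict_of_support {g : ℝ × UnitAddTorus (Fin n) → ℝ}
    (hg : ∀ z, f z = 0 → g z = 0)
    (hR : ∀ z, R < |z.1| → f z = 0) :
    ∫ w, g w = ∫ w in {w : ℝ × UnitAddTorus (Fin n) | |w.1| ≤ R}, g w := by
  refine (setIntegral_eq_integral_of_forall_compl_eq_zero fun z hz => hg z (hR z ?_)).symm
  simpa using hz

theorem ae_norm_cylSection_le (R : ℝ) :
    ∀ᵐ w ∂(volume.restrict {w : ℝ × UnitAddTorus (Fin n) | |w.1| ≤ R}),
      ‖cylSection n w‖ ≤ max R 1 := by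
  have : MeasurableSet {w : ℝ × UnitAddTorus (Fin n) | |w.1| ≤ R} :=
    measurableSet_le (by fun_prop) measurable_const
  filter_upwards [ae_restrict_mem this] with w hw
  exact (norm_cylSection_le w).trans (max_le_max hw le_rfl)

theorem IsSmooth.cylConv (hK : IsSmooth K) (hf : Integrable f) (hR : ∀ z, R < |z.1| → f z = 0) :
    IsSmooth (cylConv K f) := by
  rw [isSmooth_iff] at *
  have : _root_.cylConv K f ∘ cylCover n = fun y =>
      ∫ w in {w : ℝ × UnitAddTorus (Fin n) | |w.1| ≤ R},
        f w • (K ∘ cylCover n) (y - cylSection n w) := by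
    ext y
    rw [Function.comp_apply, cylConv_comp_cover]
    exact integral_eq_restrict_of_support (f := f) (fun z hz => by simp [hz]) hR
  rw [this]
  exact contDiff_integral_smul_comp_sub hf.integrableOn
    (measurable_cylSection n).aestronglyMeasurable (ae_norm_cylSection_le R) hK

theorem IsSmooth.integrable_cylConv (hK : IsSmooth K) (hf : Integrable f)
    (hR : ∀ z, R < |z.1| → f z = 0) (z : ℝ × UnitAddTorus (Fin n)) :
    Integrable fun w => f w * K (z - w) := by
  obtain ⟨y, rfl⟩ := cylCover_surjective n z
  have hK' := (isSmooth_iff.1 hK).continuous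
  have h1 := integrable_smul_comp_sub (μ := volume.restrict
    {w : ℝ × UnitAddTorus (Fin n) | |w.1| ≤ R}) hf.integrableOn
    (measurable_cylSection n).aestronglyMeasurable (ae_norm_cylSection_le R) hK' y
  have h2 : ∀ w, f w • (K ∘ cylCover n) (y - cylSection n w) = f w * K (cylCover n y - w) := by
    intro w
    simp [map_sub, cylCover_cylSection]
  simp_rw [h2] at h1
  refine IntegrableOn.integrable_of_forall_notMem_eq_zero h1 fun w hw => ?_
  rw [hR w (by simpa using hw), zero_mul]

theorem IsSmooth.dirDeriv_cylConv (hK : IsSmooth K) (hf : Integrable f)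
    (hR : ∀ z, R < |z.1| → f z = 0) (v : ℝ × (Fin n → ℝ)) (z : ℝ × UnitAddTorus (Fin n)) :
    dirDeriv v (_root_.cylConv K f) z = _root_.cylConv (dirDeriv v K) f z := by
  obtain ⟨y, rfl⟩ := cylCover_surjective n z
  rw [(hK.cylConv hf hR).dirDeriv_cover]
  have hK' := isSmooth_iff.1 hK
  have h0 : _root_.cylConv K f ∘ cylCover n = fun y =>
      ∫ w in {w : ℝ × UnitAddTorus (Fin n) | |w.1| ≤ R},
        f w • (K ∘ cylCover n) (y - cylSection n w) := by
    ext y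
    rw [Function.comp_apply, cylConv_comp_cover]
    exact integral_eq_restrict_of_support (f := f) (fun z hz => by simp [hz]) hR
  have h1 := hasFDerivAt_integral_smul_comp_sub (μ := volume.restrict
    {w : ℝ × UnitAddTorus (Fin n) | |w.1| ≤ R}) hf.integrableOn
    (measurable_cylSection n).aestronglyMeasurable (ae_norm_cylSection_le R)
    (hK'.of_le (by simp)) y
  have h2 := integrable_smul_comp_sub (μ := volume.restrict
    {w : ℝ × UnitAddTorus (Fin n) | |w.1| ≤ R}) hf.integrableOn
    (measurable_cylSection n).aestronglyMeasurable (ae_norm_cylSection_le R)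
    (hK'.continuous_fderiv (by simp)) y
  rw [h0, h1.fderiv, ContinuousLinearMap.integral_apply h2, cylConv_comp_cover]
  rw [integral_eq_restrict_of_support (f := f) (R := R) (fun z hz => by simp [hz]) hR]
  congr 1
  ext w
  simp only [Function.comp_apply, hK.dirDeriv_cover, smul_apply]

end CylConv

/-! ### Approximate identities in `L²` -/

section ApproximateIdentity

variable {H : Type*} [AddCommGroup H] [TopologicalSpace H] [IsTopologicalAddGroup H]
  [MeasurableSpace H] [BorelSpace H] {μ : Measure H}

theorem tendsto_eLpNorm_translate_sub [R1Space H] [IsLocallyFiniteMeasure μ]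
    [μ.InnerRegularCompactLTTop] [μ.IsAddRightInvariant] {f : H → ℝ} (hf : MemLp f 2 μ) :
    Tendsto (fun y => eLpNorm (fun x => f (x - y) - f x) 2 μ) (𝓝 0) (𝓝 0) := by
  let g : H → C(H, H) := fun y => (ContinuousMap.mk (fun a : H × H => a.2 - a.1)
    (by fun_prop)).curry y
  have hg : Continuous g := ContinuousMap.continuous _
  have hgm : ∀ y, MeasurePreserving (g y) μ μ := fun y => measurePreserving_sub_right μ y
  have h1 := Filter.Tendsto.compMeasurePreservingLp (μ := μ) (ν := μ) (p := 2)
    (tendsto_const_nhds (x := hf.toLp f)) (hg.tendsto 0) hgm (hgm 0) (by simp)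
  have h2 := tendsto_iff_edist_tendsto_0.1 h1
  refine h2.congr fun y => ?_
  rw [Lp.toLp_compMeasurePreserving hf (hgm y), Lp.toLp_compMeasurePreserving hf (hgm 0),
    Lp.edist_toLp_toLp]
  refine congrArg (fun F => eLpNorm F 2 μ) ?_
  ext x
  simp [g]

/-- Cauchy–Schwarz after splitting `k` into two square roots; for a probability density `k` this is
Jensen's inequality. -/
theorem lintegral_mul_sq_le {α : Type*} [MeasurableSpace α] {ν : Measure α} {k g : α → ℝ≥0∞}
    (hk : AEMeasurable k ν) (hg : AEMeasurable g ν) :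
    (∫⁻ a, k a * g a ∂ν) ^ 2 ≤ (∫⁻ a, k a ∂ν) * ∫⁻ a, k a * g a ^ 2 ∂ν := by
  have h := ENNReal.lintegral_mul_norm_pow_le (μ := ν) hk (hk.mul (hg.pow_const 2))
    (p := 1 / 2) (q := 1 / 2) (by norm_num) (by norm_num) (by norm_num)
  have h1 : ∀ a, k a ^ (1 / 2 : ℝ) * (k a * g a ^ 2) ^ (1 / 2 : ℝ) = k a * g a := by
    intro a
    rw [ENNReal.mul_rpow_of_nonneg _ _ (by norm_num), ← mul_assoc,
      ← ENNReal.rpow_add_of_nonneg _ _ (by norm_num) (by norm_num), ← ENNReal.rpow_natCast,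
      ← ENNReal.rpow_mul]
    norm_num
  simp only [Pi.mul_apply, h1] at h
  calc (∫⁻ a, k a * g a ∂ν) ^ 2
      ≤ ((∫⁻ a, k a ∂ν) ^ (1 / 2 : ℝ) * (∫⁻ a, k a * g a ^ 2 ∂ν) ^ (1 / 2 : ℝ)) ^ 2 := by gcongr
    _ = _ := by
      rw [mul_pow, ← ENNReal.rpow_natCast, ← ENNReal.rpow_natCast, ← ENNReal.rpow_mul,
        ← ENNReal.rpow_mul]
      norm_num

theorem eLpNorm_two_sq {α : Type*} [MeasurableSpace α] {ν : Measure α} (f : α → ℝ) :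
    eLpNorm f 2 ν ^ 2 = ∫⁻ a, ‖f a‖ₑ ^ 2 ∂ν := by
  have := eLpNorm_nnreal_pow_eq_lintegral (f := f) (μ := ν) (p := 2) (by norm_num)
  simpa using this

/-- As `K` is a probability density, `K * f - f` is a `K`-average of the differences `f (x - y) - f
x`. Jensen and Tonelli reduce its norm to the translates with `y` in the support of `K`. -/
theorem eLpNorm_convolution_sub_le [SecondCountableTopology H] [SFinite μ]
    [μ.IsAddLeftInvariant] [μ.IsNegInvariant]
    {K f : H → ℝ} (hK : Measurable K) (hK0 : ∀ y, 0 ≤ K y) (hK1 : ∫ y, K y ∂μ = 1)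
    (hf : AEStronglyMeasurable f μ)
    (hint : ∀ x, Integrable (fun w => f w * K (x - w)) μ) {e : ℝ≥0∞}
    (he : ∀ y, K y ≠ 0 → eLpNorm (fun x => f (x - y) - f x) 2 μ ≤ e) :
    eLpNorm (fun x => (∫ w, f w * K (x - w) ∂μ) - f x) 2 μ ≤ e := by
  have hKi : Integrable K μ := by
    by_contra h
    rw [integral_undef h] at hK1
    exact zero_ne_one hK1
  -- Tonelli needs joint measurability of `f (x - y)`, so `f` is first replaced by a strongly
  -- measurable representative.
  wlog hfm : StronglyMeasurable f generalizing f
  · obtain ⟨g, hg, hfg⟩ := hf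
    have hfg' : ∀ y, (fun x => f (x - y)) =ᵐ[μ] fun x => g (x - y) := fun y =>
      (measurePreserving_sub_right μ y).quasiMeasurePreserving.ae_eq_comp hfg
    have h1 : ∀ x, (fun w => f w * K (x - w)) =ᵐ[μ] fun w => g w * K (x - w) := fun x =>
      hfg.mul .rfl
    have := this hg.aestronglyMeasurable (fun x => (hint x).congr (h1 x)) (fun y hy => by
      refine (eLpNorm_congr_ae ?_).symm.trans_le (he y hy)
      filter_upwards [hfg, hfg' y] with x hx hx'
      rw [hx, hx']) hg
    refine le_trans (le_of_eq (eLpNorm_congr_ae ?_)) this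
    filter_upwards [hfg] with x hx
    rw [hx, integral_congr_ae (h1 x)]
  have hfm' := hfm.measurable
  have h1 : ∀ x, ‖(∫ w, f w * K (x - w) ∂μ) - f x‖ₑ ≤
      ∫⁻ y, ENNReal.ofReal (K y) * ‖f (x - y) - f x‖ₑ ∂μ := by
    intro x
    have e1 : ∫ w, f w * K (x - w) ∂μ = ∫ y, f (x - y) * K y ∂μ := by
      rw [← integral_sub_left_eq_self _ μ x]
      simp
    have i1 : Integrable (fun y => f (x - y) * K y) μ := by
      have := (integrable_comp_sub_left (fun w => f w * K (x - w)) x).2 (hint x)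
      simpa using this
    have e2 : f x = ∫ y, f x * K y ∂μ := by rw [integral_const_mul, hK1, mul_one]
    rw [e1, show (∫ y, f (x - y) * K y ∂μ) - f x = ∫ y, (f (x - y) * K y - f x * K y) ∂μ by
      rw [integral_sub i1 (hKi.const_mul _), ← e2]]
    refine (enorm_integral_le_lintegral_enorm _).trans (lintegral_mono fun y => ?_)
    simp only
    rw [← sub_mul, enorm_mul, mul_comm, Real.enorm_of_nonneg (hK0 y)]
  have hK2 : ∫⁻ y, ENNReal.ofReal (K y) ∂μ = 1 := by
    rw [← ofReal_integral_eq_lintegral_ofReal hKi (Eventually.of_forall hK0), hK1,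
      ENNReal.ofReal_one]
  have hmeas : Measurable fun p : H × H => ‖f (p.1 - p.2) - f p.1‖ₑ := by fun_prop
  rw [← ENNReal.pow_le_pow_left_iff two_ne_zero, eLpNorm_two_sq]
  calc ∫⁻ x, ‖(∫ w, f w * K (x - w) ∂μ) - f x‖ₑ ^ 2 ∂μ
      ≤ ∫⁻ x, ∫⁻ y, ENNReal.ofReal (K y) * ‖f (x - y) - f x‖ₑ ^ 2 ∂μ ∂μ := by
        refine lintegral_mono fun x => ?_
        have h2 := lintegral_mul_sq_le (ν := μ) (k := fun y => ENNReal.ofReal (K y))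
          (g := fun y => ‖f (x - y) - f x‖ₑ) (by fun_prop)
          (hmeas.comp measurable_prodMk_left).aemeasurable
        rw [hK2, one_mul] at h2
        exact (pow_le_pow_left' (h1 x) 2).trans h2
    _ = ∫⁻ y, ∫⁻ x, ENNReal.ofReal (K y) * ‖f (x - y) - f x‖ₑ ^ 2 ∂μ ∂μ := by
        refine lintegral_lintegral_swap ?_
        exact Measurable.aemeasurable (((hK.comp measurable_snd).ennreal_ofReal).mul
          (hmeas.pow_const 2))
    _ ≤ ∫⁻ y, ENNReal.ofReal (K y) * e ^ 2 ∂μ := by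
        refine lintegral_mono fun y => ?_
        have hm : Measurable fun x => ‖f (x - y) - f x‖ₑ ^ 2 :=
          (hmeas.comp measurable_prodMk_right).pow_const 2
        simp only
        rw [lintegral_const_mul _ hm]
        rcases eq_or_ne (K y) 0 with hy | hy
        · simp [hy]
        · gcongr
          rw [← eLpNorm_two_sq]
          gcongr
          exact he y hy
    _ = e ^ 2 := by rw [lintegral_mul_const _ (by fun_prop), hK2, one_mul]

end ApproximateIdentity

/-! ### Mollifying kernels in space and time -/

section Kernels

variable {n : ℕ}

/-- A smooth function on the torus that vanishes only at the origin. -/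
noncomputable def torusGauge (x : UnitAddTorus (Fin n)) : ℝ :=
  ∑ i, (1 - (fourier 1 (x i) : ℂ).re)

theorem isSmooth_torusGauge :
    IsSmooth fun z : ℝ × UnitAddTorus (Fin n) => torusGauge z.2 := by
  have : ((fun z : ℝ × UnitAddTorus (Fin n) => torusGauge z.2) ∘ cylCover n) =
      fun y => ∑ i, (1 - Real.cos (2 * Real.pi * y.2 i)) := by
    ext y
    simp only [torusGauge, Function.comp_apply, cylCover_snd]
    refine Finset.sum_congr rfl fun i _ => ?_
    rw [fourier_coe_apply]
    have : (2 * Real.pi * Complex.I * (1 : ℤ) * (y.2 i : ℝ) / (1 : ℝ) : ℂ) =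
        ((2 * Real.pi * y.2 i : ℝ) : ℂ) * Complex.I := by
      push_cast
      ring
    rw [this, Complex.exp_ofReal_mul_I_re]
  rw [isSmooth_iff, this]
  refine ContDiff.sum fun i _ => contDiff_const.sub (Real.contDiff_cos.comp ?_)
  fun_prop

theorem continuous_torusGauge : Continuous (torusGauge (n := n)) := by
  unfold torusGauge
  fun_prop

theorem re_fourier_one_le (x : UnitAddCircle) : (fourier 1 x : ℂ).re ≤ 1 :=
  (Complex.re_le_norm _).trans (by rw [fourier_one]; exact (Circle.norm_coe _).le)

theorem torusGauge_nonneg (x : UnitAddTorus (Fin n)) : 0 ≤ torusGauge x :=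
  Finset.sum_nonneg fun _ _ => sub_nonneg.2 (re_fourier_one_le _)

theorem torusGauge_zero : torusGauge (0 : UnitAddTorus (Fin n)) = 0 := by
  simp [torusGauge]

theorem eq_zero_of_torusGauge_eq_zero {x : UnitAddTorus (Fin n)} (h : torusGauge x = 0) :
    x = 0 := by
  ext i
  have h1 := (Finset.sum_eq_zero_iff_of_nonneg fun i _ =>
    sub_nonneg.2 (re_fourier_one_le (x i))).1 h i (Finset.mem_univ i)
  have hn : ‖(fourier 1 (x i) : ℂ)‖ = 1 := by
    rw [fourier_one]
    exact Circle.norm_coe _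
  have h2 : (fourier 1 (x i) : ℂ).re = 1 := by linarith
  have h3 : (fourier 1 (x i) : ℂ) = 1 := by
    have h4 := Complex.sq_norm (fourier 1 (x i) : ℂ)
    rw [hn, Complex.normSq_apply, h2] at h4
    refine Complex.ext h2 ?_
    have : (fourier 1 (x i) : ℂ).im * (fourier 1 (x i) : ℂ).im = 0 := by linarith
    simpa using this
  rw [fourier_one] at h3
  exact AddCircle.injective_toCircle one_ne_zero
    ((Circle.ext h3).trans (AddCircle.toCircle_zero (T := 1)).symm)

/-- By compactness the gauge is bounded below by some `δ > 0` outside `W`, so a smooth step function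
of `δ - torusGauge x`, suitably normalized, is supported in `W`. -/
theorem exists_torus_kernel {W : Set (UnitAddTorus (Fin n))} (hW : W ∈ 𝓝 0) :
    ∃ X : UnitAddTorus (Fin n) → ℝ, (IsSmooth fun z => X z.2) ∧ (∀ x, 0 ≤ X x) ∧
      ∫ x, X x = 1 ∧ ∀ x, X x ≠ 0 → x ∈ W := by
  obtain ⟨δ, hδ, hδW⟩ : ∃ δ > 0, ∀ x : UnitAddTorus (Fin n), torusGauge x < δ → x ∈ W := by
    rcases (interior W)ᶜ.eq_empty_or_nonempty with hE | hE
    · exact ⟨1, one_pos, fun x _ => interior_subset (by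
        rw [compl_empty_iff] at hE
        rw [hE]; trivial)⟩
    · obtain ⟨x₀, hx₀, hmin⟩ := (isOpen_interior (s := W)).isClosed_compl.isCompact.exists_isMinOn
        hE continuous_torusGauge.continuousOn
      refine ⟨torusGauge x₀, lt_of_le_of_ne (torusGauge_nonneg _) fun h => hx₀ ?_, fun x hx => ?_⟩
      · rw [eq_zero_of_torusGauge_eq_zero h.symm]
        exact mem_interior_iff_mem_nhds.2 hW
      · by_contra hxW
        exact (hmin (fun h => hxW (interior_subset h)) : torusGauge x₀ ≤ torusGauge x).not_gt hx
  let Y : UnitAddTorus (Fin n) → ℝ := fun x => Real.smoothTransition (δ - torusGauge x)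
  have hYs : IsSmooth fun z : ℝ × UnitAddTorus (Fin n) => Y z.2 :=
    IsSmooth.smooth_comp (g := fun s => Real.smoothTransition (δ - s))
      (Real.smoothTransition.contDiff.comp (contDiff_const.sub contDiff_id)) isSmooth_torusGauge
  have hYc : Continuous Y := by
    have := hYs.continuous.comp (Continuous.prodMk_right (0 : ℝ))
    exact this
  have hY0 : ∀ x, 0 ≤ Y x := fun x => Real.smoothTransition.nonneg _
  have hpos : 0 < ∫ x, Y x := by
    refine hYc.integral_pos_of_hasCompactSupport_nonneg_nonzero
      (HasCompactSupport.of_compactSpace _) hY0 (x := 0) ?_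
    exact (Real.smoothTransition.pos_of_pos (by rw [torusGauge_zero]; linarith)).ne'
  refine ⟨fun x => (∫ x, Y x)⁻¹ * Y x, ?_, fun x => mul_nonneg (inv_nonneg.2 hpos.le) (hY0 x), ?_,
    fun x hx => hδW x ?_⟩
  · exact IsSmooth.smooth_comp (g := fun s => (∫ x, Y x)⁻¹ * s) (by fun_prop) hYs
  · rw [integral_const_mul, inv_mul_cancel₀ hpos.ne']
  · by_contra h
    exact hx (by simp [Y, Real.smoothTransition.zero_of_nonpos (by linarith : δ - torusGauge x ≤ 0)])

/-- Support in strictly positive times makes the mollification causal: its value at time `t` depends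
only on earlier times, so no extension beyond `T` is needed. -/
theorem exists_time_kernel {ε : ℝ} (hε : 0 < ε) :
    ∃ θ : ℝ → ℝ, ContDiff ℝ ∞ θ ∧ (∀ s, 0 ≤ θ s) ∧ ∫ s, θ s = 1 ∧ ∀ s, θ s ≠ 0 → s ∈ Ioo 0 ε := by
  let f : ContDiffBump (ε / 2) := ⟨ε / 4, ε / 2, by linarith, by linarith⟩
  refine ⟨f.normed volume, f.contDiff_normed, fun s => f.nonneg_normed s, f.integral_normed,
    fun s hs => ?_⟩
  have : s ∈ Function.support (f.normed volume) := hs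
  rw [f.support_normed_eq, Real.ball_eq_Ioo] at this
  simpa [f] using this

end Kernels

/-! ### The measure of the cylinder -/

section CylinderMeasure

variable {n : ℕ} {T : ℝ}

instance instIsAddHaarMeasureCylinder :
    (volume : Measure (ℝ × UnitAddTorus (Fin n))).IsAddHaarMeasure :=
  Measure.prod.instIsAddHaarMeasure _ _

instance instRegularCylinder : (volume : Measure (ℝ × UnitAddTorus (Fin n))).Regular :=
  Measure.Regular.of_sigmaCompactSpace_of_isLocallyFiniteMeasure _

instance instIsNegInvariantTorus : (volume : Measure (UnitAddTorus (Fin n))).IsNegInvariant :=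
  Measure.IsAddHaarMeasure.isNegInvariant_of_regular _

instance instIsNegInvariantCylinder :
    (volume : Measure (ℝ × UnitAddTorus (Fin n))).IsNegInvariant :=
  Measure.IsAddHaarMeasure.isNegInvariant_of_regular _

instance instIsFiniteMeasureParabolicCylinder : IsFiniteMeasure (parabolicCylinder n T) := by
  unfold parabolicCylinder
  infer_instance

theorem parabolicCylinder_eq_restrict (n : ℕ) (T : ℝ) :
    parabolicCylinder n T = volume.restrict (Ioo 0 T ×ˢ univ) := by
  rw [parabolicCylinder, Measure.volume_eq_prod, ← Measure.prod_restrict, Measure.restrict_univ]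

theorem ae_mem_parabolicCylinder (n : ℕ) (T : ℝ) :
    ∀ᵐ z ∂(parabolicCylinder n T), z.1 ∈ Ioo 0 T := by
  rw [parabolicCylinder_eq_restrict]
  filter_upwards [ae_restrict_mem (measurableSet_Ioo.prod MeasurableSet.univ)] with z hz
  exact hz.1

theorem Continuous.memLp_top_parabolicCylinder {E : Type*} [NormedAddCommGroup E]
    [SecondCountableTopologyEither (ℝ × UnitAddTorus (Fin n)) E]
    {F : ℝ × UnitAddTorus (Fin n) → E} (h : Continuous F) : MemLp F ⊤ (parabolicCylinder n T) := by
  obtain ⟨C, -, hC⟩ := h.exists_bound_cyl 0 T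
  refine memLp_top_of_bound h.aestronglyMeasurable C ?_
  filter_upwards [ae_mem_parabolicCylinder n T] with z hz
  exact hC z (Ioo_subset_Icc_self hz)

theorem integrable_mul_continuous {h F : ℝ × UnitAddTorus (Fin n) → ℝ}
    (hh : Integrable h (parabolicCylinder n T)) (hF : Continuous F) :
    Integrable (fun z => h z * F z) (parabolicCylinder n T) := by
  obtain ⟨C, -, hC⟩ := hF.exists_bound_cyl 0 T
  refine hh.mul_bdd hF.aestronglyMeasurable (c := C) ?_
  filter_upwards [ae_mem_parabolicCylinder n T] with z hz
  exact hC z (Ioo_subset_Icc_self hz)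

theorem integrable_inner_continuous {b F : ℝ × UnitAddTorus (Fin n) → EuclideanSpace ℝ (Fin n)}
    (hb : Integrable b (parabolicCylinder n T)) (hF : Continuous F) :
    Integrable (fun z => inner ℝ (b z) (F z)) (parabolicCylinder n T) := by
  obtain ⟨C, -, hC⟩ := hF.exists_bound_cyl 0 T
  refine (hb.norm.mul_const C).mono' (hb.aestronglyMeasurable.inner hF.aestronglyMeasurable) ?_
  filter_upwards [ae_mem_parabolicCylinder n T] with z hz
  refine (norm_inner_le_norm _ _).trans ?_
  gcongr
  exact hC z (Ioo_subset_Icc_self hz)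

end CylinderMeasure

/-! ### Causal mollification of the energy class -/

/-- A function `ρ` with spatial gradient `G` and `∂ₜρ = f + div F`, with initial datum `ρ₀`, all in
the weak sense and square integrable. -/
structure IsEnergyData {n : ℕ} (T : ℝ) (ρ₀ : UnitAddTorus (Fin n) → ℝ)
    (ρ : ℝ × UnitAddTorus (Fin n) → ℝ) (G : ℝ × UnitAddTorus (Fin n) → EuclideanSpace ℝ (Fin n))
    (f : ℝ × UnitAddTorus (Fin n) → ℝ) (F : ℝ × UnitAddTorus (Fin n) → EuclideanSpace ℝ (Fin n)) :
    Prop where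
  initial : MemLp ρ₀ 2 volume
  memLp : MemLp ρ 2 (parabolicCylinder n T)
  memLp_grad : MemLp G 2 (parabolicCylinder n T)
  memLp_source : MemLp f 2 (parabolicCylinder n T)
  memLp_flux : MemLp F 2 (parabolicCylinder n T)
  grad : ∀ φ, IsInitialTest T φ → ∀ i,
    ∫ z, ρ z * spaceGrad φ z i ∂(parabolicCylinder n T) = -∫ z, G z i * φ z ∂(parabolicCylinder n T)
  time : ∀ φ, IsInitialTest T φ → -∫ z, ρ z * timeDeriv φ z ∂(parabolicCylinder n T)
    = (∫ z, (f z * φ z - inner ℝ (F z) (spaceGrad φ z)) ∂(parabolicCylinder n T)) + ∫ x, ρ₀ x * φ (0, x)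

section Mollification

variable {n : ℕ} {T : ℝ} {ρ₀ : UnitAddTorus (Fin n) → ℝ} {ρ f : ℝ × UnitAddTorus (Fin n) → ℝ}
  {G F : ℝ × UnitAddTorus (Fin n) → EuclideanSpace ℝ (Fin n)} {K h : ℝ × UnitAddTorus (Fin n) → ℝ}

theorem MemLp.coord {μ : Measure (ℝ × UnitAddTorus (Fin n))} (hG : MemLp G 2 μ) (i : Fin n) :
    MemLp (fun z => G z i) 2 μ :=
  hG.of_le ((EuclideanSpace.proj i : EuclideanSpace ℝ (Fin n) →L[ℝ] ℝ).continuous.comp_aestronglyMeasurable hG.1)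
    (Eventually.of_forall fun z => PiLp.norm_apply_le (G z) i)

/-- Causality of the kernel is what makes the reflected kernel an admissible test function, for
every base point with time below `T`. -/
theorem IsSmooth.isInitialTest_comp_sub_left (hK : IsSmooth K) (hK0 : ∀ z, z.1 ≤ 0 → K z = 0)
    {z : ℝ × UnitAddTorus (Fin n)} (hz : z.1 < T) : IsInitialTest T fun w => K (z - w) :=
  ⟨hK.comp_sub_left z, z.1, hz, fun t x ht => hK0 _ (by simp; linarith)⟩

theorem IsEnergyData.integral_mul_spaceKernel (hd : IsEnergyData T ρ₀ ρ G f F) (hK : IsSmooth K)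
    (hK0 : ∀ z, z.1 ≤ 0 → K z = 0) {z : ℝ × UnitAddTorus (Fin n)} (hz : z.1 < T) (i : Fin n) :
    ∫ w, ρ w * dirDeriv (0, Pi.single i 1) K (z - w) ∂(parabolicCylinder n T) =
      ∫ w, G w i * K (z - w) ∂(parabolicCylinder n T) := by
  have := hd.grad _ (hK.isInitialTest_comp_sub_left hK0 hz) i
  simp only [spaceGrad_eq, dirDeriv_comp_sub_left, mul_neg, integral_neg, neg_inj] at this
  exact this

theorem IsEnergyData.integral_mul_timeKernel (hd : IsEnergyData T ρ₀ ρ G f F) (hK : IsSmooth K)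
    (hK0 : ∀ z, z.1 ≤ 0 → K z = 0) {z : ℝ × UnitAddTorus (Fin n)} (hz : z.1 < T) :
    ∫ w, ρ w * dirDeriv (1, 0) K (z - w) ∂(parabolicCylinder n T) =
      (∫ w, f w * K (z - w) ∂(parabolicCylinder n T)) +
      (∑ i, ∫ w, F w i * dirDeriv (0, Pi.single i 1) K (z - w) ∂(parabolicCylinder n T)) +
      ∫ x, ρ₀ x * K (z - (0, x)) := by
  have := hd.time _ (hK.isInitialTest_comp_sub_left hK0 hz)
  simp only [timeDeriv_eq, dirDeriv_comp_sub_left, mul_neg, integral_neg, neg_neg] at this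
  rw [this]
  congr 1
  have e1 : ∀ w, inner ℝ (F w) (spaceGrad (fun w => K (z - w)) w) =
      -∑ i, F w i * dirDeriv (0, Pi.single i 1) K (z - w) := by
    intro w
    rw [PiLp.inner_apply, ← Finset.sum_neg_distrib]
    refine Finset.sum_congr rfl fun i _ => ?_
    rw [spaceGrad_eq, dirDeriv_comp_sub_left]
    simp [mul_comm]
  have i1 : Integrable (fun w => f w * K (z - w)) (parabolicCylinder n T) :=
    integrable_mul_continuous (hd.memLp_source.integrable (by norm_num))
      (hK.comp_sub_left z).continuous
  have i2 : ∀ i : Fin n, Integrable (fun w => F w i * dirDeriv (0, Pi.single i 1) K (z - w))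
      (parabolicCylinder n T) := fun i =>
    integrable_mul_continuous ((MemLp.coord hd.memLp_flux i).integrable (by norm_num))
      ((hK.smooth_dirDeriv _).comp_sub_left z).continuous
  simp_rw [e1, sub_neg_eq_add]
  rw [integral_add i1 (integrable_finsetSum _ fun i _ => i2 i),
    integral_finsetSum _ fun i _ => i2 i]

theorem cylConv_indicator {S : Set (ℝ × UnitAddTorus (Fin n))} (hS : MeasurableSet S)
    (K h : ℝ × UnitAddTorus (Fin n) → ℝ) (z : ℝ × UnitAddTorus (Fin n)) :
    cylConv K (S.indicator h) z = ∫ w in S, h w * K (z - w) := by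
  rw [cylConv, ← integral_indicator hS]
  congr 1
  ext w
  by_cases hw : w ∈ S <;> simp [hw]

/-- The kernel is a product, so the contribution of the constant-in-time extension by `ρ₀` separates
into a primitive of `θ` and a convolution in space. -/
theorem integral_initialLayer_mul {θ : ℝ → ℝ} {Y : UnitAddTorus (Fin n) → ℝ}
    (z : ℝ × UnitAddTorus (Fin n)) :
    ∫ w in Ioc (-1) 0 ×ˢ (univ : Set (UnitAddTorus (Fin n))),
      ρ₀ w.2 * (θ (z - w).1 * Y (z - w).2) =
    (∫ s in (z.1)..(z.1 + 1), θ s) * ∫ x, ρ₀ x * Y (z.2 - x) := by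
  have h1 := setIntegral_prod_mul (μ := (volume : Measure ℝ))
    (ν := (volume : Measure (UnitAddTorus (Fin n)))) (fun s => θ (z.1 - s))
    (fun x => ρ₀ x * Y (z.2 - x)) (Ioc (-1) 0) univ
  have h2 : ∫ s in Ioc (-1) 0, θ (z.1 - s) = ∫ s in (z.1)..(z.1 + 1), θ s := by
    rw [← intervalIntegral.integral_of_le (by norm_num), intervalIntegral.integral_comp_sub_left]
    simp
  rw [h2, Measure.restrict_univ] at h1
  rw [← h1, Measure.volume_eq_prod]
  congr 1
  ext w
  simp only [Prod.fst_sub, Prod.snd_sub]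
  ring

end Mollification

/-! ### Smooth approximation up to the initial time -/

section SmoothApproximation

variable {n : ℕ} {T : ℝ} {ρ₀ : UnitAddTorus (Fin n) → ℝ} {ρ f : ℝ × UnitAddTorus (Fin n) → ℝ}
  {G F : ℝ × UnitAddTorus (Fin n) → EuclideanSpace ℝ (Fin n)} {K h : ℝ × UnitAddTorus (Fin n) → ℝ}

theorem measurableSet_slab {I : Set ℝ} (hI : MeasurableSet I) :
    MeasurableSet (I ×ˢ (univ : Set (UnitAddTorus (Fin n)))) := hI.prod MeasurableSet.univ

theorem memLp_cylinder_indicator (hh : MemLp h 2 (parabolicCylinder n T)) :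
    MemLp ((Ioo 0 T ×ˢ univ).indicator h) 2 volume := by
  rw [memLp_indicator_iff_restrict (measurableSet_slab measurableSet_Ioo),
    ← parabolicCylinder_eq_restrict]
  exact hh

theorem integrable_cylinder_indicator (hh : MemLp h 2 (parabolicCylinder n T)) :
    Integrable ((Ioo 0 T ×ˢ univ).indicator h) := by
  rw [integrable_indicator_iff (measurableSet_slab measurableSet_Ioo), IntegrableOn,
    ← parabolicCylinder_eq_restrict]
  exact hh.integrable (by norm_num)

theorem cylinder_indicator_support (h : ℝ × UnitAddTorus (Fin n) → ℝ) :
    ∀ z, max T 1 < |z.1| → (Ioo 0 T ×ˢ univ).indicator h z = 0 := fun z hz => by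
  refine indicator_of_notMem (fun hm => ?_) _
  have h1 := hm.1
  rw [abs_of_pos h1.1] at hz
  exact (lt_irrefl T) (((le_max_left T 1).trans_lt hz).trans h1.2)

theorem memLp_initialLayer_indicator (hρ₀ : MemLp ρ₀ 2 volume) :
    MemLp ((Ioc (-1) 0 ×ˢ univ).indicator fun z : ℝ × UnitAddTorus (Fin n) => ρ₀ z.2) 2 volume := by
  rw [memLp_indicator_iff_restrict (measurableSet_slab measurableSet_Ioc), Measure.volume_eq_prod,
    ← Measure.prod_restrict, Measure.restrict_univ]
  exact hρ₀.comp_snd _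

theorem integrable_initialLayer_indicator (hρ₀ : MemLp ρ₀ 2 volume) :
    Integrable ((Ioc (-1) 0 ×ˢ univ).indicator fun z : ℝ × UnitAddTorus (Fin n) => ρ₀ z.2) := by
  rw [integrable_indicator_iff (measurableSet_slab measurableSet_Ioc), IntegrableOn,
    Measure.volume_eq_prod, ← Measure.prod_restrict, Measure.restrict_univ]
  exact (hρ₀.comp_snd _).integrable (by norm_num)

theorem initialLayer_indicator_support (ρ₀ : UnitAddTorus (Fin n) → ℝ) :
    ∀ z, max T 1 < |z.1| → (Ioc (-1) 0 ×ˢ univ).indicator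
      (fun z : ℝ × UnitAddTorus (Fin n) => ρ₀ z.2) z = 0 := fun z hz => by
  refine indicator_of_notMem (fun hm => ?_) _
  have h1 := hm.1
  rw [abs_of_nonpos h1.2] at hz
  have := (le_max_right T 1).trans_lt hz
  linarith [h1.1]

theorem cylConv_add {h₁ h₂ : ℝ × UnitAddTorus (Fin n) → ℝ} {z : ℝ × UnitAddTorus (Fin n)}
    (i₁ : Integrable fun w => h₁ w * K (z - w)) (i₂ : Integrable fun w => h₂ w * K (z - w)) :
    cylConv K (h₁ + h₂) z = cylConv K h₁ z + cylConv K h₂ z := by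
  simp only [cylConv, Pi.add_apply, add_mul]
  exact integral_add i₁ i₂

/-- The extension of `ρ` by `ρ₀` to negative times. -/
noncomputable def backwardExtension (T : ℝ) (ρ₀ : UnitAddTorus (Fin n) → ℝ)
    (ρ : ℝ × UnitAddTorus (Fin n) → ℝ) : ℝ × UnitAddTorus (Fin n) → ℝ :=
  (Ioo 0 T ×ˢ univ).indicator ρ + (Ioc (-1) 0 ×ˢ univ).indicator fun z => ρ₀ z.2

theorem backwardExtension_support (T : ℝ) (ρ₀ : UnitAddTorus (Fin n) → ℝ)
    (ρ : ℝ × UnitAddTorus (Fin n) → ℝ) :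
    ∀ z, max T 1 < |z.1| → backwardExtension T ρ₀ ρ z = 0 := fun z hz => by
  rw [backwardExtension, Pi.add_apply, cylinder_indicator_support ρ z hz,
    initialLayer_indicator_support ρ₀ z hz, add_zero]

theorem cylConv_backwardExtension (hρ₀ : MemLp ρ₀ 2 volume) (hρ : MemLp ρ 2 (parabolicCylinder n T))
    (hK : IsSmooth K) (z : ℝ × UnitAddTorus (Fin n)) :
    cylConv K (backwardExtension T ρ₀ ρ) z =
      (∫ w, ρ w * K (z - w) ∂(parabolicCylinder n T)) +
        ∫ w in Ioc (-1) 0 ×ˢ (univ : Set (UnitAddTorus (Fin n))), ρ₀ w.2 * K (z - w) := by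
  rw [backwardExtension, cylConv_add
    (hK.integrable_cylConv (integrable_cylinder_indicator hρ) (cylinder_indicator_support ρ) z)
    (hK.integrable_cylConv (integrable_initialLayer_indicator hρ₀)
      (initialLayer_indicator_support (T := T) ρ₀) z),
    cylConv_indicator (measurableSet_slab measurableSet_Ioo),
    cylConv_indicator (measurableSet_slab measurableSet_Ioc), parabolicCylinder_eq_restrict]

theorem eLpNorm_cylConv_sub_le {a : ℝ≥0∞} (hK : IsSmooth K) (hK0 : ∀ z, 0 ≤ K z)
    (hK1 : ∫ z, K z = 1) {hx : ℝ × UnitAddTorus (Fin n) → ℝ} (hi : Integrable hx)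
    (hs : ∀ z, max T 1 < |z.1| → hx z = 0) (hxh : ∀ z, z.1 ∈ Ioo 0 T → hx z = h z)
    (he : ∀ y, K y ≠ 0 → eLpNorm (fun x => hx (x - y) - hx x) 2 volume ≤ a) :
    eLpNorm (fun z => cylConv K hx z - h z) 2 (parabolicCylinder n T) ≤ a := by
  refine le_trans ?_ (eLpNorm_convolution_sub_le hK.continuous.measurable hK0 hK1
    hi.aestronglyMeasurable (hK.integrable_cylConv hi hs) he)
  refine le_trans (le_of_eq (eLpNorm_congr_ae (g := fun z => cylConv K hx z - hx z) ?_)) ?_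
  · filter_upwards [ae_mem_parabolicCylinder n T] with z hz
    rw [hxh z hz]
  · rw [parabolicCylinder_eq_restrict]
    exact eLpNorm_mono_measure _ Measure.restrict_le_self

theorem dirDeriv_snd (X : UnitAddTorus (Fin n) → ℝ) (v : ℝ × (Fin n → ℝ))
    (z : ℝ × UnitAddTorus (Fin n)) :
    dirDeriv v (fun z => X z.2) z = dirDeriv v (fun z => X z.2) (0, z.2) := rfl

variable {θ : ℝ → ℝ} {X : UnitAddTorus (Fin n) → ℝ}

theorem dirDeriv_space_kernel (hθ : ContDiff ℝ ∞ θ) (hX : IsSmooth fun z => X z.2)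
    (e : Fin n → ℝ) (z : ℝ × UnitAddTorus (Fin n)) :
    dirDeriv (0, e) (fun z => θ z.1 * X z.2) z =
      θ z.1 * dirDeriv (0, e) (fun z => X z.2) (0, z.2) := by
  rw [(isSmooth_time hθ).dirDeriv_mul hX, ← dirDeriv_snd]
  have : dirDeriv (0, e) (fun z : ℝ × UnitAddTorus (Fin n) => θ z.1) z = 0 := by
    simp [dirDeriv]
  rw [this, zero_mul, zero_add]

theorem dirDeriv_time_kernel (hθ : ContDiff ℝ ∞ θ) (hX : IsSmooth fun z => X z.2)
    (z : ℝ × UnitAddTorus (Fin n)) :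
    dirDeriv (1, 0) (fun z => θ z.1 * X z.2) z = deriv θ z.1 * X z.2 := by
  rw [(isSmooth_time hθ).dirDeriv_mul hX, ← timeDeriv_eq, ← timeDeriv_eq, timeDeriv_time]
  have : timeDeriv (fun z : ℝ × UnitAddTorus (Fin n) => X z.2) z = 0 := by
    simp [timeDeriv]
  rw [this, mul_zero, add_zero]

theorem intervalIntegral_kernel_eq {ε t : ℝ} (hθs : ∀ s, θ s ≠ 0 → s ∈ Ioo 0 ε)
    (ht : t ≤ 0) (h1 : ε ≤ t + 1) : ∫ s in t..(t + 1), θ s = ∫ s, θ s := by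
  rw [intervalIntegral.integral_of_le (by linarith)]
  refine setIntegral_eq_integral_of_forall_compl_eq_zero fun s hs => ?_
  by_contra h
  have := hθs s h
  exact hs ⟨ht.trans_lt this.1, this.2.le.trans h1⟩

/-- The time factor lies in `[0,1]` and vanishes after time `ε`, while the space factor is at most
`B ‖ρ₀‖₁`. The layer therefore has `L²` norm of order `ε ^ (1/2)`, with `B` allowed to be large. -/
theorem eLpNorm_initialLayer_le {ε B : ℝ} (hθ0 : ∀ s, 0 ≤ θ s)
    (hθ1 : ∫ s, θ s = 1) (hθs : ∀ s, θ s ≠ 0 → s ∈ Ioo 0 ε) {Y : UnitAddTorus (Fin n) → ℝ}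
    (hY : ∀ x, |Y x| ≤ B) (hρ₀ : MemLp ρ₀ 2 volume) :
    eLpNorm (fun z => (∫ s in (z.1)..(z.1 + 1), θ s) * ∫ x, ρ₀ x * Y (z.2 - x)) 2
      (parabolicCylinder n T) ≤ ENNReal.ofReal (B * ∫ x, |ρ₀ x|) * ENNReal.ofReal ε ^ (1 / 2 : ℝ) := by
  have hB : 0 ≤ B := (abs_nonneg _).trans (hY 0)
  have hθi : Integrable θ := by
    by_contra h
    rw [integral_undef h] at hθ1
    exact zero_ne_one hθ1
  have h1 : ∀ x, |∫ x', ρ₀ x' * Y (x - x')| ≤ B * ∫ x, |ρ₀ x| := by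
    intro x
    rw [← integral_const_mul]
    refine (abs_integral_le_integral_abs).trans (integral_mono_of_nonneg
      (Eventually.of_forall fun _ => abs_nonneg _)
      ((hρ₀.integrable (by norm_num)).abs.const_mul B) (Eventually.of_forall fun x' => ?_))
    simp only [abs_mul]
    rw [mul_comm]
    gcongr
    exact hY _
  have h2 : ∀ z : ℝ × UnitAddTorus (Fin n), z.1 ∈ Ioo 0 T →
      ‖(∫ s in (z.1)..(z.1 + 1), θ s) * ∫ x, ρ₀ x * Y (z.2 - x)‖ ≤
      ‖(Ioo 0 ε ×ˢ univ).indicator (fun _ : ℝ × UnitAddTorus (Fin n) => B * ∫ x, |ρ₀ x|) z‖ := by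
    intro z hz
    have h0 : 0 ≤ ∫ s in (z.1)..(z.1 + 1), θ s :=
      intervalIntegral.integral_nonneg (by linarith) fun s _ => hθ0 s
    by_cases hzε : z.1 < ε
    · rw [indicator_of_mem (show z ∈ Ioo 0 ε ×ˢ univ from ⟨⟨hz.1, hzε⟩, trivial⟩), norm_mul,
        Real.norm_of_nonneg h0]
      have h3 : ∫ s in (z.1)..(z.1 + 1), θ s ≤ 1 := by
        rw [intervalIntegral.integral_of_le (by linarith), ← hθ1]
        exact setIntegral_le_integral hθi (Eventually.of_forall hθ0)
      calc _ ≤ 1 * ‖∫ x, ρ₀ x * Y (z.2 - x)‖ := by gcongr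
        _ ≤ B * ∫ x, |ρ₀ x| := by rw [one_mul]; exact h1 _
        _ ≤ _ := le_abs_self _
    · have h3 : ∫ s in (z.1)..(z.1 + 1), θ s = 0 := by
        rw [intervalIntegral.integral_of_le (by linarith)]
        refine setIntegral_eq_zero_of_forall_eq_zero fun s hs => ?_
        by_contra h
        linarith [(hθs s h).2, hs.1]
      rw [h3, zero_mul, norm_zero]
      positivity
  calc _ ≤ eLpNorm ((Ioo 0 ε ×ˢ univ).indicator
          (fun _ : ℝ × UnitAddTorus (Fin n) => B * ∫ x, |ρ₀ x|)) 2 (parabolicCylinder n T) := by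
        refine eLpNorm_mono_ae ?_
        filter_upwards [ae_mem_parabolicCylinder n T] with z hz using h2 z hz
    _ ≤ eLpNorm ((Ioo 0 ε ×ˢ univ).indicator
          (fun _ : ℝ × UnitAddTorus (Fin n) => B * ∫ x, |ρ₀ x|)) 2 volume := by
        rw [parabolicCylinder_eq_restrict]
        exact eLpNorm_mono_measure _ Measure.restrict_le_self
    _ = _ := by
        rw [eLpNorm_indicator_const (measurableSet_slab measurableSet_Ioo) (by norm_num) (by norm_num),
          Real.enorm_of_nonneg (mul_nonneg hB (integral_nonneg fun _ => abs_nonneg _)),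
          Measure.volume_eq_prod, Measure.prod_prod, Real.volume_Ioo, measure_univ]
        simp

end SmoothApproximation

/-- A smooth solution of `∂ₜu = f' + div F'` on `[0,T)` that is `a`-close in `L²` to energy data. -/
structure IsSmoothApprox {n : ℕ} (T : ℝ) (ρ₀ : UnitAddTorus (Fin n) → ℝ)
    (ρ : ℝ × UnitAddTorus (Fin n) → ℝ) (G : ℝ × UnitAddTorus (Fin n) → EuclideanSpace ℝ (Fin n))
    (f : ℝ × UnitAddTorus (Fin n) → ℝ) (F : ℝ × UnitAddTorus (Fin n) → EuclideanSpace ℝ (Fin n))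
    (a : ℝ≥0∞) (u f' : ℝ × UnitAddTorus (Fin n) → ℝ) (F' : Fin n → ℝ × UnitAddTorus (Fin n) → ℝ) :
    Prop where
  smooth : IsSmooth u
  smooth_source : IsSmooth f'
  smooth_flux : ∀ i, IsSmooth (F' i)
  time : ∀ z : ℝ × UnitAddTorus (Fin n), z.1 ∈ Ico 0 T →
    timeDeriv u z = f' z + ∑ i, spaceGrad (F' i) z i
  close : eLpNorm (fun z => u z - ρ z) 2 (parabolicCylinder n T) ≤ a
  close_grad : ∀ i, eLpNorm (fun z => spaceGrad u z i - G z i) 2 (parabolicCylinder n T) ≤ a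
  close_source : eLpNorm (fun z => f' z - f z) 2 (parabolicCylinder n T) ≤ a
  close_flux : ∀ i, eLpNorm (fun z => F' i z - F z i) 2 (parabolicCylinder n T) ≤ a
  close_initial : eLpNorm (fun x => u (0, x) - ρ₀ x) 2 volume ≤ a

section

variable {n : ℕ} {T : ℝ} {ρ₀ : UnitAddTorus (Fin n) → ℝ} {ρ f : ℝ × UnitAddTorus (Fin n) → ℝ}
  {G F : ℝ × UnitAddTorus (Fin n) → EuclideanSpace ℝ (Fin n)}

/-- Extending `ρ` by `ρ₀` to the times `(-1,0]` removes the jump at time zero, so the causal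
mollification solves the mollified equation exactly on `[0,T)`. The gradient is the exception: `ρ₀`
has no square integrable gradient, so on the layer the derivative stays on the kernel. That error is
made small by shortening the kernel in time after its spatial part has been fixed. -/
theorem IsEnergyData.exists_isSmoothApprox (hd : IsEnergyData T ρ₀ ρ G f F) {a : ℝ≥0∞}
    (ha : a ≠ 0) : ∃ u f' F', IsSmoothApprox T ρ₀ ρ G f F a u f' F' := by
  let ρx := backwardExtension T ρ₀ ρ
  let ext : (ℝ × UnitAddTorus (Fin n) → ℝ) → ℝ × UnitAddTorus (Fin n) → ℝ :=
    fun h => (Ioo 0 T ×ˢ univ).indicator h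
  have hext : ∀ h : ℝ × UnitAddTorus (Fin n) → ℝ, ∀ z, z.1 ∈ Ioo 0 T → ext h z = h z :=
    fun h z hz => indicator_of_mem (show z ∈ Ioo 0 T ×ˢ univ from ⟨hz, trivial⟩) _
  have hρx : ∀ z, z.1 ∈ Ioo 0 T → ρx z = ρ z := fun z hz => by
    have h1 : z ∉ Ioc (-1 : ℝ) 0 ×ˢ (univ : Set (UnitAddTorus (Fin n))) := fun h => by
      linarith [h.1.2, hz.1]
    simp only [ρx, backwardExtension, Pi.add_apply, indicator_of_notMem h1, add_zero]
    exact hext ρ z hz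
  have mρ : MemLp ρx 2 volume :=
    (memLp_cylinder_indicator hd.memLp).add (memLp_initialLayer_indicator hd.initial)
  have iρ : Integrable ρx :=
    (integrable_cylinder_indicator hd.memLp).add (integrable_initialLayer_indicator hd.initial)
  have sρ := backwardExtension_support T ρ₀ ρ
  have mG : ∀ i, MemLp (fun z => G z i) 2 (parabolicCylinder n T) := MemLp.coord hd.memLp_grad
  have mF : ∀ i, MemLp (fun z => F z i) 2 (parabolicCylinder n T) := MemLp.coord hd.memLp_flux
  have ha2 : a / 2 ≠ 0 := (ENNReal.half_pos ha).ne'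
  have haa : a / 2 ≤ a := ENNReal.half_le_self
  -- neighbourhoods on which translations are close to the identity
  have near : ∀ {h : ℝ × UnitAddTorus (Fin n) → ℝ}, MemLp h 2 volume →
      ∀ᶠ y in 𝓝 0, eLpNorm (fun x => h (x - y) - h x) 2 volume ≤ a / 2 := fun hh =>
    (tendsto_eLpNorm_translate_sub hh).eventually (ge_mem_nhds (pos_iff_ne_zero.2 ha2))
  have hV : ∀ᶠ y : ℝ × UnitAddTorus (Fin n) in 𝓝 0,
      eLpNorm (fun x => ρx (x - y) - ρx x) 2 volume ≤ a / 2 ∧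
      eLpNorm (fun x => ext f (x - y) - ext f x) 2 volume ≤ a / 2 ∧
      (∀ i, eLpNorm (fun x => ext (fun z => G z i) (x - y) - ext (fun z => G z i) x) 2 volume
        ≤ a / 2) ∧
      ∀ i, eLpNorm (fun x => ext (fun z => F z i) (x - y) - ext (fun z => F z i) x) 2 volume
        ≤ a / 2 :=
    (near mρ).and ((near (memLp_cylinder_indicator hd.memLp_source)).and
      ((eventually_all.2 fun i => near (memLp_cylinder_indicator (mG i))).and
        (eventually_all.2 fun i => near (memLp_cylinder_indicator (mF i)))))
  rw [show (0 : ℝ × UnitAddTorus (Fin n)) = (0, 0) from rfl, nhds_prod_eq] at hV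
  obtain ⟨A, hA, W, hW, hAW⟩ := Filter.eventually_prod_iff.1 hV
  obtain ⟨ε₀, hε₀, hε₀A⟩ := Metric.eventually_nhds_iff.1 hA
  obtain ⟨X, hXs, hX0, hX1, hXW⟩ := exists_torus_kernel (W := {x | W x} ∩
    {x | eLpNorm (fun y => ρ₀ (y - x) - ρ₀ y) 2 volume ≤ a})
    (inter_mem hW ((tendsto_eLpNorm_translate_sub hd.initial).eventually
      (ge_mem_nhds (pos_iff_ne_zero.2 ha))))
  let Y : Fin n → UnitAddTorus (Fin n) → ℝ := fun i x =>
    dirDeriv (0, Pi.single i 1) (fun z => X z.2) (0, x)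
  obtain ⟨B, hB⟩ : ∃ B : ℝ, ∀ i x, |Y i x| ≤ B := by
    have : ∀ i, ∃ B : ℝ, ∀ x, |Y i x| ≤ B := fun i => by
      obtain ⟨C, -, hC⟩ := (hXs.smooth_dirDeriv (0, Pi.single i 1)).continuous.exists_bound_cyl 0 0
      exact ⟨C, fun x => hC (0, x) ⟨le_rfl, le_rfl⟩⟩
    choose B hB using this
    exact ⟨∑ i, |B i|, fun i x => (hB i x).trans ((le_abs_self _).trans
      (Finset.single_le_sum (f := fun i => |B i|) (fun _ _ => abs_nonneg _) (Finset.mem_univ i)))⟩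
  -- `B` bounds the derivatives of the spatial kernel `X`, already chosen, so `ε` may depend on it.
  -- The condition `ε < 1` keeps the kernel within the layer `(-1,0]`.
  obtain ⟨ε, hε, hεε₀, hε1, hεa⟩ : ∃ ε : ℝ, 0 < ε ∧ ε < ε₀ ∧ ε < 1 ∧
      ENNReal.ofReal (B * ∫ x, |ρ₀ x|) * ENNReal.ofReal ε ^ (1 / 2 : ℝ) ≤ a / 2 := by
    have h1 : Tendsto (fun ε : ℝ => ENNReal.ofReal (B * ∫ x, |ρ₀ x|) *
        ENNReal.ofReal ε ^ (1 / 2 : ℝ)) (𝓝[>] 0) (𝓝 0) := by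
      have h2 : Tendsto (fun ε : ℝ => ENNReal.ofReal ε ^ (1 / 2 : ℝ)) (𝓝[>] 0) (𝓝 0) := by
        have := ((ENNReal.continuous_rpow_const (y := 1 / 2)).comp
          ENNReal.continuous_ofReal).tendsto 0
        simp only [Function.comp_apply, ENNReal.ofReal_zero] at this
        rw [ENNReal.zero_rpow_of_pos (by norm_num)] at this
        exact this.mono_left nhdsWithin_le_nhds
      simpa using ENNReal.Tendsto.const_mul h2 (Or.inr ENNReal.ofReal_ne_top)
    have h3 := h1.eventually (ge_mem_nhds (pos_iff_ne_zero.2 ha2))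
    obtain ⟨ε, h4, h5⟩ := (h3.and (Ioo_mem_nhdsGT (show (0 : ℝ) < min ε₀ 1 by positivity))).exists
    exact ⟨ε, h5.1, h5.2.trans_le (min_le_left _ _), h5.2.trans_le (min_le_right _ _), h4⟩
  obtain ⟨θ, hθs, hθ0, hθ1, hθε⟩ := exists_time_kernel hε
  let K : ℝ × UnitAddTorus (Fin n) → ℝ := fun z => θ z.1 * X z.2
  have hK : IsSmooth K := (isSmooth_time hθs).mul hXs
  have hKnn : ∀ z, 0 ≤ K z := fun z => mul_nonneg (hθ0 _) (hX0 _)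
  have hθneg : ∀ s, s ≤ 0 → θ s = 0 := fun s hs => by
    by_contra h
    linarith [(hθε s h).1]
  have hKneg : ∀ z, z.1 ≤ 0 → K z = 0 := fun z hz => by simp [K, hθneg _ hz]
  have hK1 : ∫ z, K z = 1 := by
    rw [Measure.volume_eq_prod, integral_prod_mul, hθ1, hX1, one_mul]
  have hKne : ∀ z, K z ≠ 0 → A z.1 ∧ W z.2 := fun z hz => by
    have h1 := hθε _ (left_ne_zero_of_mul hz)
    refine ⟨hε₀A ?_, (hXW _ (right_ne_zero_of_mul hz)).1⟩
    rw [Real.dist_eq, sub_zero, abs_of_pos h1.1]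
    exact h1.2.trans hεε₀
  have hclose := fun z hz => hAW (hKne z hz).1 (hKne z hz).2
  have iext : ∀ {h}, MemLp h 2 (parabolicCylinder n T) → Integrable (ext h) :=
    fun hh => integrable_cylinder_indicator hh
  have sext : ∀ h : ℝ × UnitAddTorus (Fin n) → ℝ, ∀ z, max T 1 < |z.1| → ext h z = 0 :=
    cylinder_indicator_support
  have convext : ∀ (L h : ℝ × UnitAddTorus (Fin n) → ℝ) z, cylConv L (ext h) z =
      ∫ w, h w * L (z - w) ∂(parabolicCylinder n T) := fun L h z => by
    rw [cylConv_indicator (measurableSet_slab measurableSet_Ioo), parabolicCylinder_eq_restrict]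
  have hgrad : ∀ (i : Fin n) (z : ℝ × UnitAddTorus (Fin n)), z.1 < T →
      spaceGrad (cylConv K ρx) z i = cylConv K (ext fun z => G z i) z +
        (∫ s in (z.1)..(z.1 + 1), θ s) * ∫ x, ρ₀ x * Y i (z.2 - x) := by
    intro i z hz
    rw [spaceGrad_eq, hK.dirDeriv_cylConv iρ sρ,
      cylConv_backwardExtension hd.initial hd.memLp (hK.smooth_dirDeriv _),
      hd.integral_mul_spaceKernel hK hKneg hz, convext, ← integral_initialLayer_mul]
    simp only [K, dirDeriv_space_kernel hθs hXs, Y]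
  refine ⟨cylConv K ρx, cylConv K (ext f), fun i => cylConv K (ext fun z => F z i),
    hK.cylConv iρ sρ, hK.cylConv (iext hd.memLp_source) (sext _),
    fun i => hK.cylConv (iext (mF i)) (sext _), ?_, ?_, ?_, ?_, ?_, ?_⟩
  · intro z hz
    rw [timeDeriv_eq, hK.dirDeriv_cylConv iρ sρ,
      cylConv_backwardExtension hd.initial hd.memLp (hK.smooth_dirDeriv _),
      hd.integral_mul_timeKernel hK hKneg hz.2]
    simp_rw [spaceGrad_eq, hK.dirDeriv_cylConv (iext (mF _)) (sext _), convext]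
    -- In time the layer contributes `θ (t + 1) - θ t`, whose first term is zero because `ε < 1`.
    -- The second cancels the initial term of the weak formulation.
    have h1 : ∫ w in Ioc (-1) 0 ×ˢ (univ : Set (UnitAddTorus (Fin n))),
        ρ₀ w.2 * dirDeriv (1, 0) K (z - w) = -∫ x, ρ₀ x * K (z - (0, x)) := by
      simp only [K, dirDeriv_time_kernel hθs hXs]
      rw [integral_initialLayer_mul,
        intervalIntegral.integral_deriv_eq_sub (fun s _ => hθs.differentiable (by simp) s)
          ((hθs.continuous_deriv (by simp)).intervalIntegrable _ _)]
      have h2 : θ (z.1 + 1) = 0 := by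
        by_contra h
        linarith [(hθε _ h).2, hz.1]
      rw [h2, zero_sub, neg_mul, ← integral_const_mul]
      simp only [Prod.fst_sub, Prod.snd_sub, sub_zero]
      congr 2
      ext x
      ring
    rw [h1]
    ring
  · exact (eLpNorm_cylConv_sub_le hK hKnn hK1 iρ sρ hρx fun y hy => (hclose y hy).1).trans haa
  · intro i
    have h1 : eLpNorm (fun z => cylConv K (ext fun z => G z i) z - G z i) 2 (parabolicCylinder n T)
        ≤ a / 2 := eLpNorm_cylConv_sub_le hK hKnn hK1 (iext (mG i)) (sext _)
      (hext _) fun y hy => (hclose y hy).2.2.1 i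
    have h2 := (eLpNorm_initialLayer_le (T := T) hθ0 hθ1 hθε (hB i) hd.initial).trans hεa
    rw [← ENNReal.add_halves a]
    refine le_trans (le_of_eq (eLpNorm_congr_ae ?_)) ((eLpNorm_add_le ?_ ?_ (by norm_num)).trans
      (add_le_add h1 h2))
    · filter_upwards [ae_mem_parabolicCylinder n T] with z hz
      rw [hgrad i z hz.2]
      simp only [Pi.add_apply]
      ring
    · exact (hK.cylConv (iext (mG i)) (sext _)).continuous.aestronglyMeasurable.sub (mG i).1
    · have h3 : (fun z : ℝ × UnitAddTorus (Fin n) =>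
          (∫ s in (z.1)..(z.1 + 1), θ s) * ∫ x, ρ₀ x * Y i (z.2 - x)) =ᵐ[parabolicCylinder n T]
          fun z => spaceGrad (cylConv K ρx) z i - cylConv K (ext fun z => G z i) z := by
        filter_upwards [ae_mem_parabolicCylinder n T] with z hz
        rw [hgrad i z hz.2]
        ring
      refine AEStronglyMeasurable.congr (Continuous.aestronglyMeasurable ?_) h3.symm
      exact ((hK.cylConv iρ sρ).smooth_spaceGrad i).continuous.sub
        (hK.cylConv (iext (mG i)) (sext _)).continuous
  · exact (eLpNorm_cylConv_sub_le hK hKnn hK1 (iext hd.memLp_source) (sext _) (hext _)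
      fun y hy => (hclose y hy).2.1).trans haa
  · exact fun i => (eLpNorm_cylConv_sub_le hK hKnn hK1 (iext (mF i)) (sext _) (hext _)
      fun y hy => (hclose y hy).2.2.2 i).trans haa
  · have h0 : ∀ x, cylConv K ρx (0, x) = ∫ w, ρ₀ w * X (x - w) := by
      intro x
      rw [cylConv_backwardExtension hd.initial hd.memLp hK, integral_initialLayer_mul,
        intervalIntegral_kernel_eq hθε le_rfl (by simpa using hε1.le), hθ1, one_mul]
      -- At time zero the causal kernel does not see positive times, and only the convolution of
      -- `ρ₀` with `X` remains.
      rw [integral_eq_zero_of_ae, zero_add]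
      filter_upwards [ae_mem_parabolicCylinder n T] with w hw
      rw [hKneg _ (by simpa using hw.1.le)]
      simp
    simp_rw [h0]
    have hXc : Continuous X := hXs.continuous.comp (Continuous.prodMk_right (0 : ℝ))
    refine eLpNorm_convolution_sub_le hXc.measurable hX0 hX1 hd.initial.1 (fun x => ?_)
      fun y hy => (hXW y hy).2
    obtain ⟨C, hC⟩ := isCompact_univ.exists_bound_of_continuousOn hXc.continuousOn
    exact (hd.initial.integrable (by norm_num)).mul_bdd (c := C)
      (hXc.comp (continuous_const.sub continuous_id)).aestronglyMeasurable
      (Eventually.of_forall fun w => hC _ trivial)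

end

/-! ### From interior test functions to the initial time -/

section Cutoff

variable {n : ℕ} {T : ℝ}

/-- A smooth cutoff vanishing for `t ≤ 1/m` and equal to one for `t ≥ 2/m`. -/
noncomputable def timeCutoff (m : ℕ) (t : ℝ) : ℝ := Real.smoothTransition (m * t - 1)

theorem contDiff_timeCutoff (m : ℕ) : ContDiff ℝ ∞ (timeCutoff m) :=
  Real.smoothTransition.contDiff.comp (by fun_prop)

theorem IsInitialTest.isInteriorTest_cutoff {φ : ℝ × UnitAddTorus (Fin n) → ℝ}
    (hφ : IsInitialTest T φ) {m : ℕ} (hm : 0 < m) :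
    IsInteriorTest T fun z => timeCutoff m z.1 * φ z := by
  obtain ⟨hs, t₁, ht₁, h⟩ := hφ
  have hm' : (0 : ℝ) < m := by exact_mod_cast hm
  refine ⟨(isSmooth_time (contDiff_timeCutoff m)).mul hs, 1 / m, t₁, by positivity, ht₁,
    fun t x ht => ?_⟩
  rcases ht with ht | ht
  · have h1 : timeCutoff m t = 0 := by
      rw [lt_div_iff₀ hm'] at ht
      exact Real.smoothTransition.zero_of_nonpos (by linarith)
    simp [h1]
  · simp [h t x ht]

theorem IsInteriorTest.isInitialTest {φ : ℝ × UnitAddTorus (Fin n) → ℝ}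
    (hφ : IsInteriorTest T φ) : IsInitialTest T φ := by
  obtain ⟨hs, t₀, t₁, -, ht₁, h⟩ := hφ
  exact ⟨hs, t₁, ht₁, fun t x ht => h t x (Or.inr ht)⟩

theorem IsInteriorTest.apply_zero {φ : ℝ × UnitAddTorus (Fin n) → ℝ}
    (hφ : IsInteriorTest T φ) (x : UnitAddTorus (Fin n)) : φ (0, x) = 0 := by
  obtain ⟨-, t₀, t₁, ht₀, -, h⟩ := hφ
  exact h 0 x (Or.inl ht₀)

theorem spaceGrad_timeCutoff_mul {φ : ℝ × UnitAddTorus (Fin n) → ℝ} (hφ : IsSmooth φ) (m : ℕ)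
    (z : ℝ × UnitAddTorus (Fin n)) :
    spaceGrad (fun z => timeCutoff m z.1 * φ z) z = timeCutoff m z.1 • spaceGrad φ z := by
  rw [(isSmooth_time (contDiff_timeCutoff m)).spaceGrad_mul hφ, spaceGrad_time, smul_zero, zero_add]

theorem tendsto_integral_timeCutoff_mul {h : ℝ × UnitAddTorus (Fin n) → ℝ}
    (hh : Integrable h (parabolicCylinder n T)) :
    Tendsto (fun m : ℕ => ∫ z, timeCutoff m z.1 * h z ∂(parabolicCylinder n T)) atTop
      (𝓝 (∫ z, h z ∂(parabolicCylinder n T))) := by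
  refine tendsto_integral_of_dominated_convergence (fun z => ‖h z‖) (fun m => ?_) hh.norm
    (fun m => Eventually.of_forall fun z => ?_) ?_
  · exact ((isSmooth_time (contDiff_timeCutoff m)).continuous.aestronglyMeasurable).mul
      hh.aestronglyMeasurable
  · rw [norm_mul]
    refine mul_le_of_le_one_left (norm_nonneg _) ?_
    rw [timeCutoff, Real.norm_of_nonneg (Real.smoothTransition.nonneg _)]
    exact Real.smoothTransition.le_one _
  · filter_upwards [ae_mem_parabolicCylinder n T] with z hz
    refine tendsto_const_nhds.congr' ?_
    have : Tendsto (fun m : ℕ => (m : ℝ) * z.1) atTop atTop :=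
      tendsto_natCast_atTop_atTop.atTop_mul_const hz.1
    filter_upwards [this.eventually_ge_atTop 2] with m hm
    rw [timeCutoff, Real.smoothTransition.one_of_one_le (by linarith), one_mul]

theorem integral_eq_zero_of_cutoff {h : ℝ × UnitAddTorus (Fin n) → ℝ}
    (hh : Integrable h (parabolicCylinder n T))
    (h0 : ∀ m : ℕ, 0 < m → ∫ z, timeCutoff m z.1 * h z ∂(parabolicCylinder n T) = 0) :
    ∫ z, h z ∂(parabolicCylinder n T) = 0 := by
  refine tendsto_nhds_unique (tendsto_integral_timeCutoff_mul hh) (tendsto_const_nhds.congr' ?_)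
  filter_upwards [eventually_gt_atTop 0] with m hm using (h0 m hm).symm

theorem memLp_inner_continuous {b F : ℝ × UnitAddTorus (Fin n) → EuclideanSpace ℝ (Fin n)}
    (hb : MemLp b 2 (parabolicCylinder n T)) (hF : Continuous F) :
    MemLp (fun z => inner ℝ (b z) (F z)) 2 (parabolicCylinder n T) := by
  obtain ⟨C, -, hC⟩ := hF.exists_bound_cyl 0 T
  refine MemLp.of_le_mul (c := C) hb (hb.1.inner hF.aestronglyMeasurable) ?_
  filter_upwards [ae_mem_parabolicCylinder n T] with z hz
  rw [mul_comm]
  refine (norm_inner_le_norm _ _).trans ?_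
  gcongr
  exact hC z (Ioo_subset_Icc_self hz)

/-- A cutoff in time commutes with spatial derivatives, so relations without `∂ₜφ` pass from
interior test functions to those not vanishing at `t = 0`. The relation for `∂ₜρ` is not of this
kind. Comparing it with the weak formulation eliminates `∂ₜφ`; the resulting spatial relation is
extended by cutoff, and the weak formulation then gives back the time derivative together with the
initial datum. -/
theorem IsParabolicSolution.exists_isEnergyData
    {b : ℝ × UnitAddTorus (Fin n) → EuclideanSpace ℝ (Fin n)} {ρ₀ : UnitAddTorus (Fin n) → ℝ}
    {ρ : ℝ × UnitAddTorus (Fin n) → ℝ} (hs : IsParabolicSolution T b ρ₀ ρ)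
    (hb : MemLp b 2 (parabolicCylinder n T)) (hρ₀ : MemLp ρ₀ 2 volume) :
    ∃ G f F, IsEnergyData T ρ₀ ρ G f F ∧ ∀ φ, IsInteriorTest T φ →
      ∫ z, (f z * φ z - inner ℝ (F z) (spaceGrad φ z) + inner ℝ (G z) (spaceGrad φ z)
        - ρ z * inner ℝ (b z) (spaceGrad φ z)) ∂(parabolicCylinder n T) = 0 := by
  obtain ⟨G, ⟨hρ, hG, hgrad⟩, ⟨f, F, hf, hF, htime⟩, hsol⟩ := hs
  have iρ := hρ.integrable (by norm_num)
  have i1 : ∀ {φ : ℝ × UnitAddTorus (Fin n) → ℝ}, IsSmooth φ →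
      Integrable (fun z => ρ z * timeDeriv φ z) (parabolicCylinder n T) := fun hφ =>
    integrable_mul_continuous iρ hφ.smooth_timeDeriv.continuous
  have i2 : ∀ {φ : ℝ × UnitAddTorus (Fin n) → ℝ}, IsSmooth φ →
      Integrable (fun z => inner ℝ (G z) (spaceGrad φ z)) (parabolicCylinder n T) := fun hφ =>
    integrable_inner_continuous (hG.integrable (by norm_num)) hφ.continuous_spaceGrad
  have i3 : ∀ {φ : ℝ × UnitAddTorus (Fin n) → ℝ}, IsSmooth φ →
      Integrable (fun z => ρ z * inner ℝ (b z) (spaceGrad φ z)) (parabolicCylinder n T) := fun hφ =>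
    hρ.integrable_mul (memLp_inner_continuous hb hφ.continuous_spaceGrad)
  have i4 : ∀ {φ : ℝ × UnitAddTorus (Fin n) → ℝ}, IsSmooth φ →
      Integrable (fun z => f z * φ z - inner ℝ (F z) (spaceGrad φ z)) (parabolicCylinder n T) :=
    fun hφ => (integrable_mul_continuous (hf.integrable (by norm_num)) hφ.continuous).sub
      (integrable_inner_continuous (hF.integrable (by norm_num)) hφ.continuous_spaceGrad)
  have i6 : ∀ {φ : ℝ × UnitAddTorus (Fin n) → ℝ}, IsSmooth φ →
      Integrable (fun z => -inner ℝ (G z) (spaceGrad φ z) + ρ z * inner ℝ (b z) (spaceGrad φ z))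
        (parabolicCylinder n T) := fun hφ => (i2 hφ).neg.add (i3 hφ)
  have i7 : ∀ {φ : ℝ × UnitAddTorus (Fin n) → ℝ}, IsSmooth φ →
      Integrable (fun z => -(ρ z * timeDeriv φ z) + inner ℝ (G z) (spaceGrad φ z)
        - ρ z * inner ℝ (b z) (spaceGrad φ z)) (parabolicCylinder n T) := fun hφ =>
    ((i1 hφ).neg.add (i2 hφ)).sub (i3 hφ)
  have hsol' : ∀ φ, IsInitialTest T φ → -∫ z, ρ z * timeDeriv φ z ∂(parabolicCylinder n T) =
      (∫ z, (-inner ℝ (G z) (spaceGrad φ z) + ρ z * inner ℝ (b z) (spaceGrad φ z))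
        ∂(parabolicCylinder n T)) + ∫ x, ρ₀ x * φ (0, x) := by
    intro φ hφ
    rw [← hsol φ hφ, ← integral_neg, ← integral_add (i6 hφ.1) (i7 hφ.1)]
    congr 1
    ext z
    ring
  have hint : ∀ φ, IsInteriorTest T φ →
      ∫ z, (f z * φ z - inner ℝ (F z) (spaceGrad φ z) + inner ℝ (G z) (spaceGrad φ z)
        - ρ z * inner ℝ (b z) (spaceGrad φ z)) ∂(parabolicCylinder n T) = 0 := by
    intro φ hφ
    have h1 := htime φ hφ
    rw [hsol' φ hφ.isInitialTest] at h1
    simp only [hφ.apply_zero, mul_zero, integral_zero, add_zero] at h1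
    rw [← sub_eq_zero, ← integral_sub (i6 hφ.1) (i4 hφ.1)] at h1
    rw [← neg_eq_zero, ← integral_neg, ← h1]
    congr 1
    ext z
    ring
  have i5 : ∀ {φ : ℝ × UnitAddTorus (Fin n) → ℝ}, IsSmooth φ →
      Integrable (fun z => f z * φ z - inner ℝ (F z) (spaceGrad φ z) + inner ℝ (G z) (spaceGrad φ z)
        - ρ z * inner ℝ (b z) (spaceGrad φ z)) (parabolicCylinder n T) := fun hφ =>
    ((i4 hφ).add (i2 hφ)).sub (i3 hφ)
  refine ⟨G, f, F, ⟨hρ₀, hρ, hG, hf, hF, fun φ hφ i => ?_, fun φ hφ => ?_⟩, hint⟩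
  · have iG : Integrable (fun z => G z i * φ z) (parabolicCylinder n T) :=
      integrable_mul_continuous ((MemLp.coord hG i).integrable (by norm_num)) hφ.1.continuous
    have iD : Integrable (fun z => ρ z * spaceGrad φ z i) (parabolicCylinder n T) :=
      integrable_mul_continuous iρ (hφ.1.smooth_spaceGrad i).continuous
    have := integral_eq_zero_of_cutoff (iD.add iG) fun m hm => by
      have h1 := hgrad _ (hφ.isInteriorTest_cutoff hm) i
      have h2 := hφ.isInteriorTest_cutoff hm
      rw [← add_eq_zero_iff_eq_neg, ← integral_add] at h1
      · rw [← h1]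
        congr 1
        ext z
        simp only [Pi.add_apply, spaceGrad_timeCutoff_mul hφ.1, PiLp.smul_apply, smul_eq_mul]
        ring
      · exact integrable_mul_continuous iρ (h2.1.smooth_spaceGrad i).continuous
      · exact integrable_mul_continuous ((MemLp.coord hG i).integrable (by norm_num))
          h2.1.continuous
    rw [← add_eq_zero_iff_eq_neg, ← integral_add iD iG]
    exact this
  · have := integral_eq_zero_of_cutoff (i5 hφ.1) fun m hm => by
      have h1 := hint _ (hφ.isInteriorTest_cutoff hm)
      rw [← h1]
      congr 1
      ext z
      simp only [spaceGrad_timeCutoff_mul hφ.1, inner_smul_right]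
      ring
    rw [hsol' φ hφ]
    congr 1
    rw [← sub_eq_zero, ← neg_eq_zero,
      ← integral_sub (i6 hφ.1) (i4 hφ.1), ← integral_neg, ← this]
    congr 1
    ext z
    ring

end Cutoff

/-! ### Calculus of `L²` convergence -/

section SquareIntegrableConvergence

variable {α : Type*} [MeasurableSpace α] {μ : Measure α} {u v ζ : ℕ → α → ℝ} {u₀ v₀ ζ₀ : α → ℝ}

/-- Convergence in `L²` of a sequence of square integrable functions. -/
structure L2Conv (μ : Measure α) (u : ℕ → α → ℝ) (u₀ : α → ℝ) : Prop where
  memLp : ∀ j, MemLp (u j) 2 μ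
  memLp_lim : MemLp u₀ 2 μ
  tendsto : Tendsto (fun j => eLpNorm (fun z => u j z - u₀ z) 2 μ) atTop (𝓝 0)

theorem L2Conv.mono_measure {ν : Measure α} (h : L2Conv μ u u₀) (hν : ν ≤ μ) : L2Conv ν u u₀ :=
  ⟨fun j => (h.memLp j).mono_measure hν, h.memLp_lim.mono_measure hν,
    tendsto_of_tendsto_of_tendsto_of_le_of_le tendsto_const_nhds h.tendsto (fun _ => zero_le)
      fun _ => eLpNorm_mono_measure _ hν⟩

theorem L2Conv.const (h : MemLp u₀ 2 μ) : L2Conv μ (fun _ => u₀) u₀ :=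
  ⟨fun _ => h, h, by simp⟩

theorem L2Conv.comp_lipschitz [IsFiniteMeasure μ] (h : L2Conv μ u u₀) {g : ℝ → ℝ} {C : ℝ≥0}
    (hg : LipschitzWith C g) : L2Conv μ (fun j z => g (u j z)) fun z => g (u₀ z) := by
  have hm : ∀ {w : α → ℝ}, MemLp w 2 μ → MemLp (fun z => g (w z)) 2 μ := fun {w} hw => by
    have h0 : MemLp (fun z => (C : ℝ) * |w z|) 2 μ := hw.abs.const_mul (C : ℝ)
    have h1 : MemLp (fun z => |g 0| + C * |w z|) 2 μ := (memLp_const |g 0|).add h0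
    refine h1.of_le (hg.continuous.comp_aestronglyMeasurable hw.1)
      (Eventually.of_forall fun z => ?_)
    have h2 := hg.dist_le_mul (w z) 0
    rw [Real.dist_eq, Real.dist_eq, sub_zero] at h2
    rw [Real.norm_eq_abs, Real.norm_of_nonneg (by positivity)]
    have := abs_sub_abs_le_abs_sub (g (w z)) (g 0)
    linarith
  refine ⟨fun j => hm (h.memLp j), hm h.memLp_lim, ?_⟩
  have h1 : Tendsto (fun j => (C : ℝ≥0∞) * eLpNorm (fun z => u j z - u₀ z) 2 μ) atTop (𝓝 0) := by
    simpa using ENNReal.Tendsto.const_mul h.tendsto (Or.inr ENNReal.coe_ne_top)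
  refine tendsto_of_tendsto_of_tendsto_of_le_of_le tendsto_const_nhds h1 (fun _ => zero_le)
    fun j => ?_
  have := eLpNorm_le_nnreal_smul_eLpNorm_of_ae_le_mul (μ := μ) (c := C)
    (f := fun z => g (u j z) - g (u₀ z)) (g := fun z => u j z - u₀ z)
    (Eventually.of_forall fun z => by
      have := hg.nndist_le (u j z) (u₀ z)
      rwa [nndist_eq_nnnorm, nndist_eq_nnnorm] at this) 2
  simpa [ENNReal.smul_def] using this

theorem L2Conv.add (h : L2Conv μ u u₀) (h' : L2Conv μ v v₀) :
    L2Conv μ (fun j z => u j z + v j z) fun z => u₀ z + v₀ z := by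
  refine ⟨fun j => (h.memLp j).add (h'.memLp j), h.memLp_lim.add h'.memLp_lim, ?_⟩
  have h1 := h.tendsto.add h'.tendsto
  rw [add_zero] at h1
  refine tendsto_of_tendsto_of_tendsto_of_le_of_le tendsto_const_nhds h1 (fun _ => zero_le)
    fun j => ?_
  refine le_trans (le_of_eq ?_) (eLpNorm_add_le ((h.memLp j).1.sub h.memLp_lim.1)
    ((h'.memLp j).1.sub h'.memLp_lim.1) (by norm_num))
  congr 1
  ext z
  simp only [Pi.add_apply]
  ring

theorem L2Conv.const_mul (h : L2Conv μ u u₀) (c : ℝ) :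
    L2Conv μ (fun j z => c * u j z) fun z => c * u₀ z := by
  refine ⟨fun j => (h.memLp j).const_mul c, h.memLp_lim.const_mul c, ?_⟩
  have h1 : Tendsto (fun j => ‖c‖ₑ * eLpNorm (fun z => u j z - u₀ z) 2 μ) atTop (𝓝 0) := by
    simpa using ENNReal.Tendsto.const_mul h.tendsto (Or.inr enorm_ne_top)
  refine h1.congr fun j => ?_
  rw [← eLpNorm_const_smul]
  congr 1
  ext z
  simp only [Pi.smul_apply, smul_eq_mul]
  ring

/-- Write `ζⱼ uⱼ - ζ₀ u₀ = ζⱼ (uⱼ - u₀) + (ζⱼ - ζ₀) u₀` and use dominated convergence for the second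
term. This is how bounded nonlinear coefficients, convergent only almost everywhere, are multiplied
with gradients. -/
theorem L2Conv.bounded_mul (h : L2Conv μ u u₀) {C : ℝ} (hm : ∀ j, AEStronglyMeasurable (ζ j) μ)
    (hC : ∀ j z, |ζ j z| ≤ C) (hζ : ∀ᵐ z ∂μ, Tendsto (fun j => ζ j z) atTop (𝓝 (ζ₀ z))) :
    L2Conv μ (fun j z => ζ j z * u j z) fun z => ζ₀ z * u₀ z := by
  have hm₀ : AEStronglyMeasurable ζ₀ μ := aestronglyMeasurable_of_tendsto_ae _ hm hζ
  have hC₀ : ∀ᵐ z ∂μ, |ζ₀ z| ≤ C := by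
    filter_upwards [hζ] with z hz
    exact le_of_tendsto' hz.abs fun j => hC j z
  have mem : ∀ {w η : α → ℝ}, MemLp w 2 μ → AEStronglyMeasurable η μ → (∀ᵐ z ∂μ, |η z| ≤ C) →
      MemLp (fun z => η z * w z) 2 μ := fun hw hη hb => by
    refine MemLp.of_le_mul (c := C) hw (hη.mul hw.1) ?_
    filter_upwards [hb] with z hz
    rw [norm_mul]
    gcongr
    exact hz
  refine ⟨fun j => mem (h.memLp j) (hm j) (Eventually.of_forall (hC j)),
    mem h.memLp_lim hm₀ hC₀, ?_⟩
  have h1 : Tendsto (fun j => eLpNorm (fun z => (ζ j z - ζ₀ z) * u₀ z) 2 μ) atTop (𝓝 0) := by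
    have h2 : Tendsto (fun j => ∫⁻ z, ‖(ζ j z - ζ₀ z) * u₀ z‖ₑ ^ 2 ∂μ) atTop
        (𝓝 (∫⁻ _, 0 ∂μ)) := by
      have hfin : ∫⁻ z, (ENNReal.ofReal (2 * C) * ‖u₀ z‖ₑ) ^ 2 ∂μ ≠ ⊤ := by
        simp_rw [mul_pow]
        rw [lintegral_const_mul' _ _ (ENNReal.pow_ne_top ENNReal.ofReal_ne_top), ← eLpNorm_two_sq]
        exact ENNReal.mul_ne_top (ENNReal.pow_ne_top ENNReal.ofReal_ne_top)
          (ENNReal.pow_ne_top h.memLp_lim.2.ne)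
      refine tendsto_lintegral_of_dominated_convergence'
        (fun z => (ENNReal.ofReal (2 * C) * ‖u₀ z‖ₑ) ^ 2) (fun j => ?_) (fun j => ?_) hfin ?_
      · exact ((((hm j).sub hm₀).mul h.memLp_lim.1).enorm).pow_const 2
      · filter_upwards [hC₀] with z hz
        rw [enorm_mul]
        gcongr
        rw [← ofReal_norm, Real.norm_eq_abs]
        refine ENNReal.ofReal_le_ofReal ((abs_sub _ _).trans ?_)
        linarith [hC j z]
      · filter_upwards [hζ] with z hz
        have h3 : Tendsto (fun j => (ζ j z - ζ₀ z) * u₀ z) atTop (𝓝 0) := by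
          simpa using (hz.sub_const (ζ₀ z)).mul_const (u₀ z)
        have h4 := ((ENNReal.continuous_pow 2).comp continuous_enorm).tendsto (0 : ℝ)
        simp only [Function.comp_apply, enorm_zero, ne_eq, OfNat.ofNat_ne_zero, not_false_eq_true,
          zero_pow] at h4
        exact h4.comp h3
    rw [lintegral_zero] at h2
    have h3 := ((ENNReal.continuous_rpow_const (y := 1 / 2)).tendsto 0).comp h2
    rw [ENNReal.zero_rpow_of_pos (by norm_num)] at h3
    refine h3.congr fun j => ?_
    rw [Function.comp_apply, ← eLpNorm_two_sq, ← ENNReal.rpow_natCast, ← ENNReal.rpow_mul]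
    norm_num
  have h5 : Tendsto (fun j => ENNReal.ofReal C * eLpNorm (fun z => u j z - u₀ z) 2 μ +
      eLpNorm (fun z => (ζ j z - ζ₀ z) * u₀ z) 2 μ) atTop (𝓝 0) := by
    simpa using (ENNReal.Tendsto.const_mul h.tendsto (Or.inr ENNReal.ofReal_ne_top)).add h1
  refine tendsto_of_tendsto_of_tendsto_of_le_of_le tendsto_const_nhds h5 (fun _ => zero_le)
    fun j => ?_
  have e1 : (fun z => ζ j z * u j z - ζ₀ z * u₀ z) =
      (fun z => ζ j z * (u j z - u₀ z)) + fun z => (ζ j z - ζ₀ z) * u₀ z := by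
    ext z
    simp only [Pi.add_apply]
    ring
  simp only [e1]
  refine (eLpNorm_add_le ((hm j).mul ((h.memLp j).1.sub h.memLp_lim.1))
    (((hm j).sub hm₀).mul h.memLp_lim.1) (by norm_num)).trans (add_le_add ?_ le_rfl)
  exact eLpNorm_le_mul_eLpNorm_of_ae_le_mul (Eventually.of_forall fun z => by
    change ‖ζ j z * (u j z - u₀ z)‖ ≤ C * ‖u j z - u₀ z‖
    rw [norm_mul]
    gcongr
    exact hC j z) 2

theorem eLpNorm_mul_le_two {a b : α → ℝ} (ha : AEStronglyMeasurable a μ)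
    (hb : AEStronglyMeasurable b μ) :
    eLpNorm (fun z => a z * b z) 1 μ ≤ eLpNorm a 2 μ * eLpNorm b 2 μ := by
  have := eLpNorm_smul_le_mul_eLpNorm (p := 2) (q := 2) (r := 1) hb ha
  exact this

theorem L2Conv.tendsto_integral_mul (h : L2Conv μ u u₀) (h' : L2Conv μ v v₀) :
    Tendsto (fun j => ∫ z, u j z * v j z ∂μ) atTop (𝓝 (∫ z, u₀ z * v₀ z ∂μ)) := by
  refine tendsto_integral_of_L1' _ (h.memLp_lim.1.mul h'.memLp_lim.1)
    (Eventually.of_forall fun j => (h.memLp j).integrable_mul (h'.memLp j)) ?_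
  have h1 : Tendsto (fun j => eLpNorm (fun z => u j z - u₀ z) 2 μ *
      eLpNorm (fun z => v j z - v₀ z) 2 μ + eLpNorm (fun z => u j z - u₀ z) 2 μ * eLpNorm v₀ 2 μ +
      eLpNorm u₀ 2 μ * eLpNorm (fun z => v j z - v₀ z) 2 μ) atTop (𝓝 0) := by
    have a1 := ENNReal.Tendsto.mul h.tendsto (Or.inr (by simp)) h'.tendsto (Or.inr (by simp))
    have a2 := ENNReal.Tendsto.mul_const (b := eLpNorm v₀ 2 μ) h.tendsto
      (Or.inr h'.memLp_lim.2.ne)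
    have a3 := ENNReal.Tendsto.const_mul (a := eLpNorm u₀ 2 μ) h'.tendsto
      (Or.inr h.memLp_lim.2.ne)
    simpa using (a1.add a2).add a3
  refine tendsto_of_tendsto_of_tendsto_of_le_of_le tendsto_const_nhds h1 (fun _ => zero_le)
    fun j => ?_
  have mu := (h.memLp j).1.sub h.memLp_lim.1
  have mv := (h'.memLp j).1.sub h'.memLp_lim.1
  have e1 : (fun z => u j z * v j z) - u₀ * v₀ =
      ((fun z => (u j z - u₀ z) * (v j z - v₀ z)) + fun z => (u j z - u₀ z) * v₀ z) +
        fun z => u₀ z * (v j z - v₀ z) := by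
    ext z
    simp only [Pi.add_apply, Pi.sub_apply, Pi.mul_apply]
    ring
  change eLpNorm ((fun z => u j z * v j z) - u₀ * v₀) 1 μ ≤ _
  rw [e1]
  refine (eLpNorm_add_le ((mu.mul mv).add (mu.mul h'.memLp_lim.1)) (h.memLp_lim.1.mul mv)
    le_rfl).trans (add_le_add ((eLpNorm_add_le (mu.mul mv) (mu.mul h'.memLp_lim.1) le_rfl).trans
      (add_le_add ?_ ?_)) ?_)
  · exact eLpNorm_mul_le_two mu mv
  · exact eLpNorm_mul_le_two mu h'.memLp_lim.1
  · exact eLpNorm_mul_le_two h.memLp_lim.1 mv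

theorem L2Conv.sub_lim (h : L2Conv μ u u₀) : L2Conv μ (fun j z => |u j z - u₀ z|) fun _ => 0 :=
  ⟨fun j => ((h.memLp j).sub h.memLp_lim).abs, by simp, by
    simp only [sub_zero]
    refine h.tendsto.congr fun j => ?_
    exact (eLpNorm_norm (fun z => u j z - u₀ z)).symm⟩

theorem L2Conv.tendsto_integral [IsFiniteMeasure μ] (h : L2Conv μ u u₀) :
    Tendsto (fun j => ∫ z, u j z ∂μ) atTop (𝓝 (∫ z, u₀ z ∂μ)) := by
  simpa using h.tendsto_integral_mul (L2Conv.const (memLp_const (1 : ℝ)))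

/-- Composition with a function of quadratic growth turns `L²` convergence into convergence of
integrals. -/
theorem L2Conv.tendsto_integral_comp [IsFiniteMeasure μ] (h : L2Conv μ u u₀) {g β : ℝ → ℝ}
    {C : ℝ≥0} (hg : LipschitzWith C g) (hβ : ∀ s, HasDerivAt β (g s) s) :
    Integrable (fun z => β (u₀ z)) μ ∧
    Tendsto (fun j => ∫ z, β (u j z) ∂μ) atTop (𝓝 (∫ z, β (u₀ z) ∂μ)) := by
  have hβc : Continuous β := continuous_iff_continuousAt.2 fun s => (hβ s).continuousAt
  -- The mean value inequality on the segment between `b` and `a`, where `g` grows at most linearly.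
  have bound : ∀ a b : ℝ, |β a - β b| ≤ (|g 0| + C * (|a| + |b|)) * |a - b| := by
    intro a b
    have hgb : ∀ s ∈ uIcc b a, ‖g s‖ ≤ |g 0| + C * (|a| + |b|) := by
      intro s hs
      have h2 := hg.dist_le_mul s 0
      rw [Real.dist_eq, Real.dist_eq, sub_zero] at h2
      have h3 := abs_sub_abs_le_abs_sub (g s) (g 0)
      have h4 : |s| ≤ |a| + |b| := by
        rcases abs_le_max_abs_abs hs.1 hs.2 with h5
        refine h5.trans (max_le ?_ ?_)
        · rcases min_choice b a with h6 | h6 <;> simp only [h6] <;> linarith [abs_nonneg a, abs_nonneg b]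
        · rcases max_choice b a with h6 | h6 <;> simp only [h6] <;> linarith [abs_nonneg a, abs_nonneg b]
      rw [Real.norm_eq_abs]
      have h7 : (C : ℝ) * |s| ≤ C * (|a| + |b|) := by gcongr
      linarith
    have := (convex_uIcc b a).norm_image_sub_le_of_norm_hasDerivWithin_le
      (fun s _ => (hβ s).hasDerivWithinAt) hgb left_mem_uIcc right_mem_uIcc
    simpa using this
  have hint : ∀ {w : α → ℝ}, MemLp w 2 μ → Integrable (fun z => β (w z)) μ := fun {w} hw => by
    have h1 : Integrable (fun z => |β 0| + (|g 0| + C * |w z|) * |w z|) μ := by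
      have h0 : MemLp (fun z => (C : ℝ) * |w z|) 2 μ := hw.abs.const_mul (C : ℝ)
      have h2 : MemLp (fun z => |g 0| + C * |w z|) 2 μ := (memLp_const |g 0|).add h0
      exact (integrable_const _).add (h2.integrable_mul hw.abs)
    refine h1.mono' (hβc.comp_aestronglyMeasurable hw.1) (Eventually.of_forall fun z => ?_)
    have h3 := bound (w z) 0
    simp only [abs_zero, add_zero, sub_zero] at h3
    rw [Real.norm_eq_abs]
    linarith [abs_sub_abs_le_abs_sub (β (w z)) (β 0)]
  refine ⟨hint h.memLp_lim, ?_⟩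
  have h1 : L2Conv μ (fun j z => |g 0| + C * (|u j z| + |u₀ z|))
      fun z => |g 0| + C * (|u₀ z| + |u₀ z|) :=
    (L2Conv.const (memLp_const _)).add (((h.comp_lipschitz lipschitzWith_one_norm).add
      (L2Conv.const h.memLp_lim.abs)).const_mul C)
  have h2 := h1.tendsto_integral_mul h.sub_lim
  simp only [mul_zero, integral_zero] at h2
  rw [tendsto_iff_norm_sub_tendsto_zero]
  refine squeeze_zero (fun _ => norm_nonneg _) (fun j => ?_) h2
  rw [← integral_sub (hint (h.memLp j)) (hint h.memLp_lim)]
  refine norm_integral_le_of_norm_le ((h1.memLp j).integrable_mul (h.sub_lim.memLp j))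
    (Eventually.of_forall fun z => bound _ _)

end SquareIntegrableConvergence

/-! ### Approximating sequences and the chain rule -/

section

variable {n : ℕ} {T : ℝ}

theorem parabolicCylinder_mono {s t : ℝ} (h : s ≤ t) :
    parabolicCylinder n s ≤ parabolicCylinder n t := by
  rw [parabolicCylinder_eq_restrict, parabolicCylinder_eq_restrict]
  exact Measure.restrict_mono (prod_mono (Ioo_subset_Ioo_right h) Subset.rfl) le_rfl

theorem ENNReal.tsum_half_pow_sq_ne_top : ∑' j : ℕ, (((1 / 2 : ℝ≥0∞) ^ j) ^ 2) ≠ ⊤ := by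
  simp_rw [← pow_mul, mul_comm _ 2, pow_mul]
  rw [ENNReal.tsum_geometric]
  refine ENNReal.inv_ne_top.2 (tsub_pos_of_lt ?_).ne'
  have : (1 / 2 : ℝ≥0∞) < 1 := by simp
  exact pow_lt_one₀ zero_le this (by norm_num)

theorem Continuous.memLp_slice {F : ℝ × UnitAddTorus (Fin n) → ℝ} (hF : Continuous F) (t : ℝ)
    (p : ℝ≥0∞) : MemLp (fun x => F (t, x)) p volume :=
  (ContinuousMap.memLp (p := ⊤) volume ℝ
    (⟨fun x => F (t, x), by fun_prop⟩ : C(UnitAddTorus (Fin n), ℝ))).mono_exponent le_top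

theorem MeasureTheory.MemLp.integrable_fun_mul {α : Type*} [MeasurableSpace α] {μ : Measure α}
    {a b : α → ℝ} (ha : MemLp a 2 μ) (hb : MemLp b 2 μ) : Integrable (fun z => a z * b z) μ :=
  ha.integrable_mul hb

section FastConvergence

variable {w : ℕ → ℝ × UnitAddTorus (Fin n) → ℝ} {w₀ : ℝ × UnitAddTorus (Fin n) → ℝ}

/-- Geometric errors make the sum of all squared errors integrable. Hence the whole sequence
converges almost everywhere and, by Tonelli, in `L²` on almost every time slice, with no passage to
subsequences. -/
theorem lintegral_tsum_sq_ne_top (hw : ∀ j, Continuous (w j)) (h₀ : MemLp w₀ 2 (parabolicCylinder n T))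
    (hj : ∀ j, eLpNorm (fun z => w j z - w₀ z) 2 (parabolicCylinder n T) ≤ (1 / 2) ^ j) :
    ∫⁻ z, ∑' j, ‖w j z - w₀ z‖ₑ ^ 2 ∂(parabolicCylinder n T) ≠ ⊤ := by
  have hm : ∀ j, AEMeasurable (fun z => ‖w j z - w₀ z‖ₑ ^ 2) (parabolicCylinder n T) := fun j =>
    (((hw j).aestronglyMeasurable.sub h₀.1).enorm).pow_const 2
  rw [lintegral_tsum hm]
  refine ne_top_of_le_ne_top ENNReal.tsum_half_pow_sq_ne_top (ENNReal.tsum_le_tsum fun j => ?_)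
  rw [← eLpNorm_two_sq]
  gcongr
  exact hj j

theorem ae_tendsto_of_fast (hw : ∀ j, Continuous (w j)) (h₀ : MemLp w₀ 2 (parabolicCylinder n T))
    (hj : ∀ j, eLpNorm (fun z => w j z - w₀ z) 2 (parabolicCylinder n T) ≤ (1 / 2) ^ j) :
    ∀ᵐ z ∂(parabolicCylinder n T), Tendsto (fun j => w j z) atTop (𝓝 (w₀ z)) := by
  have hm : AEMeasurable (fun z => ∑' j, ‖w j z - w₀ z‖ₑ ^ 2) (parabolicCylinder n T) :=
    AEMeasurable.tsum fun j => (((hw j).aestronglyMeasurable.sub h₀.1).enorm).pow_const 2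
  filter_upwards [ae_lt_top' hm (lintegral_tsum_sq_ne_top hw h₀ hj)] with z hz
  have h1 := ENNReal.tendsto_atTop_zero_of_tsum_ne_top hz.ne
  have h2 := ((ENNReal.continuous_rpow_const (y := 1 / 2)).tendsto 0).comp h1
  rw [ENNReal.zero_rpow_of_pos (by norm_num)] at h2
  rw [tendsto_iff_edist_tendsto_0]
  refine h2.congr fun j => ?_
  rw [Function.comp_apply, ← ENNReal.rpow_natCast, ← ENNReal.rpow_mul, edist_eq_enorm_sub]
  norm_num

theorem ae_slice_l2Conv_of_fast (hw : ∀ j, Continuous (w j))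
    (h₀ : MemLp w₀ 2 (parabolicCylinder n T))
    (hj : ∀ j, eLpNorm (fun z => w j z - w₀ z) 2 (parabolicCylinder n T) ≤ (1 / 2) ^ j) :
    ∀ᵐ t ∂(volume.restrict (Ioo 0 T)), L2Conv volume (fun j x => w j (t, x)) fun x => w₀ (t, x) := by
  have hm : AEMeasurable (fun z => ∑' j, ‖w j z - w₀ z‖ₑ ^ 2) (parabolicCylinder n T) :=
    AEMeasurable.tsum fun j => (((hw j).aestronglyMeasurable.sub h₀.1).enorm).pow_const 2
  have h1 := lintegral_tsum_sq_ne_top hw h₀ hj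
  rw [parabolicCylinder] at h1 hm
  rw [lintegral_prod _ hm] at h1
  have h2 : AEStronglyMeasurable w₀ ((volume.restrict (Ioo 0 T)).prod volume) := h₀.1
  filter_upwards [ae_lt_top' hm.lintegral_prod_right' h1, h2.prodMk_left] with t ht htm
  have hj2 : Tendsto (fun j => eLpNorm (fun x => w j (t, x) - w₀ (t, x)) 2 volume) atTop (𝓝 0) := by
    have hm : ∀ j, AEMeasurable (fun x => ‖w j (t, x) - w₀ (t, x)‖ₑ ^ 2) volume := fun j =>
      ((((hw j).memLp_slice t 2).1.sub htm).enorm).pow_const 2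
    rw [lintegral_tsum hm] at ht
    have h3 := ENNReal.tendsto_atTop_zero_of_tsum_ne_top ht.ne
    have h4 := ((ENNReal.continuous_rpow_const (y := 1 / 2)).tendsto 0).comp h3
    rw [ENNReal.zero_rpow_of_pos (by norm_num)] at h4
    refine h4.congr fun j => ?_
    rw [Function.comp_apply]
    change (∫⁻ x, ‖w j (t, x) - w₀ (t, x)‖ₑ ^ 2) ^ _ = _
    rw [← eLpNorm_two_sq, ← ENNReal.rpow_natCast, ← ENNReal.rpow_mul]
    norm_num
  refine ⟨fun j => (hw j).memLp_slice t 2, ?_, hj2⟩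
  obtain ⟨j, hj⟩ := (hj2.eventually (gt_mem_nhds one_pos)).exists
  have h5 : MemLp (fun x => w j (t, x) - w₀ (t, x)) 2 volume :=
    ⟨((hw j).memLp_slice t 2).1.sub htm, hj.trans ENNReal.one_lt_top⟩
  have h6 := ((hw j).memLp_slice t 2).sub h5
  refine h6.congr_norm htm (Eventually.of_forall fun x => ?_)
  simp

theorem l2Conv_of_fast (hw : ∀ j, Continuous (w j)) (h₀ : MemLp w₀ 2 (parabolicCylinder n T))
    (hj : ∀ j, eLpNorm (fun z => w j z - w₀ z) 2 (parabolicCylinder n T) ≤ (1 / 2) ^ j) :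
    L2Conv (parabolicCylinder n T) w w₀ :=
  ⟨fun j => (hw j).memLp_top_parabolicCylinder.mono_exponent le_top, h₀,
    tendsto_of_tendsto_of_tendsto_of_le_of_le tendsto_const_nhds
      (ENNReal.tendsto_pow_atTop_nhds_zero_of_lt_one (by simp)) (fun _ => zero_le) hj⟩

end FastConvergence

/-- A sequence of smooth functions which converges in the energy space, on the cylinder and on
almost every time slice. -/
structure IsApproxSeq {n : ℕ} (T : ℝ) (ρ₀ : UnitAddTorus (Fin n) → ℝ)
    (ρ : ℝ × UnitAddTorus (Fin n) → ℝ) (G : ℝ × UnitAddTorus (Fin n) → EuclideanSpace ℝ (Fin n))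
    (f : ℝ × UnitAddTorus (Fin n) → ℝ) (F : ℝ × UnitAddTorus (Fin n) → EuclideanSpace ℝ (Fin n))
    (u f' : ℕ → ℝ × UnitAddTorus (Fin n) → ℝ) (F' : ℕ → Fin n → ℝ × UnitAddTorus (Fin n) → ℝ) :
    Prop where
  smooth : ∀ j, IsSmooth (u j)
  smooth_source : ∀ j, IsSmooth (f' j)
  smooth_flux : ∀ j i, IsSmooth (F' j i)
  time : ∀ j, ∀ z : ℝ × UnitAddTorus (Fin n), z.1 ∈ Ico 0 T →
    timeDeriv (u j) z = f' j z + ∑ i, spaceGrad (F' j i) z i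
  conv : L2Conv (parabolicCylinder n T) u ρ
  grad : ∀ i, L2Conv (parabolicCylinder n T) (fun j z => spaceGrad (u j) z i) fun z => G z i
  source : L2Conv (parabolicCylinder n T) f' f
  flux : ∀ i, L2Conv (parabolicCylinder n T) (fun j z => F' j i z) fun z => F z i
  initial : L2Conv volume (fun j x => u j (0, x)) ρ₀
  ae : ∀ᵐ z ∂(parabolicCylinder n T), Tendsto (fun j => u j z) atTop (𝓝 (ρ z))
  slice : ∀ᵐ t ∂(volume.restrict (Ioo 0 T)), L2Conv volume (fun j x => u j (t, x)) fun x => ρ (t, x)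
  slice_grad : ∀ᵐ t ∂(volume.restrict (Ioo 0 T)), ∀ i,
    L2Conv volume (fun j x => spaceGrad (u j) (t, x) i) fun x => G (t, x) i

variable {ρ₀ : UnitAddTorus (Fin n) → ℝ} {ρ f : ℝ × UnitAddTorus (Fin n) → ℝ}
  {G F : ℝ × UnitAddTorus (Fin n) → EuclideanSpace ℝ (Fin n)}
  {u f' : ℕ → ℝ × UnitAddTorus (Fin n) → ℝ} {F' : ℕ → Fin n → ℝ × UnitAddTorus (Fin n) → ℝ}

theorem IsEnergyData.exists_isApproxSeq (hd : IsEnergyData T ρ₀ ρ G f F) :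
    ∃ u f' F', IsApproxSeq T ρ₀ ρ G f F u f' F' := by
  have h : ∀ j : ℕ, ((1 / 2 : ℝ≥0∞) ^ j) ≠ 0 := fun j => pow_ne_zero j (by simp)
  choose u f' F' hs using fun j => hd.exists_isSmoothApprox (h j)
  have hu := fun j => (hs j).smooth.continuous
  have hG := fun i j => ((hs j).smooth.smooth_spaceGrad i).continuous
  refine ⟨u, f', F', fun j => (hs j).smooth, fun j => (hs j).smooth_source,
    fun j => (hs j).smooth_flux, fun j => (hs j).time,
    l2Conv_of_fast hu hd.memLp fun j => (hs j).close,
    fun i => l2Conv_of_fast (hG i) (MemLp.coord hd.memLp_grad i) fun j => (hs j).close_grad i,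
    l2Conv_of_fast (fun j => (hs j).smooth_source.continuous) hd.memLp_source
      fun j => (hs j).close_source,
    fun i => l2Conv_of_fast (fun j => ((hs j).smooth_flux i).continuous) (MemLp.coord hd.memLp_flux i)
      fun j => (hs j).close_flux i, ?_,
    ae_tendsto_of_fast hu hd.memLp fun j => (hs j).close,
    ae_slice_l2Conv_of_fast hu hd.memLp fun j => (hs j).close,
    ae_all_iff.2 fun i => ae_slice_l2Conv_of_fast (hG i) (MemLp.coord hd.memLp_grad i)
      fun j => (hs j).close_grad i⟩
  exact ⟨fun j => (hu j).memLp_slice 0 2, hd.initial,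
    tendsto_of_tendsto_of_tendsto_of_le_of_le tendsto_const_nhds
      (ENNReal.tendsto_pow_atTop_nhds_zero_of_lt_one (by simp)) (fun _ => zero_le)
      fun j => (hs j).close_initial⟩

theorem contDiff_of_hasDerivAt {β g : ℝ → ℝ} (hg : ContDiff ℝ ∞ g)
    (hβ : ∀ s, HasDerivAt β (g s) s) : ContDiff ℝ ∞ β := by
  rw [contDiff_infty_iff_deriv, (funext fun s => (hβ s).deriv : deriv β = g)]
  exact ⟨fun s => (hβ s).differentiableAt, hg⟩

/-- The integrated chain rule for smooth functions with time derivative in divergence form. -/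
theorem IsSmooth.integral_comp_slice_sub {v s : ℝ × UnitAddTorus (Fin n) → ℝ}
    {Φ : Fin n → ℝ × UnitAddTorus (Fin n) → ℝ} (hv : IsSmooth v) (hs : IsSmooth s)
    (hΦ : ∀ i, IsSmooth (Φ i)) (ht : ∀ z : ℝ × UnitAddTorus (Fin n), z.1 ∈ Ico 0 T →
      timeDeriv v z = s z + ∑ i, spaceGrad (Φ i) z i) {g β : ℝ → ℝ} (hg : ContDiff ℝ ∞ g)
    (hβ : ∀ s, HasDerivAt β (g s) s) {t : ℝ} (htT : t ∈ Ioo 0 T) :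
    (∫ x, β (v (t, x))) - ∫ x, β (v (0, x)) =
      ∫ z, (g (v z) * s z - ∑ i, deriv g (v z) * spaceGrad v z i * Φ i z) ∂(parabolicCylinder n t) := by
  have hβs := contDiff_of_hasDerivAt hg hβ
  have hg' : ContDiff ℝ ∞ (deriv g) := (contDiff_infty_iff_deriv.1 hg).2
  have hβ' : deriv β = g := funext fun s => (hβ s).deriv
  have hc : Continuous fun z => g (v z) * s z - ∑ i, deriv g (v z) * spaceGrad v z i * Φ i z := by
    have a1 := (IsSmooth.smooth_comp hg hv).continuous
    have a2 := (IsSmooth.smooth_comp hg' hv).continuous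
    have a3 := fun i => (hv.smooth_spaceGrad i).continuous
    have a4 := fun i => (hΦ i).continuous
    exact (a1.mul hs.continuous).sub (continuous_finsetSum _ fun i _ => (a2.mul (a3 i)).mul (a4 i))
  rw [parabolicCylinder, integral_prod _ (memLp_one_iff_integrable.1
    (hc.memLp_top_parabolicCylinder.mono_exponent le_top)), ← integral_Ioc_eq_integral_Ioo,
    ← intervalIntegral.integral_of_le htT.1.le,
    (IsSmooth.smooth_comp hβs hv).integral_slice_sub 0 t]
  refine intervalIntegral.integral_congr fun τ hτ => ?_
  rw [uIcc_of_le htT.1.le] at hτ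
  -- Product rule: `g(v) ∂ᵢΦᵢ` is the total derivative `∂ᵢ(g(v) Φᵢ)`, which integrates to zero over
  -- the torus, minus `g'(v) ∂ᵢv Φᵢ`.
  have e1 : ∀ x, timeDeriv (fun z => β (v z)) (τ, x) =
      (g (v (τ, x)) * s (τ, x) - ∑ i, deriv g (v (τ, x)) * spaceGrad v (τ, x) i * Φ i (τ, x)) +
        ∑ i, spaceGrad (fun z => g (v z) * Φ i z) (τ, x) i := by
    intro x
    rw [IsSmooth.timeDeriv_comp hβs hv, hβ', ht _ ⟨hτ.1, hτ.2.trans_lt htT.2⟩, mul_add,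
      Finset.mul_sum, sub_add, sub_eq_add_neg, add_right_inj, ← Finset.sum_sub_distrib,
      ← Finset.sum_neg_distrib]
    refine Finset.sum_congr rfl fun i _ => ?_
    rw [IsSmooth.spaceGrad_mul (IsSmooth.smooth_comp hg hv) (hΦ i), IsSmooth.spaceGrad_comp hg hv]
    simp only [PiLp.add_apply, PiLp.smul_apply, smul_eq_mul]
    ring
  simp only [e1]
  have hP := fun i => ((IsSmooth.smooth_comp hg hv).mul (hΦ i))
  rw [integral_add (hc.integrable_slice τ) (integrable_finsetSum _ fun i _ =>
    ((hP i).smooth_spaceGrad i).continuous.integrable_slice τ),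
    integral_finsetSum _ fun i _ => ((hP i).smooth_spaceGrad i).continuous.integrable_slice τ]
  simp [(hP _).integral_spaceGrad]

/-- The integrated chain rule in the parabolic class. -/
theorem IsApproxSeq.ae_integral_comp_sub (ha : IsApproxSeq T ρ₀ ρ G f F u f' F') {g β : ℝ → ℝ}
    (hg : ContDiff ℝ ∞ g) {L : ℝ≥0} (hL : ∀ s, ‖deriv g s‖₊ ≤ L) (hβ : ∀ s, HasDerivAt β (g s) s) :
    ∀ᵐ t ∂(volume.restrict (Ioo 0 T)), Integrable (fun x => β (ρ (t, x))) volume ∧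
      (∫ x, β (ρ (t, x))) - ∫ x, β (ρ₀ x) =
      ∫ z, (g (ρ z) * f z - deriv g (ρ z) * inner ℝ (F z) (G z)) ∂(parabolicCylinder n t) := by
  have hgL : LipschitzWith L g :=
    lipschitzWith_of_nnnorm_deriv_le (hg.differentiable (by simp)) hL
  have hg' : Continuous (deriv g) := (contDiff_infty_iff_deriv.1 hg).2.continuous
  filter_upwards [ha.slice, ae_restrict_mem measurableSet_Ioo] with t ht htT
  have c1 := ht.tendsto_integral_comp hgL hβ
  have c2 := ha.initial.tendsto_integral_comp hgL hβ
  have hle := parabolicCylinder_mono (n := n) htT.2.le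
  have hac := (Measure.absolutelyContinuous_of_le hle)
  have c3 := ((ha.conv.mono_measure hle).comp_lipschitz hgL).tendsto_integral_mul
    (ha.source.mono_measure hle)
  -- The coefficient `g'(uⱼ)` is bounded and converges almost everywhere, the gradient converges in
  -- `L²`.
  have c4 : ∀ i, L2Conv (parabolicCylinder n t) (fun j z => deriv g (u j z) * spaceGrad (u j) z i)
      fun z => deriv g (ρ z) * G z i := fun i =>
    ((ha.grad i).mono_measure hle).bounded_mul (C := L)
      (fun j => (hg'.comp (ha.smooth j).continuous).aestronglyMeasurable)
      (fun j z => by simpa using NNReal.coe_le_coe.2 (hL (u j z)))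
      (hac.ae_le (ha.ae.mono fun z hz => (hg'.tendsto _).comp hz))
  have c5 := fun i => (c4 i).tendsto_integral_mul ((ha.flux i).mono_measure hle)
  refine ⟨c1.1, tendsto_nhds_unique (c1.2.sub c2.2) ?_⟩
  have e : ∫ z, (g (ρ z) * f z - deriv g (ρ z) * inner ℝ (F z) (G z)) ∂(parabolicCylinder n t) =
      (∫ z, g (ρ z) * f z ∂(parabolicCylinder n t)) -
        ∑ i, ∫ z, deriv g (ρ z) * G z i * F z i ∂(parabolicCylinder n t) := by
    rw [← integral_finsetSum _ fun i _ => (c4 i).memLp_lim.integrable_fun_mul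
      ((ha.flux i).mono_measure hle).memLp_lim, ← integral_sub
      (((ha.conv.mono_measure hle).comp_lipschitz hgL).memLp_lim.integrable_fun_mul
        (ha.source.mono_measure hle).memLp_lim) (integrable_finsetSum _ fun i _ =>
        (c4 i).memLp_lim.integrable_fun_mul ((ha.flux i).mono_measure hle).memLp_lim)]
    refine integral_congr_ae (Eventually.of_forall fun z => ?_)
    simp only [PiLp.inner_apply, RCLike.inner_apply, conj_trivial, Finset.mul_sum, mul_assoc]
  rw [e]
  refine (c3.sub (tendsto_finsetSum _ fun i _ => c5 i)).congr fun j => ?_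
  rw [(ha.smooth j).integral_comp_slice_sub (ha.smooth_source j) (ha.smooth_flux j) (ha.time j) hg hβ
    htT, ← integral_finsetSum _ fun i _ => ((c4 i).memLp j).integrable_fun_mul
      (((ha.flux i).mono_measure hle).memLp j), ← integral_sub
      ((((ha.conv.mono_measure hle).comp_lipschitz hgL).memLp j).integrable_fun_mul
        ((ha.source.mono_measure hle).memLp j)) (integrable_finsetSum _ fun i _ =>
        ((c4 i).memLp j).integrable_fun_mul (((ha.flux i).mono_measure hle).memLp j))]

end

/-! ### Gagliardo–Nirenberg–Sobolev on the torus -/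

section

variable {n : ℕ}

/-- `D` is the continuous gradient of the function `v` on the torus. -/
structure HasTorusGrad (v : UnitAddTorus (Fin n) → ℝ) (D : Fin n → UnitAddTorus (Fin n) → ℝ) :
    Prop where
  continuous : Continuous v
  continuous_grad : ∀ i, Continuous (D i)
  hasDerivAt : ∀ (x : UnitAddTorus (Fin n)) (i : Fin n) (s : ℝ), HasDerivAt
    (fun s : ℝ => v (x + Pi.single i (s : UnitAddCircle)))
    (D i (x + Pi.single i (s : UnitAddCircle))) s

variable {v : UnitAddTorus (Fin n) → ℝ} {D : Fin n → UnitAddTorus (Fin n) → ℝ}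

theorem continuous_line (x : UnitAddTorus (Fin n)) (i : Fin n) :
    Continuous fun s : ℝ => x + Pi.single i (s : UnitAddCircle) :=
  continuous_const.add ((continuous_single i).comp (AddCircle.continuous_mk' 1))

theorem lintegral_update_eq (F : UnitAddTorus (Fin n) → ℝ≥0∞) (x : UnitAddTorus (Fin n)) (i : Fin n) :
    ∫⁻ y : UnitAddCircle, F (Function.update x i y) =
      ∫⁻ s in Ioc (0 : ℝ) 1, F (x + Pi.single i (s : UnitAddCircle)) := by
  rw [← lintegral_add_left_eq_self (fun y : UnitAddCircle => F (Function.update x i y)) (x i),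
    ← UnitAddCircle.lintegral_preimage 0, zero_add]
  refine lintegral_congr fun s => ?_
  congr 1
  ext k
  by_cases h : k = i
  · subst h; simp
  · simp [h]

theorem HasTorusGrad.enorm_sub_le (h : HasTorusGrad v D) (x : UnitAddTorus (Fin n)) (i : Fin n)
    {s : ℝ} (hs : s ∈ Icc (0 : ℝ) 1) :
    ‖v (x + Pi.single i (s : UnitAddCircle)) - v x‖ₑ ≤
      ∫⁻ τ in Ioc (0 : ℝ) 1, ‖D i (x + Pi.single i (τ : UnitAddCircle))‖ₑ := by
  have hc : Continuous fun τ : ℝ => D i (x + Pi.single i (τ : UnitAddCircle)) :=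
    (h.continuous_grad i).comp (continuous_line x i)
  have h1 := intervalIntegral.integral_eq_sub_of_hasDerivAt (a := 0) (b := s)
    (fun τ _ => h.hasDerivAt x i τ) (hc.intervalIntegrable _ _)
  have h0 : x + Pi.single i ((0 : ℝ) : UnitAddCircle) = x := by simp
  rw [h0] at h1
  rw [← h1, intervalIntegral.integral_of_le hs.1]
  exact (enorm_integral_le_lintegral_enorm _).trans
    (lintegral_mono_set (Ioc_subset_Ioc_right hs.2))

/-- A `C¹` function is bounded by its average and the average of its derivative on each circle. -/
theorem HasTorusGrad.enorm_le_line (h : HasTorusGrad v D) (x : UnitAddTorus (Fin n)) (i : Fin n) :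
    ‖v x‖ₑ ≤ ∫⁻ y : UnitAddCircle,
      (‖v (Function.update x i y)‖ₑ + ‖D i (Function.update x i y)‖ₑ) := by
  rw [lintegral_update_eq (fun z => ‖v z‖ₑ + ‖D i z‖ₑ)]
  have hc : Continuous fun s : ℝ => v (x + Pi.single i (s : UnitAddCircle)) :=
    h.continuous.comp (continuous_line x i)
  rw [lintegral_add_left hc.enorm.measurable]
  have h1 : ‖v x‖ₑ = ∫⁻ _ in Ioc (0 : ℝ) 1, ‖v x‖ₑ := by simp
  have h2 : ∫⁻ τ in Ioc (0 : ℝ) 1, ‖D i (x + Pi.single i (τ : UnitAddCircle))‖ₑ =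
      ∫⁻ _ in Ioc (0 : ℝ) 1, ∫⁻ τ in Ioc (0 : ℝ) 1, ‖D i (x + Pi.single i (τ : UnitAddCircle))‖ₑ := by
    simp
  rw [h1, h2, ← lintegral_add_left hc.enorm.measurable]
  refine setLIntegral_mono' measurableSet_Ioc fun s hs => ?_
  have h3 := h.enorm_sub_le x i (Ioc_subset_Icc_self hs)
  calc ‖v x‖ₑ = ‖v (x + Pi.single i (s : UnitAddCircle)) -
        (v (x + Pi.single i (s : UnitAddCircle)) - v x)‖ₑ := by rw [sub_sub_cancel]
    _ ≤ _ := _root_.enorm_sub_le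
    _ ≤ _ := by gcongr

theorem HasTorusGrad.rpow (h : HasTorusGrad v D) {γ : ℝ} (hγ : 1 ≤ γ) :
    HasTorusGrad (fun x => v x ^ γ) fun i x => D i x * γ * v x ^ (γ - 1) :=
  ⟨h.continuous.rpow_const fun _ => Or.inr (by linarith), fun i =>
    ((h.continuous_grad i).mul continuous_const).mul
      (h.continuous.rpow_const fun _ => Or.inr (by linarith)),
    fun x i s => (h.hasDerivAt x i s).rpow_const (Or.inr hγ)⟩

/-- The square of the `H¹` norm. -/
noncomputable def torusEnergy (v : UnitAddTorus (Fin n) → ℝ) (D : Fin n → UnitAddTorus (Fin n) → ℝ) : ℝ≥0∞ :=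
  (∫⁻ x, ‖v x‖ₑ ^ 2) + ∑ i, ∫⁻ x, ‖D i x‖ₑ ^ 2

theorem HasTorusGrad.lintegral_sum_sq_le (h : HasTorusGrad v D) :
    ∫⁻ x, (‖v x‖ₑ + ∑ i, ‖D i x‖ₑ) ^ 2 ≤ ((n : ℝ≥0∞) + 1) * torusEnergy v D := by
  have h1 : ∀ x, (‖v x‖ₑ + ∑ i, ‖D i x‖ₑ) ^ 2 ≤
      ((n : ℝ≥0∞) + 1) * (‖v x‖ₑ ^ 2 + ∑ i, ‖D i x‖ₑ ^ 2) := by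
    intro x
    have := ENNReal.rpow_sum_le_const_mul_sum_rpow (Finset.univ : Finset (Option (Fin n)))
      (fun o => o.elim ‖v x‖ₑ fun i => ‖D i x‖ₑ) (p := 2) (by norm_num)
    norm_num [Fintype.sum_option, Finset.card_univ, Fintype.card_option] at this
    exact_mod_cast this
  refine (lintegral_mono h1).trans ?_
  have hm : ∀ i, Measurable fun x => ‖D i x‖ₑ ^ 2 := fun i =>
    (h.continuous_grad i).enorm.measurable.pow_const 2
  rw [lintegral_const_mul' _ _ (by finiteness), lintegral_add_left
    (h.continuous.enorm.measurable.pow_const 2), lintegral_finsetSum _ fun i _ => hm i, torusEnergy]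

theorem HasTorusGrad.torusEnergy_ne_top (h : HasTorusGrad v D) : torusEnergy v D ≠ ⊤ := by
  have : ∀ {F : UnitAddTorus (Fin n) → ℝ}, Continuous F → ∫⁻ x, ‖F x‖ₑ ^ 2 ≠ ⊤ := fun {F} hF => by
    rw [← eLpNorm_two_sq]
    exact ENNReal.pow_ne_top ((hF.comp continuous_snd).memLp_slice 0 2).2.ne
  exact ENNReal.add_ne_top.2 ⟨this h.continuous, ENNReal.sum_ne_top.2 fun i _ =>
    this (h.continuous_grad i)⟩

/-- Gagliardo's argument: `|v x|` is bounded by an integral along each of the `n` coordinate circles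
through `x`. The product of these bounds to the power `1/(n-1)` is integrated by the grid inequality
`lintegral_prod_lintegral_pow_le`. -/
theorem HasTorusGrad.lintegral_rpow_le_lintegral (h : HasTorusGrad v D) {N : ℝ}
    (hN : Real.HolderConjugate n N) :
    ∫⁻ x, ‖v x‖ₑ ^ N ≤ (∫⁻ x, (‖v x‖ₑ + ∑ i, ‖D i x‖ₑ)) ^ N := by
  have hn := hN.lt
  have hf : Measurable fun x => ‖v x‖ₑ + ∑ i, ‖D i x‖ₑ :=
    h.continuous.enorm.measurable.add
      (Finset.measurable_fun_sum _ fun i _ => (h.continuous_grad i).enorm.measurable)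
  have h1 := lintegral_prod_lintegral_pow_le (fun _ : Fin n => (volume : Measure UnitAddCircle))
    (p := N) (by simpa using hN) hf
  refine le_trans (lintegral_mono fun x => ?_) h1
  have h2 : ∀ i ∈ (Finset.univ : Finset (Fin n)), ‖v x‖ₑ ^ ((1 : ℝ) / (n - 1)) ≤
      (∫⁻ y : UnitAddCircle, (‖v (Function.update x i y)‖ₑ +
        ∑ j, ‖D j (Function.update x i y)‖ₑ)) ^ ((1 : ℝ) / (n - 1)) := fun i _ => by
    refine ENNReal.rpow_le_rpow ((h.enorm_le_line x i).trans (lintegral_mono fun y => ?_))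
      (div_nonneg zero_le_one (by linarith))
    gcongr
    exact Finset.single_le_sum (f := fun j => ‖D j (Function.update x i y)‖ₑ)
      (fun _ _ => zero_le) (Finset.mem_univ i)
  have h3 := Finset.prod_le_prod' h2
  simp only [Finset.prod_const, Finset.card_univ, Fintype.card_fin] at h3
  refine le_trans (le_of_eq ?_) (by simpa using h3)
  rw [← ENNReal.rpow_natCast, ← ENNReal.rpow_mul, hN.conjugate_eq]
  congr 1
  field_simp

/-- Each summand contains a factor `v ^ (γ - 1)`, which Cauchy–Schwarz separates from `|v| + |Dv|`.
The factor `γ` of the chain rule can be put on the first summand too, as `γ ≥ 1`. -/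
theorem HasTorusGrad.lintegral_rpow_add_le (h : HasTorusGrad v D) (h0 : ∀ x, 0 ≤ v x) {γ : ℝ}
    (hγ : 1 ≤ γ) :
    ∫⁻ x, (‖v x ^ γ‖ₑ + ∑ i, ‖D i x * γ * v x ^ (γ - 1)‖ₑ) ≤
      (ENNReal.ofReal γ ^ 2 * ((n : ℝ≥0∞) + 1) *
        ((∫⁻ x, ‖v x‖ₑ ^ (2 * (γ - 1))) * torusEnergy v D)) ^ (1 / 2 : ℝ) := by
  have e1 : ∀ x, ‖v x ^ γ‖ₑ = ‖v x‖ₑ ^ γ := fun x => Real.enorm_rpow_of_nonneg (h0 x) (by linarith)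
  simp only [e1]
  have h2 : ∀ x, ‖v x‖ₑ ^ γ + ∑ i, ‖D i x * γ * v x ^ (γ - 1)‖ₑ ≤
      ENNReal.ofReal γ * (‖v x‖ₑ ^ (γ - 1) * (‖v x‖ₑ + ∑ i, ‖D i x‖ₑ)) := by
    intro x
    have a1 : ‖v x‖ₑ ^ γ = ‖v x‖ₑ ^ (γ - 1) * ‖v x‖ₑ := by
      conv_rhs => rw [← ENNReal.rpow_one ‖v x‖ₑ, ← ENNReal.rpow_mul, one_mul,
        ← ENNReal.rpow_add_of_nonneg _ _ (by linarith) zero_le_one]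
      ring_nf
    rw [mul_add, mul_add, Finset.mul_sum, Finset.mul_sum]
    refine add_le_add ?_ (Finset.sum_le_sum fun i _ => le_of_eq ?_)
    · rw [a1]
      exact le_mul_of_one_le_left zero_le (by simpa using hγ)
    · rw [enorm_mul, enorm_mul, Real.enorm_rpow_of_nonneg (h0 x) (by linarith),
        Real.enorm_of_nonneg (by linarith : 0 ≤ γ)]
      ring
  have hm1 : AEMeasurable (fun x => ‖v x‖ₑ ^ (2 * (γ - 1))) volume :=
    (h.continuous.enorm.measurable.pow_const _).aemeasurable
  have hm2 : AEMeasurable (fun x => (‖v x‖ₑ + ∑ i, ‖D i x‖ₑ) ^ 2) volume :=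
    ((h.continuous.enorm.measurable.add (Finset.measurable_fun_sum _ fun i _ =>
      (h.continuous_grad i).enorm.measurable)).pow_const 2).aemeasurable
  refine (lintegral_mono h2).trans ?_
  rw [lintegral_const_mul' _ _ ENNReal.ofReal_ne_top]
  have h4 := ENNReal.lintegral_mul_norm_pow_le hm1 hm2 (p := 1 / 2) (q := 1 / 2)
    (by norm_num) (by norm_num) (by norm_num)
  have e2 : ∀ x, (‖v x‖ₑ ^ (2 * (γ - 1))) ^ (1 / 2 : ℝ) *
      ((‖v x‖ₑ + ∑ i, ‖D i x‖ₑ) ^ 2) ^ (1 / 2 : ℝ) =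
      ‖v x‖ₑ ^ (γ - 1) * (‖v x‖ₑ + ∑ i, ‖D i x‖ₑ) := by
    intro x
    rw [← ENNReal.rpow_mul, ← ENNReal.rpow_natCast, ← ENNReal.rpow_mul]
    have : 2 * (γ - 1) * (1 / 2) = γ - 1 := by ring
    norm_num [this]
  simp only [e2] at h4
  have h5 := ENNReal.rpow_le_rpow h.lintegral_sum_sq_le (z := 1 / 2) (by norm_num)
  calc _ ≤ ENNReal.ofReal γ * ((∫⁻ x, ‖v x‖ₑ ^ (2 * (γ - 1))) ^ (1 / 2 : ℝ) *
        (((n : ℝ≥0∞) + 1) * torusEnergy v D) ^ (1 / 2 : ℝ)) := by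
        gcongr
        exact h4.trans (by gcongr)
    _ = _ := by
        have e3 : ENNReal.ofReal γ = (ENNReal.ofReal γ ^ 2) ^ (1 / 2 : ℝ) := by
          rw [← ENNReal.rpow_natCast, ← ENNReal.rpow_mul]
          norm_num
        conv_lhs => rw [e3]
        rw [← ENNReal.mul_rpow_of_nonneg _ _ (by norm_num),
          ← ENNReal.mul_rpow_of_nonneg _ _ (by norm_num)]
        congr 1
        ring

/-- The Gagliardo–Nirenberg–Sobolev inequality for powers. -/
theorem HasTorusGrad.lintegral_rpow_le (h : HasTorusGrad v D) (h0 : ∀ x, 0 ≤ v x) {N γ : ℝ}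
    (hN : Real.HolderConjugate n N) (hγ : 1 ≤ γ) :
    ∫⁻ x, ‖v x‖ₑ ^ (γ * N) ≤ (ENNReal.ofReal γ ^ 2 * ((n : ℝ≥0∞) + 1) *
      ((∫⁻ x, ‖v x‖ₑ ^ (2 * (γ - 1))) * torusEnergy v D)) ^ (N / 2) := by
  have hN0 : 0 ≤ N := hN.symm.nonneg
  have h1 := (h.rpow hγ).lintegral_rpow_le_lintegral hN
  have e1 : ∀ x, ‖v x ^ γ‖ₑ = ‖v x‖ₑ ^ γ := fun x => Real.enorm_rpow_of_nonneg (h0 x) (by linarith)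
  simp only [e1, ← ENNReal.rpow_mul] at h1
  have h3 := h.lintegral_rpow_add_le h0 hγ
  simp only [e1] at h3
  refine h1.trans ?_
  refine (ENNReal.rpow_le_rpow h3 hN0).trans (le_of_eq ?_)
  rw [← ENNReal.rpow_mul]
  congr 1
  ring

end

/-! ### Sobolev, Ladyzhenskaya and their interpolation -/

section

variable {n : ℕ}

/-- Absorption of `S ^ θ` into the left side, which is why `S` must be finite beforehand. -/
theorem ENNReal.le_rpow_of_le_mul_rpow {S A : ℝ≥0∞} {θ : ℝ} (hS : S ≠ ⊤) (hθ : 0 < θ) (hθ1 : θ < 1)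
    (h : S ≤ (A * S) ^ θ) : S ≤ A ^ (θ / (1 - θ)) := by
  rcases eq_or_ne S 0 with h0 | h0
  · simp [h0]
  rw [ENNReal.mul_rpow_of_nonneg _ _ hθ.le] at h
  have h1 : S ^ (1 - θ) ≤ A ^ θ := by
    rw [ENNReal.rpow_sub _ _ h0 hS, ENNReal.rpow_one]
    exact ENNReal.div_le_of_le_mul h
  have h2 := ENNReal.rpow_le_rpow h1 (z := 1 / (1 - θ)) (by
    have := sub_pos.2 hθ1
    positivity)
  rw [← ENNReal.rpow_mul, ← ENNReal.rpow_mul, mul_one_div_cancel (sub_pos.2 hθ1).ne',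
    ENNReal.rpow_one, mul_one_div] at h2
  exact h2

theorem HasTorusGrad.lintegral_rpow_ne_top {v : UnitAddTorus (Fin n) → ℝ}
    {D : Fin n → UnitAddTorus (Fin n) → ℝ} (h : HasTorusGrad v D) {s : ℝ} (hs : 0 ≤ s) :
    ∫⁻ x, ‖v x‖ₑ ^ s ≠ ⊤ := by
  obtain ⟨C, hC⟩ := isCompact_univ.exists_bound_of_continuousOn h.continuous.continuousOn
  have : ∀ x, ‖v x‖ₑ ^ s ≤ ENNReal.ofReal C ^ s := fun x => by
    refine ENNReal.rpow_le_rpow ?_ hs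
    rw [← ofReal_norm]
    exact ENNReal.ofReal_le_ofReal (hC x (mem_univ x))
  refine ne_top_of_le_ne_top ?_ (lintegral_mono this)
  simp only [lintegral_const, measure_univ, mul_one]
  exact ENNReal.rpow_ne_top_of_nonneg hs ENNReal.ofReal_ne_top

/-- The Sobolev inequality in dimension at least three. -/
theorem exists_sobolev (hn : 3 ≤ n) : ∃ K : ℝ≥0, ∀ (v : UnitAddTorus (Fin n) → ℝ) D,
    HasTorusGrad v D → (∀ x, 0 ≤ v x) →
    ∫⁻ x, ‖v x‖ₑ ^ (2 * ((n : ℝ) / (n - 2))) ≤ K * torusEnergy v D ^ ((n : ℝ) / (n - 2)) := by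
  have hn' : (3 : ℝ) ≤ n := by exact_mod_cast hn
  have h2 : (0 : ℝ) < n - 2 := by linarith
  have h1 : (0 : ℝ) < n - 1 := by linarith
  -- With this `γ` the exponents `γ n/(n-1)` on the left and `2(γ-1)` on the right are both
  -- `2n/(n-2)`, so the integral on the right can be absorbed.
  set γ : ℝ := 2 * (n - 1) / (n - 2) with hγ
  have hγ1 : 1 ≤ γ := by rw [hγ, le_div_iff₀ h2]; linarith
  have hN : Real.HolderConjugate (n : ℝ) (n / (n - 1)) :=
    Real.HolderConjugate.conjExponent (by linarith)
  set A : ℝ≥0∞ := ENNReal.ofReal γ ^ 2 * ((n : ℝ≥0∞) + 1) with hA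
  have hA' : A ≠ ⊤ := by rw [hA]; finiteness
  have hm : 0 ≤ (n : ℝ) / (n - 2) := by positivity
  refine ⟨(A ^ ((n : ℝ) / (n - 2))).toNNReal, fun v D h h0 => ?_⟩
  rw [ENNReal.coe_toNNReal (ENNReal.rpow_ne_top_of_nonneg hm hA'),
    ← ENNReal.mul_rpow_of_nonneg _ _ hm]
  have h3 := h.lintegral_rpow_le h0 hN hγ1
  have e1 : γ * (n / (n - 1)) = 2 * ((n : ℝ) / (n - 2)) := by rw [hγ]; field_simp
  have e2 : 2 * (γ - 1) = 2 * ((n : ℝ) / (n - 2)) := by rw [hγ]; field_simp; ring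
  rw [e1, e2, mul_comm (∫⁻ x, ‖v x‖ₑ ^ (2 * ((n : ℝ) / (n - 2)))), ← mul_assoc] at h3
  have h4 := ENNReal.le_rpow_of_le_mul_rpow (h.lintegral_rpow_ne_top (by positivity))
    (by positivity) (by rw [div_div, div_lt_one (by positivity)]; linarith) h3
  have e3 : (n / (n - 1) / 2 : ℝ) / (1 - n / (n - 1) / 2) = n / (n - 2) := by
    have : (1 - n / (n - 1) / 2 : ℝ) = (n - 2) / (2 * (n - 1)) := by field_simp; ring
    rw [this]
    field_simp
  rwa [e3] at h4

/-- The Ladyzhenskaya inequalities in dimension two. -/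
theorem exists_ladyzhenskaya (k : ℕ) : ∃ K : ℝ≥0, ∀ (v : UnitAddTorus (Fin 2) → ℝ) D,
    HasTorusGrad v D → (∀ x, 0 ≤ v x) →
    ∫⁻ x, ‖v x‖ₑ ^ (2 * ((k : ℝ) + 1)) ≤ K * ((∫⁻ x, ‖v x‖ₑ ^ 2) * torusEnergy v D ^ (k : ℝ)) := by
  induction k with
  | zero =>
    refine ⟨1, fun v D _ _ => le_of_eq ?_⟩
    simp
  | succ k ih =>
    obtain ⟨K, hK⟩ := ih
    have hN : Real.HolderConjugate ((2 : ℕ) : ℝ) 2 := by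
      have := Real.HolderConjugate.two_two
      exact_mod_cast this
    set A : ℝ≥0∞ := ENNReal.ofReal ((k : ℝ) + 2) ^ 2 * (((2 : ℕ) : ℝ≥0∞) + 1) with hA
    have hA' : A ≠ ⊤ := by rw [hA]; finiteness
    refine ⟨A.toNNReal * K, fun v D h h0 => ?_⟩
    -- Here `N = 2`, so `γ = k + 2` raises the exponent from `2(k+1)` to `2(k+2)` at the cost of one
    -- factor of the energy.
    have h3 := h.lintegral_rpow_le h0 hN (γ := (k : ℝ) + 2) (by linarith [k.cast_nonneg (α := ℝ)])
    rw [div_self two_ne_zero, ENNReal.rpow_one] at h3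
    have e1 : 2 * (((k + 1 : ℕ) : ℝ) + 1) = ((k : ℝ) + 2) * 2 := by push_cast; ring
    have e2 : 2 * ((k : ℝ) + 2 - 1) = 2 * ((k : ℝ) + 1) := by ring
    rw [e2] at h3
    rw [e1, ENNReal.coe_mul, ENNReal.coe_toNNReal hA']
    refine h3.trans ?_
    calc _ ≤ A * (K * ((∫⁻ x, ‖v x‖ₑ ^ 2) * torusEnergy v D ^ (k : ℝ)) * torusEnergy v D) := by
          gcongr
          exact hK v D h h0
      _ = _ := by
          push_cast
          rw [ENNReal.rpow_add_of_nonneg _ _ (by positivity) zero_le_one, ENNReal.rpow_one]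
          ring

/-- Interpolation of a Gagliardo–Nirenberg inequality with Hölder's inequality. -/
theorem lintegral_mul_sq_le_of_endpoint {v : UnitAddTorus (Fin n) → ℝ} (hv : Continuous v)
    {K Z : ℝ≥0∞} {m b q : ℝ} (hm : 1 < m) (hbm : b ≤ m)
    (h : ∫⁻ x, ‖v x‖ₑ ^ (2 * m) ≤ K * ((∫⁻ x, ‖v x‖ₑ ^ 2) ^ (m - b) * Z ^ b))
    (hq : m / (m - 1) ≤ q) {e : UnitAddTorus (Fin n) → ℝ≥0∞} (he : AEMeasurable e volume) :
    ∫⁻ x, e x * ‖v x‖ₑ ^ 2 ≤ K ^ (1 / (q * (m - 1))) * ((∫⁻ x, e x ^ q) ^ (1 / q) *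
      ((∫⁻ x, ‖v x‖ₑ ^ 2) ^ (1 - b / (q * (m - 1))) * Z ^ (b / (q * (m - 1))))) := by
  have hm1 : 0 < m - 1 := by linarith
  have hq0 : 0 < q := lt_of_lt_of_le (by positivity) hq
  rw [div_le_iff₀ hm1] at hq
  set X := ∫⁻ x, ‖v x‖ₑ ^ 2
  -- Hölder with weights `1/q`, `1 - mκ`, `κ` on `e ^ q`, `|v|²`, `|v| ^ (2m)`: they sum to one, the
  -- powers of `v` recombine to `|v|²`, and the middle weight is nonnegative exactly when `m/(m-1) ≤
  -- q`.
  set κ := 1 / (q * (m - 1)) with hκ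
  have hκ0 : 0 < κ := by positivity
  have hα : 0 ≤ 1 - m * κ := by
    rw [hκ, mul_one_div, sub_nonneg, div_le_one (by positivity)]
    exact hq
  have e0 : b / (q * (m - 1)) = b * κ := by rw [hκ, mul_one_div]
  rw [e0]
  have h1 := ENNReal.lintegral_prod_norm_pow_le (μ := (volume : Measure (UnitAddTorus (Fin n))))
    (Finset.univ : Finset (Fin 3))
    (f := ![fun x => e x ^ q, fun x => ‖v x‖ₑ ^ 2, fun x => ‖v x‖ₑ ^ (2 * m)])
    (p := ![1 / q, 1 - m * κ, κ]) (by
      intro i _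
      fin_cases i
      · exact he.pow_const _
      · exact (hv.enorm.measurable.pow_const 2).aemeasurable
      · exact (hv.enorm.measurable.pow_const _).aemeasurable) (by
      simp only [Fin.sum_univ_three, Matrix.cons_val_zero, Matrix.cons_val_one, Matrix.cons_val]
      rw [hκ]; field_simp; ring) (by
      intro i _
      fin_cases i
      · simp only [Fin.zero_eta, Matrix.cons_val_zero]; positivity
      · exact hα
      · exact hκ0.le)
  simp only [Fin.prod_univ_three, Matrix.cons_val_zero, Matrix.cons_val_one, Matrix.cons_val] at h1
  have e1 : ∀ x, (e x ^ q) ^ (1 / q) * (‖v x‖ₑ ^ 2) ^ (1 - m * κ) * (‖v x‖ₑ ^ (2 * m)) ^ κ =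
      e x * ‖v x‖ₑ ^ 2 := by
    intro x
    rw [← ENNReal.rpow_mul, mul_one_div_cancel hq0.ne', ENNReal.rpow_one, mul_assoc,
      ← ENNReal.rpow_natCast, ← ENNReal.rpow_mul, ← ENNReal.rpow_mul,
      ← ENNReal.rpow_add_of_nonneg _ _ (by positivity) (by positivity)]
    congr 2
    push_cast
    ring
  simp only [e1] at h1
  refine h1.trans ?_
  calc _ ≤ (∫⁻ x, e x ^ q) ^ (1 / q) * X ^ (1 - m * κ) * (K * (X ^ (m - b) * Z ^ b)) ^ κ := by
        gcongr
    _ = _ := by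
        rw [ENNReal.mul_rpow_of_nonneg _ _ hκ0.le, ENNReal.mul_rpow_of_nonneg _ _ hκ0.le,
          ← ENNReal.rpow_mul, ← ENNReal.rpow_mul,
          show 1 - b * κ = (1 - m * κ) + (m - b) * κ by ring,
          ENNReal.rpow_add_of_nonneg _ _ hα (mul_nonneg (by linarith) hκ0.le)]
        ring

/-- In dimension one the circle through `x` is the whole torus, so the line estimate for `v²` is
already pointwise. The constant `8` is `γ²(n+1)` with `γ = 2` and `n = 1`. -/
theorem HasTorusGrad.enorm_sq_le_of_dim_one {v : UnitAddTorus (Fin 1) → ℝ}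
    {D : Fin 1 → UnitAddTorus (Fin 1) → ℝ} (h : HasTorusGrad v D) (h0 : ∀ x, 0 ≤ v x)
    (x : UnitAddTorus (Fin 1)) :
    ‖v x‖ₑ ^ 2 ≤ (8 * ((∫⁻ x, ‖v x‖ₑ ^ 2) * torusEnergy v D)) ^ (1 / 2 : ℝ) := by
  have h1 := (h.rpow one_le_two).enorm_le_line x 0
  have h2 := h.lintegral_rpow_add_le h0 one_le_two
  have e1 : ∀ F : UnitAddTorus (Fin 1) → ℝ≥0∞, ∫⁻ y : UnitAddCircle, F (Function.update x 0 y) =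
      ∫⁻ z, F z := fun F => by
    have a1 := lmarginal_univ (μ := fun _ : Fin 1 => (volume : Measure UnitAddCircle)) (f := F)
    have a2 := lmarginal_singleton (μ := fun _ : Fin 1 => (volume : Measure UnitAddCircle)) F 0
    rw [Finset.univ_unique, show (default : Fin 1) = 0 from rfl, a2] at a1
    exact congrFun a1 x
  rw [e1 fun z => ‖v z ^ (2 : ℝ)‖ₑ + ‖D 0 z * 2 * v z ^ ((2 : ℝ) - 1)‖ₑ] at h1
  have e2 : ‖v x‖ₑ ^ 2 = ‖v x ^ (2 : ℝ)‖ₑ := by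
    rw [Real.enorm_rpow_of_nonneg (h0 x) zero_le_two, ← ENNReal.rpow_natCast]
    norm_num
  rw [e2]
  refine h1.trans (le_trans (le_of_eq ?_) (h2.trans (le_of_eq ?_)))
  · simp
  · norm_num

/-- The Gagliardo–Nirenberg inequality in the form of a bound on a quadratic form. -/
theorem exists_lintegral_mul_sq_le {q : ℝ}
    (hq : (2 ≤ n ∧ (n : ℝ) / 2 < q) ∨ (n = 1 ∧ 1 ≤ q)) :
    ∃ K : ℝ≥0, ∀ (v : UnitAddTorus (Fin n) → ℝ) D, HasTorusGrad v D → (∀ x, 0 ≤ v x) →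
    ∀ e : UnitAddTorus (Fin n) → ℝ≥0∞, AEMeasurable e volume →
    ∫⁻ x, e x * ‖v x‖ₑ ^ 2 ≤ K * ((∫⁻ x, e x ^ q) ^ (1 / q) *
      ((∫⁻ x, ‖v x‖ₑ ^ 2) ^ (1 - n / (2 * q)) * torusEnergy v D ^ (n / (2 * q)))) := by
  rcases hq with ⟨hn, hq⟩ | ⟨rfl, hq⟩
  -- One endpoint exponent `2m` suffices: with energy exponent `n(m-1)/2`, the interpolated exponent
  -- is `n/(2q)` whatever `m` is.
  · suffices h : ∃ m : ℝ, 1 < m ∧ m / (m - 1) ≤ q ∧ (n * (m - 1) / 2 : ℝ) ≤ m ∧ ∃ K : ℝ≥0,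
        ∀ (v : UnitAddTorus (Fin n) → ℝ) D, HasTorusGrad v D → (∀ x, 0 ≤ v x) →
        ∫⁻ x, ‖v x‖ₑ ^ (2 * m) ≤ K * ((∫⁻ x, ‖v x‖ₑ ^ 2) ^ (m - (n * (m - 1) / 2)) *
          torusEnergy v D ^ (n * (m - 1) / 2)) by
      obtain ⟨m, hm, hmq, hbm, K, hK⟩ := h
      have hm1 : 0 < m - 1 := by linarith
      have hq0 : 0 < q := lt_of_lt_of_le (by positivity) hmq
      refine ⟨K ^ (1 / (q * (m - 1))), fun v D h h0 e he => ?_⟩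
      have := lintegral_mul_sq_le_of_endpoint h.continuous hm hbm (hK v D h h0)
        hmq he
      rw [ENNReal.coe_rpow_of_nonneg _ (by positivity)]
      rwa [show n * (m - 1) / 2 / (q * (m - 1)) = n / (2 * q) by field_simp] at this
    rcases hn.eq_or_lt with rfl | hn
    · have hq1 : 0 < q - 1 := by norm_num at hq; linarith
      -- For `m = k + 1` the requirement `m/(m-1) ≤ q` reads `1 + 1/k ≤ q`, which holds for large
      -- `k` since `q > 1`.
      obtain ⟨k, hk⟩ := exists_nat_gt (1 / (q - 1))
      have hk0 : (0 : ℝ) < k := lt_trans (by positivity) hk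
      obtain ⟨K, hK⟩ := exists_ladyzhenskaya k
      refine ⟨(k : ℝ) + 1, by linarith, ?_, by push_cast; linarith, K, fun v D h h0 => ?_⟩
      · rw [div_lt_iff₀ hq1] at hk
        rw [add_sub_cancel_right, div_le_iff₀ hk0]
        linarith
      · convert hK v D h h0 using 3
        · convert ENNReal.rpow_one _
          push_cast
          ring
        · congr 1
          push_cast
          ring
    · have hn' : (3 : ℝ) ≤ n := by exact_mod_cast hn
      have h2 : (0 : ℝ) < n - 2 := by linarith
      obtain ⟨K, hK⟩ := exists_sobolev hn
      have e1 : (n * ((n : ℝ) / (n - 2) - 1) / 2 : ℝ) = n / (n - 2) := by field_simp; ring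
      refine ⟨(n : ℝ) / (n - 2), by rw [lt_div_iff₀ h2]; linarith, ?_, e1.le, K, fun v D h h0 => ?_⟩
      · rw [show (n : ℝ) / (n - 2) / (n / (n - 2) - 1) = n / 2 by
          rw [div_sub_one h2.ne', div_div_div_cancel_right₀ h2.ne']; ring]
        exact hq.le
      · rw [e1, sub_self, ENNReal.rpow_zero, one_mul]
        exact hK v D h h0
  · have hq0 : 0 < q := by linarith
    have h1q : 1 / q ≤ 1 := by rwa [div_le_one hq0]
    refine ⟨8 ^ (1 / (2 * q)), fun v D h h0 e he => ?_⟩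
    set X := ∫⁻ x, ‖v x‖ₑ ^ 2
    set Z := torusEnergy v D
    have h1 : ∀ x, e x * ‖v x‖ₑ ^ 2 ≤
        (8 * (X * Z)) ^ (1 / (2 * q)) * ((e x ^ q) ^ (1 / q) * (‖v x‖ₑ ^ 2) ^ (1 - 1 / q)) := by
      intro x
      have a1 : ‖v x‖ₑ ^ 2 = (‖v x‖ₑ ^ 2) ^ (1 / q) * (‖v x‖ₑ ^ 2) ^ (1 - 1 / q) := by
        rw [← ENNReal.rpow_add_of_nonneg _ _ (by positivity) (by linarith), add_sub_cancel,
          ENNReal.rpow_one]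
      have a2 := ENNReal.rpow_le_rpow (h.enorm_sq_le_of_dim_one h0 x) (z := 1 / q) (by positivity)
      rw [← ENNReal.rpow_mul, show (1 / 2 : ℝ) * (1 / q) = 1 / (2 * q) by field_simp] at a2
      rw [← ENNReal.rpow_mul, mul_one_div_cancel hq0.ne', ENNReal.rpow_one]
      calc e x * ‖v x‖ₑ ^ 2 = (‖v x‖ₑ ^ 2) ^ (1 / q) * (e x * (‖v x‖ₑ ^ 2) ^ (1 - 1 / q)) := by
            conv_lhs => rw [a1]
            ring
        _ ≤ _ := by gcongr
    have h2 := ENNReal.lintegral_mul_norm_pow_le (he.pow_const q)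
      (h.continuous.enorm.measurable.pow_const 2).aemeasurable (p := 1 / q) (q := 1 - 1 / q)
      (by positivity) (by linarith) (by ring)
    have hZ : Z ≠ ⊤ := h.torusEnergy_ne_top
    have hX : X ≠ ⊤ := ne_top_of_le_ne_top hZ le_self_add
    refine (lintegral_mono h1).trans ?_
    rw [lintegral_const_mul' _ _ (ENNReal.rpow_ne_top_of_nonneg (by positivity) (by finiteness))]
    calc _ ≤ (8 * (X * Z)) ^ (1 / (2 * q)) * ((∫⁻ x, e x ^ q) ^ (1 / q) * X ^ (1 - 1 / q)) := by
          gcongr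
      _ = _ := by
          rw [ENNReal.mul_rpow_of_nonneg _ _ (by positivity),
            ENNReal.mul_rpow_of_nonneg _ _ (by positivity), Nat.cast_one,
            show (1 - 1 / (2 * q) : ℝ) = 1 / (2 * q) + (1 - 1 / q) by field_simp; ring,
            ENNReal.rpow_add_of_nonneg _ _ (by positivity) (by linarith),
            ENNReal.coe_rpow_of_nonneg _ (by positivity)]
          push_cast
          ring

end

/-! ### Form bounds for the divergence and the Poincaré inequality -/

section

variable {n : ℕ}

theorem ENNReal.rpow_mul_rpow_le_add (a b : ℝ≥0∞) {s : ℝ} (h0 : 0 ≤ s) (h1 : s ≤ 1) :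
    a ^ s * b ^ (1 - s) ≤ a + b := by
  calc a ^ s * b ^ (1 - s) ≤ (a + b) ^ s * (a + b) ^ (1 - s) := by
        gcongr
        · exact le_self_add
        · exact le_add_self
    _ = a + b := by
        rw [← ENNReal.rpow_add_of_nonneg _ _ h0 (by linarith), add_sub_cancel, ENNReal.rpow_one]

/-- Young's inequality without optimal constants: both factors of a weighted geometric mean are at
most `a + b`. The power of `η⁻¹` put into the first factor compensates for the `η` in the second. -/
theorem ENNReal.young_epsilon {N X Z K : ℝ≥0∞} {η : ℝ≥0} {r : ℝ} (hr : 1 ≤ r) (hη : η ≠ 0) :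
    K * (N * (X ^ (1 / r) * Z ^ (1 - 1 / r))) ≤
      (K * ((η : ℝ≥0∞)⁻¹) ^ (1 - 1 / r)) ^ r * (N ^ r * X) + η * Z := by
  have hr0 : 0 < r := by linarith
  have h1r : 1 / r ≤ 1 := by rwa [div_le_one hr0]
  have h := ENNReal.rpow_mul_rpow_le_add ((K * ((η : ℝ≥0∞)⁻¹) ^ (1 - 1 / r)) ^ r * (N ^ r * X))
    (η * Z) (s := 1 / r) (by positivity) h1r
  refine le_trans (le_of_eq ?_) h
  have h2 : 0 ≤ 1 - 1 / r := by linarith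
  rw [ENNReal.mul_rpow_of_nonneg _ _ (by positivity),
    ENNReal.mul_rpow_of_nonneg (N ^ r) X (by positivity), ← ENNReal.rpow_mul, ← ENNReal.rpow_mul,
    mul_one_div_cancel hr0.ne', ENNReal.rpow_one, ENNReal.rpow_one, ENNReal.mul_rpow_of_nonneg _ _ h2]
  have h3 : ((η : ℝ≥0∞)⁻¹) ^ (1 - 1 / r) * (η : ℝ≥0∞) ^ (1 - 1 / r) = 1 := by
    rw [← ENNReal.mul_rpow_of_nonneg _ _ h2, ENNReal.inv_mul_cancel (by simpa using hη)
      ENNReal.coe_ne_top, ENNReal.one_rpow]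
  calc _ = K * (N * (X ^ (1 / r) * Z ^ (1 - 1 / r))) *
        (((η : ℝ≥0∞)⁻¹) ^ (1 - 1 / r) * (η : ℝ≥0∞) ^ (1 - 1 / r)) := by rw [h3, mul_one]
    _ = _ := by ring

theorem AdmissibleExponents.one_le {r : ℝ} {q : ℝ≥0∞} (h : AdmissibleExponents n r q) : 1 ≤ r := by
  rcases h.2 with h | h
  exacts [h.2.1, h.2.1]

/-- The quadratic form of an admissible potential is form bounded with respect to the Dirichlet
form, with arbitrarily small relative bound. -/
theorem AdmissibleExponents.exists_lintegral_mul_sq_le {r : ℝ} {q : ℝ≥0∞}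
    (hrq : AdmissibleExponents n r q) {η : ℝ≥0} (hη : η ≠ 0) :
    ∃ K : ℝ≥0, ∀ (v : UnitAddTorus (Fin n) → ℝ) D, HasTorusGrad v D → (∀ x, 0 ≤ v x) →
    ∀ d : UnitAddTorus (Fin n) → ℝ, AEStronglyMeasurable d volume →
    ∫⁻ x, ‖d x‖ₑ * ‖v x‖ₑ ^ 2 ≤ K * (eLpNorm d q volume ^ r * ∫⁻ x, ‖v x‖ₑ ^ 2) +
      η * torusEnergy v D := by
  have hr := hrq.one_le
  have hr0 : 0 < r := by linarith
  have h1r : 1 / r ≤ 1 := by rwa [div_le_one hr0]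
  suffices h : ∃ K : ℝ≥0, ∀ (v : UnitAddTorus (Fin n) → ℝ) D, HasTorusGrad v D → (∀ x, 0 ≤ v x) →
      ∀ d : UnitAddTorus (Fin n) → ℝ, AEStronglyMeasurable d volume →
      ∫⁻ x, ‖d x‖ₑ * ‖v x‖ₑ ^ 2 ≤ K * (eLpNorm d q volume * ((∫⁻ x, ‖v x‖ₑ ^ 2) ^ (1 / r) *
        torusEnergy v D ^ (1 - 1 / r))) by
    obtain ⟨K, hK⟩ := h
    have hfin : (K * ((η : ℝ≥0∞)⁻¹) ^ (1 - 1 / r)) ^ r ≠ ⊤ :=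
      ENNReal.rpow_ne_top_of_nonneg hr0.le (ENNReal.mul_ne_top ENNReal.coe_ne_top
        (ENNReal.rpow_ne_top_of_nonneg (by linarith) (by simpa using hη)))
    refine ⟨((K * ((η : ℝ≥0∞)⁻¹) ^ (1 - 1 / r)) ^ r).toNNReal, fun v D h h0 d hd => ?_⟩
    rw [ENNReal.coe_toNNReal hfin]
    exact (hK v D h h0 d hd).trans (ENNReal.young_epsilon hr hη)
  -- The energy dominates `∫ v²`, so its exponent `θ` may be increased to `1 - 1/r`. Applied to `θ =
  -- n/(2q)`, or `θ = 0` if `q = ∞`, this is where the scaling condition on the exponents is used.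
  have mono : ∀ (v : UnitAddTorus (Fin n) → ℝ) D (θ : ℝ), 0 ≤ θ → θ ≤ 1 - 1 / r →
      (∫⁻ x, ‖v x‖ₑ ^ 2) ^ (1 - θ) * torusEnergy v D ^ θ ≤
        (∫⁻ x, ‖v x‖ₑ ^ 2) ^ (1 / r) * torusEnergy v D ^ (1 - 1 / r) := by
    intro v D θ h0 hθ
    have h1 : (∫⁻ x, ‖v x‖ₑ ^ 2) ≤ torusEnergy v D := le_self_add
    calc _ = (∫⁻ x, ‖v x‖ₑ ^ 2) ^ (1 / r) * (∫⁻ x, ‖v x‖ₑ ^ 2) ^ (1 - 1 / r - θ) *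
          torusEnergy v D ^ θ := by
          rw [← ENNReal.rpow_add_of_nonneg _ _ (by positivity) (by linarith)]
          ring_nf
      _ ≤ (∫⁻ x, ‖v x‖ₑ ^ 2) ^ (1 / r) * torusEnergy v D ^ (1 - 1 / r - θ) *
          torusEnergy v D ^ θ := by
          gcongr
      _ = _ := by
          rw [mul_assoc, ← ENNReal.rpow_add_of_nonneg _ _ (by linarith) h0]
          ring_nf
  rcases eq_or_ne q ⊤ with rfl | hq
  · refine ⟨1, fun v D hv _ d _ => ?_⟩
    rw [ENNReal.coe_one, one_mul]
    calc ∫⁻ x, ‖d x‖ₑ * ‖v x‖ₑ ^ 2 ≤ ∫⁻ x, eLpNorm d ⊤ volume * ‖v x‖ₑ ^ 2 := by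
          refine lintegral_mono_ae ?_
          filter_upwards [enorm_ae_le_eLpNormEssSup d volume] with x hx
          rw [eLpNorm_exponent_top]
          gcongr
      _ ≤ eLpNorm d ⊤ volume * ∫⁻ x, ‖v x‖ₑ ^ 2 := ?_
      _ ≤ _ := by
          gcongr
          simpa using mono v D 0 le_rfl (by linarith)
    rw [lintegral_const_mul _ (hv.continuous.enorm.measurable.pow_const 2)]
  · lift q to ℝ≥0 using hq
    have hq2 : (2 ≤ n ∧ (n : ℝ) / 2 < q) ∨ (n = 1 ∧ 1 ≤ (q : ℝ)) := by
      rcases hrq.2 with h | h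
      · refine Or.inl ⟨h.1, ?_⟩
        have := h.2.2
        rw [show (n : ℝ≥0∞) / 2 = ((n / 2 : ℝ≥0) : ℝ≥0∞) by push_cast; rfl] at this
        exact_mod_cast this
      · exact Or.inr ⟨h.1, by exact_mod_cast h.2.2.2⟩
    have hq0 : 0 < (q : ℝ) := by
      rcases hq2 with h | h
      · exact lt_of_le_of_lt (by positivity) h.2
      · linarith [h.2]
    have hθ : (n : ℝ) / (2 * q) ≤ 1 - 1 / r := by
      have h1 := hrq.1
      have h2 := ENNReal.toReal_mono ENNReal.one_ne_top h1
      have h3 : (n : ℝ≥0∞) / (2 * q) ≠ ⊤ := ne_top_of_le_ne_top ENNReal.one_ne_top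
        (le_self_add.trans h1)
      have h4 : 1 / ENNReal.ofReal r ≠ ⊤ := ne_top_of_le_ne_top ENNReal.one_ne_top
        (le_add_self.trans h1)
      rw [ENNReal.toReal_add h3 h4, ENNReal.toReal_div, ENNReal.toReal_div,
        ENNReal.toReal_ofReal hr0.le] at h2
      simp at h2
      simp
      linarith
    obtain ⟨K, hK⟩ := _root_.exists_lintegral_mul_sq_le hq2
    refine ⟨K, fun v D h h0 d hd => (hK v D h h0 _ hd.enorm).trans ?_⟩
    rw [eLpNorm_eq_lintegral_rpow_enorm_toReal (by simpa using fun h => hq0.ne' (by simp [h]))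
      ENNReal.coe_ne_top, ENNReal.coe_toReal]
    exact mul_le_mul' le_rfl (mul_le_mul' le_rfl (mono v D _ (by positivity) hθ))

theorem lintegral_average_translate {A : Type*} [MeasurableSpace A] [AddGroup A] [MeasurableAdd A]
    {μ : Measure A} [SFinite μ] [μ.IsAddRightInvariant] {B : Type*} [MeasurableSpace B] {ν : Measure B} 
    [IsProbabilityMeasure ν]
    {G : A → ℝ≥0∞} {c : B → A} (hG : Measurable fun z : A × B => G (z.1 + c z.2)) :
    ∫⁻ x, ∫⁻ τ, G (x + c τ) ∂ν ∂μ = ∫⁻ x, G x ∂μ := by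
  rw [lintegral_lintegral_swap hG.aemeasurable]
  simp_rw [lintegral_add_right_eq_self]
  simp

section Poincare

variable {v : UnitAddTorus (Fin n) → ℝ} {D : Fin n → UnitAddTorus (Fin n) → ℝ}

/-- A translation on the circle is represented by a shift of length at most one. Cauchy–Schwarz on
that segment leaves an average of translates of `|Dᵢ|²`, and all of these have the same integral. -/
theorem HasTorusGrad.eLpNorm_translate_single_sub_le (h : HasTorusGrad v D) (i : Fin n)
    (y : UnitAddCircle) : eLpNorm (fun x => v (x + Pi.single i y) - v x) 2 volume ≤
      eLpNorm (D i) 2 volume := by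
  obtain ⟨s, hs, rfl⟩ : ∃ s ∈ Icc (0 : ℝ) 1, (s : UnitAddCircle) = y := by
    have := AddCircle.coe_image_Ico_eq (1 : ℝ) 0
    obtain ⟨s, hs, h⟩ := this.ge (mem_univ y)
    exact ⟨s, by simpa using Ico_subset_Icc_self hs, h⟩
  have h3 : ∀ x, ‖v (x + Pi.single i (s : UnitAddCircle)) - v x‖ₑ ^ 2 ≤
      ∫⁻ τ in Ioc (0 : ℝ) 1, ‖D i (x + Pi.single i (τ : UnitAddCircle))‖ₑ ^ 2 := by
    intro x
    have h1 := h.enorm_sub_le x i hs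
    have hm : Measurable fun τ : ℝ => ‖D i (x + Pi.single i (τ : UnitAddCircle))‖ₑ :=
      ((h.continuous_grad i).comp (continuous_line x i)).enorm.measurable
    have h2 := lintegral_mul_sq_le (ν := volume.restrict (Ioc (0 : ℝ) 1)) (k := fun _ => 1)
      aemeasurable_const hm.aemeasurable
    simp only [one_mul, lintegral_one, Measure.restrict_apply_univ, Real.volume_Ioc, sub_zero,
      ENNReal.ofReal_one] at h2
    exact le_trans (by gcongr) h2
  have hc : Continuous fun z : UnitAddTorus (Fin n) × ℝ =>
      D i (z.1 + Pi.single i (z.2 : UnitAddCircle)) :=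
    (h.continuous_grad i).comp (continuous_fst.add ((continuous_single i).comp
      ((AddCircle.continuous_mk' 1).comp continuous_snd)))
  have : IsProbabilityMeasure (volume.restrict (Ioc (0 : ℝ) 1)) := ⟨by simp⟩
  rw [← ENNReal.pow_le_pow_left_iff two_ne_zero, eLpNorm_two_sq, eLpNorm_two_sq]
  exact (lintegral_mono h3).trans (lintegral_average_translate (μ := volume)
    (G := fun x => ‖D i x‖ₑ ^ 2) (c := fun τ : ℝ => Pi.single i (τ : UnitAddCircle))
    (hc.enorm.measurable.pow_const 2)).le

theorem HasTorusGrad.eLpNorm_translate_sub_le (h : HasTorusGrad v D) (y : UnitAddTorus (Fin n)) :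
    eLpNorm (fun x => v (x + y) - v x) 2 volume ≤ ∑ i, eLpNorm (D i) 2 volume := by
  suffices H : ∀ S : Finset (Fin n), eLpNorm (fun x => v (x + ∑ i ∈ S, Pi.single i (y i)) - v x) 2
      volume ≤ ∑ i ∈ S, eLpNorm (D i) 2 volume by
    have := H Finset.univ
    rwa [Finset.univ_sum_single] at this
  intro S
  induction S using Finset.induction_on with
  | empty => simp
  | insert i S hi ih =>
    rw [Finset.sum_insert hi, Finset.sum_insert hi]
    set w := ∑ i ∈ S, Pi.single i (y i)
    have e : (fun x => v (x + (Pi.single i (y i) + w)) - v x) =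
        ((fun x => v (x + Pi.single i (y i)) - v x) ∘ fun x => x + w) +
          fun x => v (x + w) - v x := by
      ext x
      simp only [Pi.add_apply, Function.comp_apply]
      rw [show x + (Pi.single i (y i) + w) = x + w + Pi.single i (y i) by abel]
      ring
    have hc : ∀ w, Continuous fun x => v (x + w) - v x := fun w =>
      (h.continuous.comp (continuous_add_const w)).sub h.continuous
    rw [e]
    refine (eLpNorm_add_le ((hc _).comp (continuous_add_const w)).aestronglyMeasurable
      (hc _).aestronglyMeasurable (by norm_num)).trans (add_le_add ?_ ih)
    rw [eLpNorm_comp_measurePreserving (hc _).aestronglyMeasurable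
      (measurePreserving_add_right volume w)]
    exact h.eLpNorm_translate_single_sub_le i _

theorem Continuous.integral_sq_eq (h : Continuous v) :
    ENNReal.ofReal (∫ x, v x * v x) = eLpNorm v 2 volume ^ 2 := by
  have hi : Integrable (fun x => v x * v x) volume :=
    ((h.mul h).comp continuous_snd).integrable_slice 0
  rw [ofReal_integral_eq_lintegral_ofReal hi (Eventually.of_forall fun x => mul_self_nonneg _),
    eLpNorm_two_sq]
  refine lintegral_congr fun x => ?_
  rw [← Real.enorm_of_nonneg (mul_self_nonneg _), enorm_mul, sq]

theorem Continuous.integrable_torus (h : Continuous v) : Integrable v volume :=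
  (h.comp continuous_snd).integrable_slice 0

/-- The Poincaré inequality on the torus. -/
theorem HasTorusGrad.variance_le (h : HasTorusGrad v D) :
    (∫ x, v x * v x) - (∫ x, v x) * ∫ x, v x ≤ n / 2 * ∑ i, ∫ x, D i x * D i x := by
  -- The average over `y` of these integrals is twice the variance, whence the `1/2` in the final
  -- constant; the factor `n` comes from squaring a sum of `n` norms.
  have h1 : ∀ y, ∫ x, (v (x + y) - v x) * (v (x + y) - v x) ≤ n * ∑ i, ∫ x, D i x * D i x := by
    intro y
    have hc : Continuous fun x => v (x + y) - v x :=
      (h.continuous.comp (continuous_add_const y)).sub h.continuous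
    have hp : 0 ≤ ∑ i, ∫ x, D i x * D i x :=
      Finset.sum_nonneg fun i _ => integral_nonneg fun x => mul_self_nonneg _
    rw [← ENNReal.ofReal_le_ofReal_iff (by positivity), hc.integral_sq_eq,
      ENNReal.ofReal_mul (by positivity), ENNReal.ofReal_sum_of_nonneg fun i _ =>
        integral_nonneg fun x => mul_self_nonneg _]
    simp_rw [fun i => (h.continuous_grad i).integral_sq_eq]
    refine (pow_le_pow_left' (h.eLpNorm_translate_sub_le y) 2).trans ?_
    have := ENNReal.rpow_sum_le_const_mul_sum_rpow Finset.univ (fun i => eLpNorm (D i) 2 volume)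
      (p := 2) (by norm_num)
    norm_num at this
    simpa using this
  have h2 : ∀ y, ∫ x, (v (x + y) - v x) * (v (x + y) - v x) =
      2 * (∫ x, v x * v x) - 2 * ∫ x, v x * v (x + y) := by
    intro y
    have c1 := h.continuous
    have c2 : Continuous fun x => v (x + y) := c1.comp (continuous_add_const y)
    have e : ∀ x, (v (x + y) - v x) * (v (x + y) - v x) =
        v (x + y) * v (x + y) + v x * v x - 2 * (v x * v (x + y)) := fun x => by ring
    simp only [e]
    have i1 : Integrable (fun x => v (x + y) * v (x + y)) volume := (c2.mul c2).integrable_torus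
    have i2 : Integrable (fun x => v x * v x) volume := (c1.mul c1).integrable_torus
    have i3 : Integrable (fun x => v x * v (x + y)) volume := (c1.mul c2).integrable_torus
    have i4 : Integrable (fun x => v (x + y) * v (x + y) + v x * v x) volume := i1.add i2
    rw [integral_sub i4 (i3.const_mul 2), integral_add i1 i2, integral_const_mul,
      integral_add_right_eq_self (fun x => v x * v x) y]
    ring
  have hc : Continuous fun z : UnitAddTorus (Fin n) × UnitAddTorus (Fin n) => v z.2 * v (z.2 + z.1) :=
    (h.continuous.comp continuous_snd).mul
      (h.continuous.comp (continuous_snd.add continuous_fst))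
  have hi : Integrable (Function.uncurry fun y x => v x * v (x + y))
      ((volume : Measure (UnitAddTorus (Fin n))).prod (volume : Measure (UnitAddTorus (Fin n)))) := by
    obtain ⟨C, hC⟩ := isCompact_univ.exists_bound_of_continuousOn hc.continuousOn
    exact Integrable.of_bound hc.aestronglyMeasurable C (Eventually.of_forall fun z => hC z (mem_univ z))
  have h3 : ∫ y, ∫ x, v x * v (x + y) = (∫ x, v x) * ∫ x, v x := by
    rw [integral_integral_swap hi]
    simp_rw [integral_const_mul]
    simp_rw [fun x => integral_add_left_eq_self (μ := volume) v x]
    rw [integral_mul_const]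
  have hi2 : Integrable (fun y => 2 * ∫ x, v x * v (x + y)) volume :=
    hi.integral_prod_left.const_mul 2
  have h4 := integral_mono (μ := volume) (f := fun y => 2 * (∫ x, v x * v x) - 2 * ∫ x, v x * v (x + y))
    (g := fun _ => n * ∑ i, ∫ x, D i x * D i x)
    ((integrable_const _).sub (hi.integral_prod_left.const_mul 2)) (integrable_const _)
    (fun y => (h2 y).symm.trans_le (h1 y))
  rw [integral_sub (integrable_const _) hi2,
    integral_const_mul 2 fun y => ∫ x, v x * v (x + y), h3] at h4
  simp at h4
  linarith

end Poincare

end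

/-! ### Passage from `C¹` functions to `H¹` limits -/

section

theorem MemLp.ofReal_integral_mul_self {α : Type*} [MeasurableSpace α] {μ : Measure α} {w : α → ℝ}
    (hw : MemLp w 2 μ) : ENNReal.ofReal (∫ x, w x * w x ∂μ) = ∫⁻ x, ‖w x‖ₑ ^ 2 ∂μ := by
  rw [ofReal_integral_eq_lintegral_ofReal (hw.integrable_fun_mul hw)
    (Eventually.of_forall fun x => mul_self_nonneg _)]
  refine lintegral_congr fun x => ?_
  rw [← Real.enorm_of_nonneg (mul_self_nonneg _), enorm_mul, sq]

theorem L2Conv.tendsto_lintegral_sq {α : Type*} [MeasurableSpace α] {μ : Measure α}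
    {u : ℕ → α → ℝ} {u₀ : α → ℝ} (h : L2Conv μ u u₀) :
    Tendsto (fun j => ∫⁻ x, ‖u j x‖ₑ ^ 2 ∂μ) atTop (𝓝 (∫⁻ x, ‖u₀ x‖ₑ ^ 2 ∂μ)) := by
  rw [← MemLp.ofReal_integral_mul_self h.memLp_lim]
  simp_rw [← fun j => MemLp.ofReal_integral_mul_self (h.memLp j)]
  exact (ENNReal.continuous_ofReal.tendsto _).comp (h.tendsto_integral_mul h)

variable {n : ℕ}

/-- A sequence of `C¹` functions which converges in `H¹` of the torus and almost everywhere. -/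
structure H1Approx (v' : ℕ → UnitAddTorus (Fin n) → ℝ) (D' : ℕ → Fin n → UnitAddTorus (Fin n) → ℝ)
    (v : UnitAddTorus (Fin n) → ℝ) (D : Fin n → UnitAddTorus (Fin n) → ℝ) : Prop where
  grad : ∀ j, HasTorusGrad (v' j) (D' j)
  conv : L2Conv volume v' v
  conv_grad : ∀ i, L2Conv volume (fun j => D' j i) (D i)
  ae : ∀ᵐ x, Tendsto (fun j => v' j x) atTop (𝓝 (v x))

variable {v' : ℕ → UnitAddTorus (Fin n) → ℝ} {D' : ℕ → Fin n → UnitAddTorus (Fin n) → ℝ}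
  {v : UnitAddTorus (Fin n) → ℝ} {D : Fin n → UnitAddTorus (Fin n) → ℝ}

theorem HasTorusGrad.comp (h : HasTorusGrad v D) {w w' : ℝ → ℝ} (hw : ∀ s, HasDerivAt w (w' s) s)
    (hw' : Continuous w') : HasTorusGrad (fun x => w (v x)) fun i x => w' (v x) * D i x :=
  ⟨(continuous_iff_continuousAt.2 fun s => (hw s).continuousAt).comp h.continuous,
    fun i => (hw'.comp h.continuous).mul (h.continuous_grad i),
    fun x i s => (hw _).comp s (h.hasDerivAt x i s)⟩

theorem lipschitzWith_of_hasDerivAt {w w' : ℝ → ℝ} (hw : ∀ s, HasDerivAt w (w' s) s) {L : ℝ≥0}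
    (hL : ∀ s, |w' s| ≤ L) : LipschitzWith L w :=
  lipschitzWith_of_nnnorm_deriv_le (fun s => (hw s).differentiableAt) fun s => by
    rw [(hw s).deriv, ← NNReal.coe_le_coe]
    exact hL s

theorem H1Approx.comp (h : H1Approx v' D' v D) {w w' : ℝ → ℝ} (hw : ∀ s, HasDerivAt w (w' s) s)
    (hw' : Continuous w') {L : ℝ≥0} (hL : ∀ s, |w' s| ≤ L) :
    H1Approx (fun j x => w (v' j x)) (fun j i x => w' (v' j x) * D' j i x) (fun x => w (v x))
      fun i x => w' (v x) * D i x where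
  grad j := (h.grad j).comp hw hw'
  conv := h.conv.comp_lipschitz (lipschitzWith_of_hasDerivAt hw hL)
  conv_grad i := (h.conv_grad i).bounded_mul (C := L)
    (fun j => (hw'.comp (h.grad j).continuous).aestronglyMeasurable) (fun _ _ => hL _)
    (h.ae.mono fun _ hx => (hw'.tendsto _).comp hx)
  ae := h.ae.mono fun _ hx => ((hw _).continuousAt.tendsto).comp hx

theorem H1Approx.tendsto_torusEnergy (h : H1Approx v' D' v D) :
    Tendsto (fun j => torusEnergy (v' j) (D' j)) atTop (𝓝 (torusEnergy v D)) :=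
  h.conv.tendsto_lintegral_sq.add
    (tendsto_finsetSum _ fun i _ => (h.conv_grad i).tendsto_lintegral_sq)

/-- The left side is lower semicontinuous by Fatou along the almost everywhere convergent sequence,
and the right side converges. Finiteness of the norm of `d` excludes an indeterminate product in
that limit. -/
theorem AdmissibleExponents.exists_formBound {r : ℝ} {q : ℝ≥0∞}
    (hrq : AdmissibleExponents n r q) {η : ℝ≥0} (hη : η ≠ 0) :
    ∃ K : ℝ≥0, ∀ (v' : ℕ → UnitAddTorus (Fin n) → ℝ) D' v D, H1Approx v' D' v D →
    (∀ j x, 0 ≤ v' j x) → ∀ d : UnitAddTorus (Fin n) → ℝ, AEStronglyMeasurable d volume →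
    eLpNorm d q volume ≠ ⊤ →
    ∫⁻ x, ‖d x‖ₑ * ‖v x‖ₑ ^ 2 ≤ K * (eLpNorm d q volume ^ r * ∫⁻ x, ‖v x‖ₑ ^ 2) +
      η * torusEnergy v D := by
  obtain ⟨K, hK⟩ := hrq.exists_lintegral_mul_sq_le hη
  refine ⟨K, fun v' D' v D h h0 d hd hdq => ?_⟩
  have hN : eLpNorm d q volume ^ r ≠ ⊤ :=
    ENNReal.rpow_ne_top_of_nonneg (by linarith [hrq.one_le]) hdq
  have h1 : ∫⁻ x, ‖d x‖ₑ * ‖v x‖ₑ ^ 2 ≤ liminf (fun j => ∫⁻ x, ‖d x‖ₑ * ‖v' j x‖ₑ ^ 2) atTop := by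
    refine le_trans (lintegral_mono_ae ?_) (lintegral_liminf_le' fun j =>
      hd.enorm.mul ((h.grad j).continuous.enorm.measurable.pow_const 2).aemeasurable)
    filter_upwards [h.ae] with x hx
    have h2 : Tendsto (fun j => ‖d x‖ₑ * ‖v' j x‖ₑ ^ 2) atTop (𝓝 (‖d x‖ₑ * ‖v x‖ₑ ^ 2)) :=
      ENNReal.Tendsto.const_mul
        (((ENNReal.continuous_pow 2).tendsto _).comp ((continuous_enorm.tendsto _).comp hx))
        (Or.inr enorm_ne_top)
    exact h2.liminf_eq.ge
  have h3 : Tendsto (fun j => K * (eLpNorm d q volume ^ r * ∫⁻ x, ‖v' j x‖ₑ ^ 2) +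
      η * torusEnergy (v' j) (D' j)) atTop (𝓝 (K * (eLpNorm d q volume ^ r * ∫⁻ x, ‖v x‖ₑ ^ 2) +
      η * torusEnergy v D)) :=
    (ENNReal.Tendsto.const_mul (ENNReal.Tendsto.const_mul h.conv.tendsto_lintegral_sq (Or.inr hN))
      (Or.inr ENNReal.coe_ne_top)).add
      (ENNReal.Tendsto.const_mul h.tendsto_torusEnergy (Or.inr ENNReal.coe_ne_top))
  rw [← h3.liminf_eq]
  exact h1.trans (liminf_le_liminf (Eventually.of_forall fun j => hK _ _ (h.grad j) (h0 j) d hd))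

theorem H1Approx.variance_le (h : H1Approx v' D' v D) :
    (∫ x, v x * v x) - (∫ x, v x) * ∫ x, v x ≤ n / 2 * ∑ i, ∫ x, D i x * D i x :=
  le_of_tendsto_of_tendsto' ((h.conv.tendsto_integral_mul h.conv).sub
    (h.conv.tendsto_integral.mul h.conv.tendsto_integral))
    ((tendsto_finsetSum _ fun i _ => (h.conv_grad i).tendsto_integral_mul (h.conv_grad i)).const_mul
      ((n : ℝ) / 2)) fun j => (h.grad j).variance_le

/-- A Poincaré inequality for functions which are controlled on half of the torus. -/
theorem H1Approx.integral_sq_le (h : H1Approx v' D' v D) {E : Set (UnitAddTorus (Fin n))}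
    (hE : NullMeasurableSet E volume) (hE2 : 1 / 2 ≤ volume.real E) {c : ℝ}
    (hc : ∀ x ∈ E, v x * v x ≤ c) :
    ∫ x, v x * v x ≤ 5 * n / 2 * (∑ i, ∫ x, D i x * D i x) + 2 * c := by
  set m := ∫ x, v x
  have hv := h.conv.memLp_lim
  have h1 := h.variance_le
  have hi : Integrable (fun x => v x * v x) volume := hv.integrable_fun_mul hv
  have hi1 : Integrable v volume := hv.integrable (by norm_num)
  have hdev : ∫ x, (v x - m) * (v x - m) = (∫ x, v x * v x) - m * m := by
    have e : ∀ x, (v x - m) * (v x - m) = v x * v x - 2 * m * v x + m * m := fun x => by ring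
    simp only [e]
    have i1 : Integrable (fun x => v x * v x - 2 * m * v x) volume := hi.sub (hi1.const_mul _)
    rw [integral_add i1 (integrable_const _), integral_sub hi (hi1.const_mul _), integral_const_mul]
    simp only [integral_const, probReal_univ, smul_eq_mul, one_mul]
    change _ - 2 * m * m + _ = _
    ring
  have hvm : MemLp (fun x => v x - m) 2 volume := hv.sub (memLp_const m)
  have hi2 : Integrable (fun x => (v x - m) * (v x - m)) volume := hvm.integrable_fun_mul hvm
  -- Pointwise on `E`, `m² ≤ 2(v - m)² + 2v²`: the mean is small up to the variance because `v` is
  -- small there.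
  have h2 : ∫ x in E, m * m ≤ ∫ x in E, (2 * ((v x - m) * (v x - m)) + 2 * c) := by
    refine setIntegral_mono_on₀ (integrable_const _).integrableOn
      ((hi2.const_mul 2).add (integrable_const _)).integrableOn hE fun x hx => ?_
    nlinarith [hc x hx, sq_nonneg (v x - m + v x), sq_nonneg (2 * v x - m)]
  have hE1 : volume.real E ≤ 1 := measureReal_le_one
  have h3 : ∫ x in E, (2 * ((v x - m) * (v x - m)) + 2 * c) ≤
      2 * (∫ x, (v x - m) * (v x - m)) + volume.real E * (2 * c) := by
    have i2 : Integrable (fun x => 2 * ((v x - m) * (v x - m))) volume := hi2.const_mul 2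
    rw [integral_add i2.integrableOn (integrable_const _).integrableOn, setIntegral_const,
      smul_eq_mul, ← integral_const_mul]
    gcongr
    · exact Eventually.of_forall fun x => mul_nonneg zero_le_two (mul_self_nonneg _)
    · exact Measure.restrict_le_self
  rw [setIntegral_const, smul_eq_mul] at h2
  have h4 : 0 ≤ ∫ x, (v x - m) * (v x - m) := integral_nonneg fun x => mul_self_nonneg (v x - m)
  have h5 := h2.trans h3
  -- Dividing by the measure of `E`, at least `1/2`, doubles the variance term to `4`. Adding the
  -- variance itself produces the factor `5`.
  have h6 : m * m ≤ 4 * (∫ x, (v x - m) * (v x - m)) + 2 * c := by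
    have h7 : volume.real E * (m * m) ≤
        volume.real E * (4 * (∫ x, (v x - m) * (v x - m)) + 2 * c) := by nlinarith
    exact le_of_mul_le_mul_left h7 (by linarith)
  rw [hdev] at h6
  linarith

end

/-! ### Time slices and integrability against the divergence -/

section

variable {n : ℕ} {T : ℝ}

/-- For `q = ∞` a sublevel set of the essential supremum consists of the times at which the slice of
`{c < |d|}` is a null set, and the measure of a slice depends measurably on time. -/
theorem Measurable.measurable_eLpNorm_slice {d : ℝ × UnitAddTorus (Fin n) → ℝ} (hd : Measurable d)
    (q : ℝ≥0∞) : Measurable fun t => eLpNorm (fun x => d (t, x)) q volume := by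
  rcases eq_or_ne q 0 with rfl | h0
  · simp
  rcases eq_or_ne q ⊤ with rfl | hq
  · refine measurable_of_Iic fun c => ?_
    have e : (fun t => eLpNorm (fun x => d (t, x)) ⊤ volume) ⁻¹' Iic c =
        (fun t => volume (Prod.mk t ⁻¹' {z : ℝ × UnitAddTorus (Fin n) | c < ‖d z‖ₑ})) ⁻¹' {0} := by
      ext t
      simp only [mem_preimage, mem_Iic, mem_singleton_iff, eLpNorm_exponent_top]
      constructor
      · intro h
        refine measure_mono_null (fun x hx => ?_)
          (ae_iff.1 (enorm_ae_le_eLpNormEssSup (fun x => d (t, x)) volume))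
        simp only [mem_ofPred_eq, not_le]
        exact h.trans_lt hx
      · intro h
        refine essSup_le_of_ae_le _ (ae_iff.2 ?_)
        simp only [not_le]
        exact h
    rw [e]
    exact measurable_measure_prodMk_left (measurableSet_lt measurable_const hd.enorm)
      (measurableSet_singleton 0)
  · simp_rw [eLpNorm_eq_lintegral_rpow_enorm_toReal h0 hq]
    exact (hd.enorm.pow_const _).lintegral_prod_right'.pow_const _

theorem aemeasurable_eLpNorm_slice {d : ℝ × UnitAddTorus (Fin n) → ℝ}
    (hd : AEStronglyMeasurable d (parabolicCylinder n T)) (q : ℝ≥0∞) :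
    AEMeasurable (fun t => eLpNorm (fun x => d (t, x)) q volume) (volume.restrict (Ioo 0 T)) := by
  refine ⟨_, hd.stronglyMeasurable_mk.measurable.measurable_eLpNorm_slice q, ?_⟩
  filter_upwards [Measure.ae_ae_of_ae_prod hd.ae_eq_mk] with t ht
  exact eLpNorm_congr_ae ht

theorem lintegral_rpow_le_of_mixedNorm_le {d : ℝ × UnitAddTorus (Fin n) → ℝ} {r : ℝ} {q : ℝ≥0∞}
    {M : ℝ≥0} (hr : 1 ≤ r) (h : mixedNorm T r q d ≤ M) :
    ∫⁻ t in Ioo 0 T, eLpNorm (fun x => d (t, x)) q volume ^ r ≤ (M : ℝ≥0∞) ^ r := by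
  have hr0 : 0 < r := by linarith
  have h1 := ENNReal.rpow_le_rpow h hr0.le
  rwa [mixedNorm, ← ENNReal.rpow_mul, one_div, inv_mul_cancel₀ hr0.ne', ENNReal.rpow_one] at h1

variable {ρ₀ : UnitAddTorus (Fin n) → ℝ} {ρ f : ℝ × UnitAddTorus (Fin n) → ℝ}
  {G F : ℝ × UnitAddTorus (Fin n) → EuclideanSpace ℝ (Fin n)}
  {u f' : ℕ → ℝ × UnitAddTorus (Fin n) → ℝ} {F' : ℕ → Fin n → ℝ × UnitAddTorus (Fin n) → ℝ}

theorem IsSmooth.hasTorusGrad_slice {φ : ℝ × UnitAddTorus (Fin n) → ℝ} (h : IsSmooth φ) (t : ℝ) :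
    HasTorusGrad (fun x => φ (t, x)) fun i x => spaceGrad φ (t, x) i where
  continuous := h.continuous.comp (by fun_prop)
  continuous_grad i := (h.smooth_spaceGrad i).continuous.comp (by fun_prop)
  hasDerivAt x i s := by
    have h1 := h.hasDerivAt (t, x) (0, Pi.single i 1) s
    have e : ∀ s : ℝ, (t, x) + cylCover n (s • ((0 : ℝ), (Pi.single i 1 : Fin n → ℝ))) =
        (t, x + Pi.single i (s : UnitAddCircle)) := by
      intro s
      refine Prod.ext (by simp) (funext fun k => ?_)
      by_cases hk : k = i
      · subst hk; simp
      · simp [hk]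
    simp only [e] at h1
    rwa [spaceGrad_eq]

theorem IsApproxSeq.ae_h1Approx (ha : IsApproxSeq T ρ₀ ρ G f F u f' F') :
    ∀ᵐ t ∂(volume.restrict (Ioo 0 T)), H1Approx (fun j x => u j (t, x))
      (fun j i x => spaceGrad (u j) (t, x) i) (fun x => ρ (t, x)) fun i x => G (t, x) i := by
  filter_upwards [ha.slice, ha.slice_grad, Measure.ae_ae_of_ae_prod ha.ae] with t h1 h2 h3
  exact ⟨fun j => (ha.smooth j).hasTorusGrad_slice t, h1, h2, h3⟩

/-- Boundedness in `L²`, uniformly in time. -/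
theorem IsApproxSeq.exists_ae_lintegral_sq_le (ha : IsApproxSeq T ρ₀ ρ G f F u f' F') :
    ∃ N : ℝ≥0∞, N ≠ ⊤ ∧ ∀ᵐ t ∂(volume.restrict (Ioo 0 T)), ∫⁻ x, ‖ρ (t, x)‖ₑ ^ 2 ≤ N := by
  have hb : ∀ s : ℝ, HasDerivAt (fun s : ℝ => s ^ 2 / 2) s s := fun s => by
    have := (hasDerivAt_pow 2 s).div_const 2
    simpa using this
  -- With `β = s²/2` the chain rule bounds the `L²` norm in terms of `f` and `F` alone, so the drift
  -- plays no role yet.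
  have h1 := ha.ae_integral_comp_sub contDiff_id (L := 1) (by simp) hb
  set E : ℝ × UnitAddTorus (Fin n) → ℝ := fun z => |ρ z * f z| + |inner ℝ (F z) (G z)| with hE
  have hFG : Integrable (fun z => inner ℝ (F z) (G z)) (parabolicCylinder n T) := by
    simp only [PiLp.inner_apply, RCLike.inner_apply, conj_trivial]
    exact integrable_finsetSum _ fun i _ =>
      (ha.grad i).memLp_lim.integrable_fun_mul (ha.flux i).memLp_lim
  have hρf : Integrable (fun z => ρ z * f z) (parabolicCylinder n T) :=
    ha.conv.memLp_lim.integrable_fun_mul ha.source.memLp_lim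
  have hEi : Integrable E (parabolicCylinder n T) := hρf.abs.add hFG.abs
  refine ⟨ENNReal.ofReal ((∫ x, ρ₀ x ^ 2) + 2 * ∫ z, E z ∂(parabolicCylinder n T)),
    ENNReal.ofReal_ne_top, ?_⟩
  filter_upwards [h1, ae_restrict_mem measurableSet_Ioo] with t ⟨hi, ht⟩ htT
  have hle := parabolicCylinder_mono (n := n) htT.2.le
  have hi2 : Integrable (fun x => ρ (t, x) ^ 2) volume := by
    have := hi.mul_const 2
    simpa using this
  have e1 : ∀ x, ‖ρ (t, x)‖ₑ ^ 2 = ENNReal.ofReal (ρ (t, x) ^ 2) := fun x => by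
    rw [← Real.enorm_of_nonneg (sq_nonneg _), sq, sq, enorm_mul]
  simp only [e1]
  rw [← ofReal_integral_eq_lintegral_ofReal hi2 (Eventually.of_forall fun x => sq_nonneg _)]
  refine ENNReal.ofReal_le_ofReal ?_
  have h2 : ∫ z, (id (ρ z) * f z - deriv id (ρ z) * inner ℝ (F z) (G z)) ∂(parabolicCylinder n t) ≤
      ∫ z, E z ∂(parabolicCylinder n T) := by
    refine (Real.le_norm_self _).trans ((norm_integral_le_of_norm_le (hEi.mono_measure hle)
      (Eventually.of_forall fun z => ?_)).trans (integral_mono_measure hle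
      (Eventually.of_forall fun z => add_nonneg (abs_nonneg _) (abs_nonneg _)) hEi))
    simp only [id, deriv_id, one_mul, hE, Real.norm_eq_abs]
    exact abs_sub _ _
  rw [integral_div, integral_div] at ht
  linarith

theorem hasDerivAt_sqrt_one_add_sq (s : ℝ) :
    HasDerivAt (fun s : ℝ => √(1 + s ^ 2)) (s / √(1 + s ^ 2)) s := by
  have h := (((hasDerivAt_pow 2 s).const_add 1).sqrt (by positivity))
  convert h using 1
  field_simp
  push_cast
  ring

theorem abs_div_sqrt_one_add_sq_le (s : ℝ) : |s / √(1 + s ^ 2)| ≤ 1 := by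
  rw [abs_div, abs_of_nonneg (Real.sqrt_nonneg _), div_le_one (by positivity)]
  exact Real.abs_le_sqrt (by linarith)

/-- The form bound is applied on each slice to `√(1 + ρ²)`, whose gradient is dominated by that of
`ρ`. Since `∫ ρ²` is bounded uniformly in time, the slice bound is integrable in `t`. The summand
`1` yields integrability of `d` itself as well. -/
theorem IsApproxSeq.integrable_mul_sq (ha : IsApproxSeq T ρ₀ ρ G f F u f' F') {r : ℝ} {q : ℝ≥0∞}
    {M : ℝ≥0} (hrq : AdmissibleExponents n r q) {d : ℝ × UnitAddTorus (Fin n) → ℝ}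
    (hd : AEStronglyMeasurable d (parabolicCylinder n T)) (hM : mixedNorm T r q d ≤ M) :
    Integrable (fun z => d z * (1 + ρ z ^ 2)) (parabolicCylinder n T) := by
  have hr := hrq.one_le
  have hρ := ha.conv.memLp_lim
  have hm : AEStronglyMeasurable (fun z => d z * (1 + ρ z ^ 2)) (parabolicCylinder n T) :=
    hd.mul (aestronglyMeasurable_const.add (hρ.1.pow 2))
  obtain ⟨N, hN, hNt⟩ := ha.exists_ae_lintegral_sq_le
  obtain ⟨K, hK⟩ := hrq.exists_formBound one_ne_zero
  have hα := lintegral_rpow_le_of_mixedNorm_le hr hM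
  have hαm := (aemeasurable_eLpNorm_slice hd q).pow_const r
  have hMr : (M : ℝ≥0∞) ^ r ≠ ⊤ := ENNReal.rpow_ne_top_of_nonneg (by linarith) ENNReal.coe_ne_top
  have hw : ∀ s : ℝ, ‖√(1 + s ^ 2)‖ₑ ^ 2 = ENNReal.ofReal (1 + s ^ 2) := fun s => by
    rw [Real.enorm_of_nonneg (Real.sqrt_nonneg _), ← ENNReal.ofReal_pow (Real.sqrt_nonneg _),
      Real.sq_sqrt (by positivity)]
  refine ⟨hm, ?_⟩
  rw [hasFiniteIntegral_iff_enorm]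
  have e1 : ∀ z, ‖d z * (1 + ρ z ^ 2)‖ₑ = ‖d z‖ₑ * ‖√(1 + ρ z ^ 2)‖ₑ ^ 2 := fun z => by
    rw [hw, enorm_mul, Real.enorm_of_nonneg (by positivity : 0 ≤ 1 + ρ z ^ 2)]
  have hm2 : AEMeasurable (fun z => ‖d z * (1 + ρ z ^ 2)‖ₑ) ((volume.restrict (Ioo 0 T)).prod
      (volume : Measure (UnitAddTorus (Fin n)))) := hm.enorm
  rw [parabolicCylinder, lintegral_prod _ hm2]
  simp only [e1]
  have hGm : ∀ i, AEMeasurable (fun z => ‖G z i‖ₑ ^ 2) ((volume.restrict (Ioo 0 T)).prod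
      (volume : Measure (UnitAddTorus (Fin n)))) := fun i =>
    ((ha.grad i).memLp_lim.1.enorm).pow_const 2
  have h1 : ∀ᵐ t ∂(volume.restrict (Ioo 0 T)), ∫⁻ x, ‖d (t, x)‖ₑ * ‖√(1 + ρ (t, x) ^ 2)‖ₑ ^ 2 ≤
      K * (eLpNorm (fun x => d (t, x)) q volume ^ r * (1 + N)) +
        ((1 + N) + ∑ i, ∫⁻ x, ‖G (t, x) i‖ₑ ^ 2) := by
    have hd' : AEStronglyMeasurable d ((volume.restrict (Ioo 0 T)).prod volume) := hd
    filter_upwards [ha.ae_h1Approx, hNt, hd'.prodMk_left, ae_lt_top' hαm (hα.trans_lt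
      (lt_top_iff_ne_top.2 hMr)).ne] with t ht hNt hdt hαt
    have h2 := ht.comp hasDerivAt_sqrt_one_add_sq (continuous_id.div (by fun_prop) fun s => by
      have : 0 < √(1 + s ^ 2) := by positivity
      exact this.ne') (L := 1) (by simpa using abs_div_sqrt_one_add_sq_le)
    have h3 := hK _ _ _ _ h2 (fun _ _ => Real.sqrt_nonneg _) (fun x => d (t, x)) hdt fun h => by
      simp [h, ENNReal.top_rpow_of_pos (show 0 < r by linarith)] at hαt
    have h4 : ∫⁻ x, ‖√(1 + ρ (t, x) ^ 2)‖ₑ ^ 2 ≤ 1 + N := by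
      have : ∀ x, ‖√(1 + ρ (t, x) ^ 2)‖ₑ ^ 2 = 1 + ‖ρ (t, x)‖ₑ ^ 2 := fun x => by
        rw [hw, ENNReal.ofReal_add zero_le_one (sq_nonneg _), ENNReal.ofReal_one,
          ← Real.enorm_of_nonneg (sq_nonneg _), sq, sq, enorm_mul]
      simp only [this]
      rw [lintegral_add_left measurable_const]
      simpa using hNt
    refine h3.trans ?_
    rw [ENNReal.coe_one, one_mul, torusEnergy]
    gcongr with i _ x
    rw [enorm_mul]
    refine mul_le_of_le_one_left zero_le ?_
    rw [← ofReal_norm, ENNReal.ofReal_le_one]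
    exact abs_div_sqrt_one_add_sq_le _
  refine (lintegral_mono_ae h1).trans_lt ?_
  have hm3 : AEMeasurable (fun t => K * (eLpNorm (fun x => d (t, x)) q volume ^ r * (1 + N)))
      (volume.restrict (Ioo 0 T)) := (hαm.mul_const _).const_mul _
  have h1N : 1 + N ≠ ⊤ := by finiteness
  rw [lintegral_add_left' hm3, lintegral_const_mul' _ _ ENNReal.coe_ne_top,
    lintegral_mul_const' _ _ h1N, lintegral_add_left measurable_const,
    lintegral_finsetSum' _ fun i _ => (hGm i).lintegral_prod_right']
  refine (ENNReal.add_ne_top.2 ⟨?_, ENNReal.add_ne_top.2 ⟨?_, ENNReal.sum_ne_top.2 fun i _ => ?_⟩⟩).lt_top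
  · exact ENNReal.mul_ne_top ENNReal.coe_ne_top (ENNReal.mul_ne_top
      (ne_top_of_le_ne_top hMr hα) h1N)
  · rw [lintegral_const]
    exact ENNReal.mul_ne_top h1N (measure_ne_top _ _)
  · rw [← lintegral_prod _ (hGm i)]
    have := eLpNorm_two_sq (ν := parabolicCylinder n T) fun z => G z i
    rw [parabolicCylinder] at this
    rw [← this]
    exact ENNReal.pow_ne_top (ha.grad i).memLp_lim.2.ne

end

/-! ### The product rule for the divergence -/

section

theorem tendsto_integral_bounded_mul {α : Type*} [MeasurableSpace α] {μ : Measure α}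
    {ζ : ℕ → α → ℝ} {ζ₀ h : α → ℝ} {C : ℝ} (hh : Integrable h μ)
    (hm : ∀ j, AEStronglyMeasurable (ζ j) μ) (hC : ∀ j z, |ζ j z| ≤ C)
    (hζ : ∀ᵐ z ∂μ, Tendsto (fun j => ζ j z) atTop (𝓝 (ζ₀ z))) :
    Tendsto (fun j => ∫ z, ζ j z * h z ∂μ) atTop (𝓝 (∫ z, ζ₀ z * h z ∂μ)) := by
  refine tendsto_integral_of_dominated_convergence (fun z => C * ‖h z‖)
    (fun j => (hm j).mul hh.1) (hh.norm.const_mul C) (fun j => Eventually.of_forall fun z => ?_)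
    (hζ.mono fun z hz => hz.mul_const _)
  rw [norm_mul]
  exact mul_le_mul_of_nonneg_right (hC j z) (norm_nonneg _)

section SmoothTruncation

/-- The smooth bounded approximation `m sin (x / m)` of the identity, with `m = j + 1`. -/
noncomputable def sinTrunc (j : ℕ) (x : ℝ) : ℝ := ((j : ℝ) + 1) * Real.sin (x / ((j : ℝ) + 1))

theorem hasDerivAt_sinTrunc (j : ℕ) (x : ℝ) :
    HasDerivAt (sinTrunc j) (Real.cos (x / ((j : ℝ) + 1))) x := by
  have h := (((hasDerivAt_id x).div_const ((j : ℝ) + 1)).sin).const_mul ((j : ℝ) + 1)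
  have hj : (j : ℝ) + 1 ≠ 0 := by positivity
  refine h.congr_deriv ?_
  change ((j : ℝ) + 1) * (Real.cos (x / ((j : ℝ) + 1)) * (1 / ((j : ℝ) + 1))) = _
  field_simp

theorem contDiff_sinTrunc (j : ℕ) : ContDiff ℝ ∞ (sinTrunc j) :=
  contDiff_const.mul (Real.contDiff_sin.comp (contDiff_id.div_const _))

theorem abs_sinTrunc_le (j : ℕ) (x : ℝ) : |sinTrunc j x| ≤ (j : ℝ) + 1 := by
  have hj : (0 : ℝ) ≤ (j : ℝ) + 1 := by positivity
  rw [sinTrunc, abs_mul, abs_of_nonneg hj]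
  exact mul_le_of_le_one_right hj (Real.abs_sin_le_one _)

theorem tendsto_div_nat_succ (x : ℝ) : Tendsto (fun j : ℕ => x / ((j : ℝ) + 1)) atTop (𝓝 0) :=
  tendsto_const_nhds.div_atTop (tendsto_atTop_add_const_right _ _ tendsto_natCast_atTop_atTop)

theorem sinTrunc_eq (j : ℕ) (x : ℝ) : sinTrunc j x = Real.sinc (x / ((j : ℝ) + 1)) * x := by
  have hj : (j : ℝ) + 1 ≠ 0 := by positivity
  rcases eq_or_ne x 0 with rfl | hx
  · simp [sinTrunc]
  · rw [Real.sinc_of_ne_zero (div_ne_zero hx hj), sinTrunc]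
    field_simp

theorem abs_sinTrunc_le_abs (j : ℕ) (x : ℝ) : |sinTrunc j x| ≤ |x| := by
  rw [sinTrunc_eq, abs_mul]
  exact mul_le_of_le_one_left (abs_nonneg _) (Real.abs_sinc_le_one _)

theorem tendsto_sinc_div (x : ℝ) :
    Tendsto (fun j : ℕ => Real.sinc (x / ((j : ℝ) + 1))) atTop (𝓝 1) := by
  have := (Real.continuous_sinc.tendsto 0).comp (tendsto_div_nat_succ x)
  rwa [Real.sinc_zero] at this

theorem tendsto_sinTrunc (x : ℝ) : Tendsto (fun j => sinTrunc j x) atTop (𝓝 x) := by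
  simp_rw [sinTrunc_eq]
  simpa using (tendsto_sinc_div x).mul_const x

theorem tendsto_cos_div (x : ℝ) :
    Tendsto (fun j : ℕ => Real.cos (x / ((j : ℝ) + 1))) atTop (𝓝 1) := by
  have := (Real.continuous_cos.tendsto 0).comp (tendsto_div_nat_succ x)
  rwa [Real.cos_zero] at this

end SmoothTruncation

variable {n : ℕ} {T : ℝ}

theorem IsInteriorTest.exists_bound {φ : ℝ × UnitAddTorus (Fin n) → ℝ} (hφ : IsInteriorTest T φ) :
    ∃ C, 0 ≤ C ∧ ∀ z, |φ z| ≤ C := by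
  obtain ⟨hs, t₀, t₁, -, -, h⟩ := hφ
  obtain ⟨C, hC0, hC⟩ := hs.continuous.exists_bound_cyl t₀ t₁
  refine ⟨C, hC0, fun z => ?_⟩
  by_cases hz : z.1 ∈ Icc t₀ t₁
  · exact hC z hz
  · have : φ z = 0 := h z.1 z.2 (by
      by_contra hh
      push Not at hh
      exact hz hh)
    simpa [this] using hC0

/-- A weak solution of the drift–diffusion equation in the energy class, with its approximation. -/
structure IsDriftData {n : ℕ} (T : ℝ) (b : ℝ × UnitAddTorus (Fin n) → EuclideanSpace ℝ (Fin n))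
    (d : ℝ × UnitAddTorus (Fin n) → ℝ) (ρ₀ : UnitAddTorus (Fin n) → ℝ)
    (ρ : ℝ × UnitAddTorus (Fin n) → ℝ) (G : ℝ × UnitAddTorus (Fin n) → EuclideanSpace ℝ (Fin n))
    (f : ℝ × UnitAddTorus (Fin n) → ℝ) (F : ℝ × UnitAddTorus (Fin n) → EuclideanSpace ℝ (Fin n))
    (u f' : ℕ → ℝ × UnitAddTorus (Fin n) → ℝ) (F' : ℕ → Fin n → ℝ × UnitAddTorus (Fin n) → ℝ) :
    Prop where
  approx : IsApproxSeq T ρ₀ ρ G f F u f' F'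
  memLp_drift : MemLp b 2 (parabolicCylinder n T)
  measurable_div : AEStronglyMeasurable d (parabolicCylinder n T)
  integrable_div : Integrable (fun z => d z * (1 + ρ z ^ 2)) (parabolicCylinder n T)
  div : IsWeakDiv T b d
  eq : ∀ φ, IsInteriorTest T φ →
    ∫ z, (f z * φ z - inner ℝ (F z) (spaceGrad φ z) + inner ℝ (G z) (spaceGrad φ z)
      - ρ z * inner ℝ (b z) (spaceGrad φ z)) ∂(parabolicCylinder n T) = 0

variable {b : ℝ × UnitAddTorus (Fin n) → EuclideanSpace ℝ (Fin n)}
  {d : ℝ × UnitAddTorus (Fin n) → ℝ} {ρ₀ : UnitAddTorus (Fin n) → ℝ}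
  {ρ f : ℝ × UnitAddTorus (Fin n) → ℝ}
  {G F : ℝ × UnitAddTorus (Fin n) → EuclideanSpace ℝ (Fin n)}
  {u f' : ℕ → ℝ × UnitAddTorus (Fin n) → ℝ} {F' : ℕ → Fin n → ℝ × UnitAddTorus (Fin n) → ℝ}

theorem integral_inner_eq_sum {a c : ℝ × UnitAddTorus (Fin n) → EuclideanSpace ℝ (Fin n)}
    {μ : Measure (ℝ × UnitAddTorus (Fin n))} (h : ∀ i, Integrable (fun z => c z i * a z i) μ) :
    ∫ z, inner ℝ (a z) (c z) ∂μ = ∑ i, ∫ z, c z i * a z i ∂μ := by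
  rw [← integral_finsetSum _ fun i _ => h i]
  simp only [PiLp.inner_apply, RCLike.inner_apply, conj_trivial]

theorem integrable_inner_of_coord {a c : ℝ × UnitAddTorus (Fin n) → EuclideanSpace ℝ (Fin n)}
    {μ : Measure (ℝ × UnitAddTorus (Fin n))} (h : ∀ i, Integrable (fun z => c z i * a z i) μ) :
    Integrable (fun z => inner ℝ (a z) (c z)) μ := by
  simp only [PiLp.inner_apply, RCLike.inner_apply, conj_trivial]
  exact integrable_finsetSum _ fun i _ => h i

theorem IsDriftData.integrable_div_mul (h : IsDriftData T b d ρ₀ ρ G f F u f' F')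
    {ζ : ℝ × UnitAddTorus (Fin n) → ℝ} (hζ : AEStronglyMeasurable ζ (parabolicCylinder n T)) {C : ℝ}
    (hC : ∀ z, |ζ z| ≤ C * (1 + ρ z ^ 2)) :
    Integrable (fun z => d z * ζ z) (parabolicCylinder n T) := by
  refine (h.integrable_div.norm.const_mul C).mono' (h.measurable_div.mul hζ)
    (Eventually.of_forall fun z => ?_)
  rw [norm_mul, norm_mul, Real.norm_of_nonneg (by positivity : 0 ≤ 1 + ρ z ^ 2), Real.norm_eq_abs,
    Real.norm_eq_abs]
  nlinarith [hC z, abs_nonneg (d z)]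

theorem IsInteriorTest.mul_comp {ψ φ : ℝ × UnitAddTorus (Fin n) → ℝ} (hψ : IsInteriorTest T ψ)
    (hφ : IsSmooth φ) : IsInteriorTest T fun z => ψ z * φ z := by
  obtain ⟨hs, t₀, t₁, h0, h1, h⟩ := hψ
  exact ⟨hs.mul hφ, t₀, t₁, h0, h1, fun t x ht => by simp [h t x ht]⟩

theorem IsApproxSeq.l2Conv_spaceGrad_test (ha : IsApproxSeq T ρ₀ ρ G f F u f' F')
    {ψ : ℝ × UnitAddTorus (Fin n) → ℝ} (hψ : IsInteriorTest T ψ) {Φ : ℝ → ℝ} (hΦ : ContDiff ℝ ∞ Φ)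
    {B L : ℝ} (hB : ∀ s, |Φ s| ≤ B) (hL : ∀ s, |deriv Φ s| ≤ L) (i : Fin n) :
    L2Conv (parabolicCylinder n T) (fun j z => spaceGrad (fun z => ψ z * Φ (u j z)) z i)
      fun z => Φ (ρ z) * spaceGrad ψ z i + ψ z * deriv Φ (ρ z) * G z i := by
  obtain ⟨C, hC0, hC⟩ := hψ.exists_bound
  have hΦ' : Continuous (deriv Φ) := (contDiff_infty_iff_deriv.1 hΦ).2.continuous
  have h1 := (L2Conv.const ((hψ.1.smooth_spaceGrad i).continuous.memLp_top_parabolicCylinder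
    (T := T) |>.mono_exponent (p := 2) le_top)).bounded_mul (ζ := fun j z => Φ (u j z))
    (ζ₀ := fun z => Φ (ρ z))
    (fun j => (hΦ.continuous.comp (ha.smooth j).continuous).aestronglyMeasurable)
    (fun _ _ => hB _) (ha.ae.mono fun z hz => (hΦ.continuous.tendsto _).comp hz)
  have h2 := (ha.grad i).bounded_mul (ζ := fun j z => ψ z * deriv Φ (u j z)) (C := C * L)
    (ζ₀ := fun z => ψ z * deriv Φ (ρ z))
    (fun j => (hψ.1.continuous.mul (hΦ'.comp (ha.smooth j).continuous)).aestronglyMeasurable)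
    (fun j z => by
      rw [abs_mul]
      exact mul_le_mul (hC z) (hL _) (abs_nonneg _) hC0)
    (ha.ae.mono fun z hz => ((hΦ'.tendsto _).comp hz).const_mul _)
  convert h1.add h2 using 3 with j z
  rw [hψ.1.spaceGrad_mul (IsSmooth.smooth_comp hΦ (ha.smooth j)),
    IsSmooth.spaceGrad_comp hΦ (ha.smooth j)]
  simp only [PiLp.add_apply, PiLp.smul_apply, smul_eq_mul]
  ring

/-- The function `ψ Φ(uⱼ)` is an admissible test function for the distributional divergence. In the
limit its gradient converges in `L²`, against `b` in `L²`, while the other side is dominated because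
`Φ` is bounded and `d` is integrable. -/
theorem IsDriftData.integral_div_of_bounded (h : IsDriftData T b d ρ₀ ρ G f F u f' F')
    {ψ : ℝ × UnitAddTorus (Fin n) → ℝ} (hψ : IsInteriorTest T ψ) {Φ : ℝ → ℝ} (hΦ : ContDiff ℝ ∞ Φ)
    {B L : ℝ} (hB : ∀ s, |Φ s| ≤ B) (hL : ∀ s, |deriv Φ s| ≤ L) :
    ∑ i, ∫ z, (Φ (ρ z) * spaceGrad ψ z i + ψ z * deriv Φ (ρ z) * G z i) * b z i
      ∂(parabolicCylinder n T) = -∫ z, ψ z * Φ (ρ z) * d z ∂(parabolicCylinder n T) := by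
  have ha := h.approx
  obtain ⟨C, hC0, hC⟩ := hψ.exists_bound
  have hb := fun i => L2Conv.const (MemLp.coord h.memLp_drift i)
  have hd : Integrable d (parabolicCylinder n T) := by
    simpa using h.integrable_div_mul (ζ := fun _ => 1) aestronglyMeasurable_const (C := 1)
      fun z => by rw [abs_one]; nlinarith [sq_nonneg (ρ z)]
  have h1 := tendsto_finsetSum Finset.univ fun i _ =>
    (ha.l2Conv_spaceGrad_test hψ hΦ hB hL i).tendsto_integral_mul (hb i)
  have h2 := tendsto_integral_bounded_mul (ζ := fun j z => ψ z * Φ (u j z))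
    (ζ₀ := fun z => ψ z * Φ (ρ z)) (C := C * B) hd
    (fun j => (hψ.1.continuous.mul
      (hΦ.continuous.comp (ha.smooth j).continuous)).aestronglyMeasurable)
    (fun j z => by
      rw [abs_mul]
      exact mul_le_mul (hC z) (hB _) (abs_nonneg _) hC0)
    (ha.ae.mono fun z hz => ((hΦ.continuous.tendsto _).comp hz).const_mul _)
  refine tendsto_nhds_unique h1 (h2.neg.congr fun j => ?_)
  have h3 := h.div _ (hψ.mul_comp (IsSmooth.smooth_comp hΦ (ha.smooth j)))
  rw [integral_inner_eq_sum fun i => ((ha.l2Conv_spaceGrad_test hψ hΦ hB hL i).memLp j).integrable_fun_mul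
    (MemLp.coord h.memLp_drift i)] at h3
  rw [h3]
  simp only [mul_comm]

theorem abs_le_of_deriv_le {Φ : ℝ → ℝ} (hΦ : Differentiable ℝ Φ) {L : ℝ} (hL : ∀ s, |deriv Φ s| ≤ L)
    (s : ℝ) : |Φ s| ≤ |Φ 0| + L * |s| := by
  have := convex_univ.norm_image_sub_le_of_norm_deriv_le (f := Φ) (x := 0) (y := s)
    (fun x _ => hΦ x) (fun x _ => hL x) (mem_univ _) (mem_univ _)
  simp only [Real.norm_eq_abs, sub_zero] at this
  linarith [abs_sub_abs_le_abs_sub (Φ s) (Φ 0)]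

theorem IsDriftData.memLp_comp (h : IsDriftData T b d ρ₀ ρ G f F u f' F') {Φ : ℝ → ℝ}
    (hΦ : ContDiff ℝ ∞ Φ) {L : ℝ} (hL : ∀ s, |deriv Φ s| ≤ L) :
    MemLp (fun z => Φ (ρ z)) 2 (parabolicCylinder n T) := by
  have hL0 : 0 ≤ L := (abs_nonneg _).trans (hL 0)
  exact (h.approx.conv.comp_lipschitz (lipschitzWith_of_hasDerivAt (L := ⟨L, hL0⟩)
    (fun s => (hΦ.differentiable (by simp) s).hasDerivAt) hL)).memLp_lim

/-- The product rule for the divergence of a drift multiplied by a function of the solution. -/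
theorem IsDriftData.integral_div (h : IsDriftData T b d ρ₀ ρ G f F u f' F')
    {ψ : ℝ × UnitAddTorus (Fin n) → ℝ} (hψ : IsInteriorTest T ψ) {Φ : ℝ → ℝ} (hΦ : ContDiff ℝ ∞ Φ)
    {L : ℝ} (hL : ∀ s, |deriv Φ s| ≤ L) :
    ∑ i, ∫ z, (Φ (ρ z) * spaceGrad ψ z i + ψ z * deriv Φ (ρ z) * G z i) * b z i
      ∂(parabolicCylinder n T) = -∫ z, ψ z * Φ (ρ z) * d z ∂(parabolicCylinder n T) := by
  have ha := h.approx
  have hL0 : 0 ≤ L := (abs_nonneg _).trans (hL 0)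
  obtain ⟨C, hC0, hC⟩ := hψ.exists_bound
  have hρm := ha.conv.memLp_lim.1
  have hΦd : Differentiable ℝ Φ := hΦ.differentiable (by simp)
  have hΦ' : Continuous (deriv Φ) := (contDiff_infty_iff_deriv.1 hΦ).2.continuous
  have hb := fun i => L2Conv.const (MemLp.coord h.memLp_drift i)
  -- The truncation `sinTrunc j ∘ Φ` is bounded, and the cosine factor leaves the Lipschitz constant
  -- of `Φ` unchanged, uniformly in `j`.
  have hder : ∀ j s, HasDerivAt (fun s => sinTrunc j (Φ s))
      (Real.cos (Φ s / ((j : ℝ) + 1)) * deriv Φ s) s := fun j s =>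
    (hasDerivAt_sinTrunc j (Φ s)).comp s (hΦd s).hasDerivAt
  have hL2 : ∀ j s, |deriv (fun s => sinTrunc j (Φ s)) s| ≤ L := fun j s => by
    rw [(hder j s).deriv, abs_mul]
    exact (mul_le_of_le_one_left (abs_nonneg _) (Real.abs_cos_le_one _)).trans (hL s)
  have h0 := fun j => h.integral_div_of_bounded hψ ((contDiff_sinTrunc j).comp hΦ)
    (fun s => abs_sinTrunc_le j (Φ s)) (hL2 j)
  have c1 : ∀ i, L2Conv (parabolicCylinder n T) (fun j z => sinTrunc j (Φ (ρ z)) * spaceGrad ψ z i)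
      fun z => Φ (ρ z) * spaceGrad ψ z i := fun i => by
    obtain ⟨C', -, hC'⟩ := (hψ.1.smooth_spaceGrad i).continuous.exists_bound_cyl 0 T
    have hm : MemLp (fun z => Φ (ρ z) * spaceGrad ψ z i) 2 (parabolicCylinder n T) := by
      refine MemLp.of_le_mul (c := C') (h.memLp_comp hΦ hL) ((h.memLp_comp hΦ hL).1.mul
        (hψ.1.smooth_spaceGrad i).continuous.aestronglyMeasurable) ?_
      filter_upwards [ae_mem_parabolicCylinder n T] with z hz
      rw [norm_mul, mul_comm]
      exact mul_le_mul_of_nonneg_right (hC' z (Ioo_subset_Icc_self hz)) (norm_nonneg _)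
    have := (L2Conv.const hm).bounded_mul (ζ := fun j z => Real.sinc (Φ (ρ z) / ((j : ℝ) + 1)))
      (ζ₀ := fun _ => 1) (C := 1) (fun j => (Real.continuous_sinc.comp
        (hΦ.continuous.div_const _)).comp_aestronglyMeasurable hρm)
      (fun _ _ => Real.abs_sinc_le_one _) (Eventually.of_forall fun z => tendsto_sinc_div _)
    simp only [one_mul] at this
    convert this using 3
    rw [sinTrunc_eq, mul_assoc]
  have c2 : ∀ i, L2Conv (parabolicCylinder n T)
      (fun j z => ψ z * (Real.cos (Φ (ρ z) / ((j : ℝ) + 1)) * deriv Φ (ρ z)) * G z i)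
      fun z => ψ z * deriv Φ (ρ z) * G z i := fun i => by
    refine (L2Conv.const (ha.grad i).memLp_lim).bounded_mul (C := C * L) (fun j =>
      hψ.1.continuous.aestronglyMeasurable.mul (((Real.continuous_cos.comp
        (hΦ.continuous.div_const _)).mul hΦ').comp_aestronglyMeasurable hρm))
      (fun j z => ?_) (Eventually.of_forall fun z => ?_)
    · rw [abs_mul]
      refine mul_le_mul (hC z) ?_ (abs_nonneg _) hC0
      rw [abs_mul]
      exact (mul_le_of_le_one_left (abs_nonneg _) (Real.abs_cos_le_one _)).trans (hL _)
    · simpa using ((tendsto_cos_div (Φ (ρ z))).mul_const (deriv Φ (ρ z))).const_mul (ψ z)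
  have h1 := tendsto_finsetSum Finset.univ fun i _ =>
    ((c1 i).add (c2 i)).tendsto_integral_mul (hb i)
  -- `Φ` grows linearly, and `|ρ|` is dominated by `1 + ρ²`, against which `d` is integrable.
  have hdom : Integrable (fun z => d z * (C * (|Φ 0| + L * |ρ z|))) (parabolicCylinder n T) := by
    refine h.integrable_div_mul (C := C * (|Φ 0| + L)) ?_ fun z => ?_
    · exact (Continuous.comp_aestronglyMeasurable (g := fun s : ℝ => C * (|Φ 0| + L * |s|))
        (by fun_prop) hρm)
    · rw [abs_of_nonneg (by positivity)]
      have : |ρ z| ≤ 1 + ρ z ^ 2 := by nlinarith [sq_abs (ρ z), sq_nonneg (|ρ z| - 1)]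
      rw [mul_assoc]
      refine mul_le_mul_of_nonneg_left ?_ hC0
      nlinarith [abs_nonneg (Φ 0), sq_nonneg (ρ z)]
  have h2 : Tendsto (fun j => ∫ z, ψ z * sinTrunc j (Φ (ρ z)) * d z ∂(parabolicCylinder n T)) atTop
      (𝓝 (∫ z, ψ z * Φ (ρ z) * d z ∂(parabolicCylinder n T))) := by
    refine tendsto_integral_of_dominated_convergence _ (fun j => ?_) hdom.norm
      (fun j => Eventually.of_forall fun z => ?_) (Eventually.of_forall fun z => ?_)
    · exact (hψ.1.continuous.aestronglyMeasurable.mul (((contDiff_sinTrunc j).continuous.comp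
        hΦ.continuous).comp_aestronglyMeasurable hρm)).mul h.measurable_div
    · rw [norm_mul, norm_mul, norm_mul, mul_comm]
      refine mul_le_mul_of_nonneg_left ?_ (norm_nonneg _)
      rw [Real.norm_of_nonneg (by positivity : 0 ≤ C * (|Φ 0| + L * |ρ z|))]
      exact mul_le_mul (hC z) ((abs_sinTrunc_le_abs j _).trans (abs_le_of_deriv_le hΦd hL _))
        (norm_nonneg _) hC0
    · exact ((tendsto_sinTrunc _).const_mul _).mul_const _
  refine tendsto_nhds_unique h1 (h2.neg.congr fun j => ?_)
  refine (h0 j).symm.trans ?_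
  rw [show sinTrunc j ∘ Φ = fun s => sinTrunc j (Φ s) from rfl]
  simp only [(hder j _).deriv]

end

/-! ### The energy identity for bounded nonlinearities -/

section

variable {n : ℕ} {T : ℝ} {b : ℝ × UnitAddTorus (Fin n) → EuclideanSpace ℝ (Fin n)}
  {d : ℝ × UnitAddTorus (Fin n) → ℝ} {ρ₀ : UnitAddTorus (Fin n) → ℝ}
  {ρ f : ℝ × UnitAddTorus (Fin n) → ℝ}
  {G F : ℝ × UnitAddTorus (Fin n) → EuclideanSpace ℝ (Fin n)}
  {u f' : ℕ → ℝ × UnitAddTorus (Fin n) → ℝ} {F' : ℕ → Fin n → ℝ × UnitAddTorus (Fin n) → ℝ}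

/-- The equation in nondivergence form. -/
theorem IsDriftData.nondivergence (h : IsDriftData T b d ρ₀ ρ G f F u f' F')
    {φ : ℝ × UnitAddTorus (Fin n) → ℝ} (hφ : IsInteriorTest T φ) :
    (∫ z, φ z * f z ∂(parabolicCylinder n T)) -
      ∑ i, (∫ z, spaceGrad φ z i * F z i ∂(parabolicCylinder n T)) +
      ∑ i, (∫ z, spaceGrad φ z i * G z i ∂(parabolicCylinder n T)) +
      ∑ i, (∫ z, φ z * (G z i * b z i) ∂(parabolicCylinder n T)) +
      ∫ z, φ z * (ρ z * d z) ∂(parabolicCylinder n T) = 0 := by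
  have ha := h.approx
  -- The product `ρ b` is merely integrable, so pairing it with `Dφ` is not stable under `L²`
  -- convergence of gradients. The product rule with `Φ = id` replaces it by the integrable
  -- functions `G · b` and `ρ d` paired with `φ`, for which bounded almost everywhere convergence is
  -- enough.
  have hdiv := h.integral_div hφ contDiff_id (L := 1) (by simp)
  simp only [id, deriv_id, mul_one] at hdiv
  have hφ2 : MemLp φ 2 (parabolicCylinder n T) :=
    hφ.1.continuous.memLp_top_parabolicCylinder.mono_exponent le_top
  have hD : ∀ i, Continuous fun z => spaceGrad φ z i := fun i => (hφ.1.smooth_spaceGrad i).continuous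
  have hD2 : ∀ i, MemLp (fun z => spaceGrad φ z i) 2 (parabolicCylinder n T) := fun i =>
    (hD i).memLp_top_parabolicCylinder.mono_exponent le_top
  have i1 : Integrable (fun z => f z * φ z) (parabolicCylinder n T) :=
    ha.source.memLp_lim.integrable_fun_mul hφ2
  have i2 : ∀ i, Integrable (fun z => spaceGrad φ z i * F z i) (parabolicCylinder n T) := fun i =>
    (hD2 i).integrable_fun_mul (ha.flux i).memLp_lim
  have i3 : ∀ i, Integrable (fun z => spaceGrad φ z i * G z i) (parabolicCylinder n T) := fun i =>
    (hD2 i).integrable_fun_mul (ha.grad i).memLp_lim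
  have i4 : ∀ i, Integrable (fun z => ρ z * spaceGrad φ z i * b z i) (parabolicCylinder n T) :=
    fun i => by
      have := integrable_mul_continuous
        (ha.conv.memLp_lim.integrable_fun_mul (MemLp.coord h.memLp_drift i)) (hD i)
      exact this.congr (Eventually.of_forall fun z => by ring)
  have i5 : ∀ i, Integrable (fun z => φ z * (G z i * b z i)) (parabolicCylinder n T) := fun i => by
    have := integrable_mul_continuous
      ((ha.grad i).memLp_lim.integrable_fun_mul (MemLp.coord h.memLp_drift i)) hφ.1.continuous
    exact this.congr (Eventually.of_forall fun z => by ring)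
  have e1 : ∀ i, ∫ z, (ρ z * spaceGrad φ z i + φ z * G z i) * b z i ∂(parabolicCylinder n T) =
      (∫ z, ρ z * spaceGrad φ z i * b z i ∂(parabolicCylinder n T)) +
        ∫ z, φ z * (G z i * b z i) ∂(parabolicCylinder n T) := fun i => by
    rw [← integral_add (i4 i) (i5 i)]
    refine integral_congr_ae (Eventually.of_forall fun z => ?_)
    simp only
    ring
  simp only [e1, Finset.sum_add_distrib] at hdiv
  have heq := h.eq φ hφ
  have e2 : ∀ z, ρ z * inner ℝ (b z) (spaceGrad φ z) = ∑ i, ρ z * spaceGrad φ z i * b z i := by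
    intro z
    simp only [PiLp.inner_apply, RCLike.inner_apply, conj_trivial, Finset.mul_sum, mul_assoc]
  simp only [e2] at heq
  have j2 := integrable_inner_of_coord i2
  have j3 := integrable_inner_of_coord i3
  have j12 : Integrable (fun z => f z * φ z - inner ℝ (F z) (spaceGrad φ z))
    (parabolicCylinder n T) := i1.sub j2
  have j123 : Integrable (fun z => f z * φ z - inner ℝ (F z) (spaceGrad φ z) +
    inner ℝ (G z) (spaceGrad φ z)) (parabolicCylinder n T) := j12.add j3
  rw [integral_sub j123 (integrable_finsetSum _ fun i _ => i4 i), integral_add j12 j3,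
    integral_sub i1 j2, integral_inner_eq_sum i2, integral_inner_eq_sum i3,
    integral_finsetSum _ fun i _ => i4 i] at heq
  simp only [mul_comm (φ _) (f _)]
  have e3 : ∫ z, φ z * (ρ z * d z) ∂(parabolicCylinder n T) =
      ∫ z, φ z * ρ z * d z ∂(parabolicCylinder n T) := by simp only [mul_assoc]
  rw [e3]
  linarith

/-- The density in the energy identity for the function with derivative `g`. -/
noncomputable def energyDensity (d ρ f : ℝ × UnitAddTorus (Fin n) → ℝ)
    (G F : ℝ × UnitAddTorus (Fin n) → EuclideanSpace ℝ (Fin n)) (g β : ℝ → ℝ)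
    (z : ℝ × UnitAddTorus (Fin n)) : ℝ :=
  g (ρ z) * f z - ∑ i, deriv g (ρ z) * G z i * F z i + ∑ i, deriv g (ρ z) * G z i * G z i +
    (ρ z * g (ρ z) - β (ρ z)) * d z

theorem IsDriftData.memLp_deriv_mul_grad (h : IsDriftData T b d ρ₀ ρ G f F u f' F') {g : ℝ → ℝ}
    (hg : ContDiff ℝ ∞ g) {L : ℝ} (hL : ∀ s, |deriv g s| ≤ L) (i : Fin n) :
    MemLp (fun z => deriv g (ρ z) * G z i) 2 (parabolicCylinder n T) := by
  refine MemLp.of_le_mul (c := L) (h.approx.grad i).memLp_lim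
    (((contDiff_infty_iff_deriv.1 hg).2.continuous.comp_aestronglyMeasurable
      h.approx.conv.memLp_lim.1).mul (h.approx.grad i).memLp_lim.1)
    (Eventually.of_forall fun z => ?_)
  rw [norm_mul]
  exact mul_le_mul_of_nonneg_right (hL _) (norm_nonneg _)

theorem abs_primitive_le {g β : ℝ → ℝ} (hβ : ∀ s, HasDerivAt β (g s) s) {A L : ℝ} (hL0 : 0 ≤ L)
    (hg : ∀ s, |g s| ≤ A + L * |s|) (s : ℝ) : |β s| ≤ |β 0| + (A + L * |s|) * |s| := by
  have h1 : ∀ x ∈ uIcc 0 s, ‖g x‖ ≤ A + L * |s| := fun x hx => by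
    have h2 : |x| ≤ |s| := by
      have := abs_sub_left_of_mem_uIcc hx
      simpa using this
    exact (hg x).trans (by gcongr)
  have := (convex_uIcc 0 s).norm_image_sub_le_of_norm_hasDerivWithin_le
    (fun x _ => (hβ x).hasDerivWithinAt) h1 left_mem_uIcc right_mem_uIcc
  simp only [Real.norm_eq_abs, sub_zero] at this
  linarith [abs_sub_abs_le_abs_sub (β s) (β 0)]

theorem abs_mul_sub_primitive_le {g β : ℝ → ℝ} (hβ : ∀ s, HasDerivAt β (g s) s) {A L B : ℝ}
    (hA0 : 0 ≤ A) (hL0 : 0 ≤ L) (hg : ∀ s, |g s| ≤ A + L * |s|) (hB : |β 0| ≤ B) (s : ℝ) :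
    |s * g s - β s| ≤ (B + 2 * A + 2 * L) * (1 + s ^ 2) := by
  have h1 := abs_primitive_le hβ hL0 hg s
  have h2 : |s * g s| ≤ |s| * (A + L * |s|) := by
    rw [abs_mul]
    exact mul_le_mul_of_nonneg_left (hg s) (abs_nonneg s)
  have h3 := abs_sub (s * g s) (β s)
  have h4 : |s| ≤ 1 + s ^ 2 := by nlinarith [sq_abs s, sq_nonneg (|s| - 1)]
  have h5 := sq_abs s
  nlinarith [abs_nonneg s, sq_nonneg s, mul_le_mul_of_nonneg_left h4 hA0, abs_nonneg (β 0),
    mul_nonneg ((abs_nonneg _).trans hB) (sq_nonneg s)]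

theorem IsDriftData.integrable_energyDensity (h : IsDriftData T b d ρ₀ ρ G f F u f' F') {g β : ℝ → ℝ}
    (hg : ContDiff ℝ ∞ g) {L : ℝ} (hL : ∀ s, |deriv g s| ≤ L) (hβ : ∀ s, HasDerivAt β (g s) s) :
    Integrable (fun z => g (ρ z) * f z) (parabolicCylinder n T) ∧
    (∀ i, Integrable (fun z => deriv g (ρ z) * G z i * F z i) (parabolicCylinder n T)) ∧
    (∀ i, Integrable (fun z => deriv g (ρ z) * G z i * G z i) (parabolicCylinder n T)) ∧
    Integrable (fun z => (ρ z * g (ρ z) - β (ρ z)) * d z) (parabolicCylinder n T) ∧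
    Integrable (energyDensity d ρ f G F g β) (parabolicCylinder n T) := by
  have ha := h.approx
  have hL0 : 0 ≤ L := (abs_nonneg _).trans (hL 0)
  have i1 := (h.memLp_comp hg hL).integrable_fun_mul ha.source.memLp_lim
  have i2 := fun i => (h.memLp_deriv_mul_grad hg hL i).integrable_fun_mul (ha.flux i).memLp_lim
  have i3 := fun i => (h.memLp_deriv_mul_grad hg hL i).integrable_fun_mul (ha.grad i).memLp_lim
  have hβc : Continuous β := continuous_iff_continuousAt.2 fun s => (hβ s).continuousAt
  have i4 : Integrable (fun z => (ρ z * g (ρ z) - β (ρ z)) * d z) (parabolicCylinder n T) := by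
    have := h.integrable_div_mul (ζ := fun z => ρ z * g (ρ z) - β (ρ z))
      (((continuous_id.mul hg.continuous).sub hβc).comp_aestronglyMeasurable
        ha.conv.memLp_lim.1)
      fun z => abs_mul_sub_primitive_le hβ (abs_nonneg _) hL0
        (abs_le_of_deriv_le (hg.differentiable (by simp)) hL) le_rfl (ρ z)
    simpa only [mul_comm] using this
  exact ⟨i1, i2, i3, i4, ((i1.sub (integrable_finsetSum _ fun i _ => i2 i)).add
    (integrable_finsetSum _ fun i _ => i3 i)).add i4⟩

theorem IsDriftData.integral_mul_energyDensity (h : IsDriftData T b d ρ₀ ρ G f F u f' F')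
    {g β : ℝ → ℝ} (hg : ContDiff ℝ ∞ g) {L : ℝ} (hL : ∀ s, |deriv g s| ≤ L)
    (hβ : ∀ s, HasDerivAt β (g s) s) {η : ℝ × UnitAddTorus (Fin n) → ℝ} (hη : IsInteriorTest T η) :
    ∫ z, η z * energyDensity d ρ f G F g β z ∂(parabolicCylinder n T) =
    (∫ z, η z * g (ρ z) * f z ∂(parabolicCylinder n T)) -
      ∑ i, (∫ z, η z * deriv g (ρ z) * G z i * F z i ∂(parabolicCylinder n T)) +
      ∑ i, (∫ z, η z * deriv g (ρ z) * G z i * G z i ∂(parabolicCylinder n T)) +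
      ∫ z, η z * ((ρ z * g (ρ z) - β (ρ z)) * d z) ∂(parabolicCylinder n T) := by
  obtain ⟨i1, i2, i3, i4, -⟩ := h.integrable_energyDensity hg hL hβ
  have hm : ∀ {k : ℝ × UnitAddTorus (Fin n) → ℝ}, Integrable k (parabolicCylinder n T) →
      Integrable (fun z => η z * k z) (parabolicCylinder n T) := fun hk =>
    (integrable_mul_continuous hk hη.1.continuous).congr (Eventually.of_forall fun z => mul_comm _ _)
  have k2 : Integrable (fun z => ∑ i, η z * (deriv g (ρ z) * G z i * F z i))
    (parabolicCylinder n T) := integrable_finsetSum _ fun i _ => hm (i2 i)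
  have k3 : Integrable (fun z => ∑ i, η z * (deriv g (ρ z) * G z i * G z i))
    (parabolicCylinder n T) := integrable_finsetSum _ fun i _ => hm (i3 i)
  have k12 : Integrable (fun z => η z * (g (ρ z) * f z) -
    ∑ i, η z * (deriv g (ρ z) * G z i * F z i)) (parabolicCylinder n T) := (hm i1).sub k2
  have k123 : Integrable (fun z => η z * (g (ρ z) * f z) -
    ∑ i, η z * (deriv g (ρ z) * G z i * F z i) + ∑ i, η z * (deriv g (ρ z) * G z i * G z i))
    (parabolicCylinder n T) := k12.add k3
  have e : ∀ z, η z * energyDensity d ρ f G F g β z = η z * (g (ρ z) * f z) -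
      ∑ i, η z * (deriv g (ρ z) * G z i * F z i) + ∑ i, η z * (deriv g (ρ z) * G z i * G z i) +
      η z * ((ρ z * g (ρ z) - β (ρ z)) * d z) := fun z => by
    rw [energyDensity, ← Finset.mul_sum, ← Finset.mul_sum]
    ring
  simp only [e]
  rw [integral_add k123 (hm i4), integral_add k12 k3, integral_sub (hm i1) k2,
    integral_finsetSum _ fun i _ => hm (i2 i), integral_finsetSum _ fun i _ => hm (i3 i)]
  simp only [mul_assoc]

/-- Testing with `η g(uⱼ)` leaves in the limit the drift terms `η g(ρ) (G · b + ρ d)`. The product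
rule with `Φ = β` turns `η g(ρ) G · b` into `-η β(ρ) d`, so `b` disappears. Boundedness of `g` keeps
the test functions uniformly bounded. -/
theorem IsDriftData.energy_identity_of_bounded (h : IsDriftData T b d ρ₀ ρ G f F u f' F')
    {g β : ℝ → ℝ} (hg : ContDiff ℝ ∞ g) {B L : ℝ} (hB : ∀ s, |g s| ≤ B) (hL : ∀ s, |deriv g s| ≤ L)
    (hβ : ∀ s, HasDerivAt β (g s) s) {η : ℝ → ℝ}
    (hη : IsInteriorTest T fun z : ℝ × UnitAddTorus (Fin n) => η z.1) :
    ∫ z, η z.1 * energyDensity d ρ f G F g β z ∂(parabolicCylinder n T) = 0 := by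
  have ha := h.approx
  obtain ⟨C, hC0, hC⟩ := hη.exists_bound
  have hρm := ha.conv.memLp_lim.1
  have hL0 : 0 ≤ L := (abs_nonneg _).trans (hL 0)
  have hβs := contDiff_of_hasDerivAt hg hβ
  have hβ' : deriv β = g := funext fun s => (hβ s).deriv
  have h1 := h.integral_div hη hβs (L := B) (by rwa [hβ'])
  rw [h.integral_mul_energyDensity hg hL hβ hη]
  simp only [hβ', spaceGrad_time, PiLp.zero_apply, mul_zero, zero_add] at h1
  set φ : ℕ → ℝ × UnitAddTorus (Fin n) → ℝ := fun j z => η z.1 * g (u j z) with hφ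
  have hφt : ∀ j, IsInteriorTest T (φ j) := fun j =>
    hη.mul_comp (IsSmooth.smooth_comp hg (ha.smooth j))
  have hφm : ∀ j, AEStronglyMeasurable (φ j) (parabolicCylinder n T) := fun j =>
    (hφt j).1.continuous.aestronglyMeasurable
  have hφb : ∀ j z, |φ j z| ≤ C * B := fun j z => by
    rw [hφ, abs_mul]
    exact mul_le_mul (hC z) (hB _) (abs_nonneg _) hC0
  have hφl : ∀ᵐ z ∂(parabolicCylinder n T), Tendsto (fun j => φ j z) atTop
      (𝓝 (η z.1 * g (ρ z))) :=
    ha.ae.mono fun z hz => ((hg.continuous.tendsto _).comp hz).const_mul _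
  have c0 := fun i => ha.l2Conv_spaceGrad_test hη hg hB hL i
  simp only [spaceGrad_time, PiLp.zero_apply, mul_zero, zero_add] at c0
  have c1 := tendsto_integral_bounded_mul (ha.source.memLp_lim.integrable (by norm_num)) hφm hφb hφl
  have c2 := tendsto_finsetSum Finset.univ fun i _ =>
    (c0 i).tendsto_integral_mul (L2Conv.const (ha.flux i).memLp_lim)
  have c3 := tendsto_finsetSum Finset.univ fun i _ =>
    (c0 i).tendsto_integral_mul (L2Conv.const (ha.grad i).memLp_lim)
  have c4 := tendsto_finsetSum Finset.univ fun i _ => tendsto_integral_bounded_mul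
    ((ha.grad i).memLp_lim.integrable_fun_mul (MemLp.coord h.memLp_drift i)) hφm hφb hφl
  have hρd : Integrable (fun z => ρ z * d z) (parabolicCylinder n T) := by
    have := h.integrable_div_mul (ζ := ρ) hρm (C := 1) fun z => by
      nlinarith [sq_abs (ρ z), sq_nonneg (|ρ z| - 1)]
    simpa only [mul_comm] using this
  have c5 := tendsto_integral_bounded_mul hρd hφm hφb hφl
  have c := (((c1.sub c2).add c3).add c4).add c5
  have e := tendsto_nhds_unique c (tendsto_const_nhds.congr fun j => (h.nondivergence (hφt j)).symm)
  have hβm : Integrable (fun z => β (ρ z) * d z) (parabolicCylinder n T) := by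
    have := h.integrable_div_mul (ζ := fun z => β (ρ z))
      (hβs.continuous.comp_aestronglyMeasurable hρm) (C := |β 0| + B) fun z => by
        have h2 := abs_le_of_deriv_le (hβs.differentiable (by simp)) (L := B) (by rwa [hβ']) (ρ z)
        have h3 : |ρ z| ≤ 1 + ρ z ^ 2 := by nlinarith [sq_abs (ρ z), sq_nonneg (|ρ z| - 1)]
        have hB0 : 0 ≤ B := (abs_nonneg _).trans (hB 0)
        nlinarith [abs_nonneg (β 0), sq_nonneg (ρ z)]
    simpa only [mul_comm] using this
  have hgm : Integrable (fun z => g (ρ z) * (ρ z * d z)) (parabolicCylinder n T) :=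
    hρd.bdd_mul (c := B) (hg.continuous.comp_aestronglyMeasurable hρm)
      (Eventually.of_forall fun z => hB _)
  have hm : ∀ {k : ℝ × UnitAddTorus (Fin n) → ℝ}, Integrable k (parabolicCylinder n T) →
      Integrable (fun z => η z.1 * k z) (parabolicCylinder n T) := fun hk =>
    (integrable_mul_continuous hk hη.1.continuous).congr (Eventually.of_forall fun z => mul_comm _ _)
  have e5 : ∫ z, η z.1 * ((ρ z * g (ρ z) - β (ρ z)) * d z) ∂(parabolicCylinder n T) =
      (∫ z, η z.1 * g (ρ z) * (ρ z * d z) ∂(parabolicCylinder n T)) -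
        ∫ z, η z.1 * β (ρ z) * d z ∂(parabolicCylinder n T) := by
    have := integral_sub (hm hgm) (hm hβm)
    simp only [mul_assoc] at this ⊢
    rw [← this]
    refine integral_congr_ae (Eventually.of_forall fun z => ?_)
    simp only
    ring
  rw [e5]
  simp only [mul_assoc] at e h1 ⊢
  linarith

end

/-! ### The energy identity for nonlinearities of quadratic growth -/

section

variable {n : ℕ} {T : ℝ} {b : ℝ × UnitAddTorus (Fin n) → EuclideanSpace ℝ (Fin n)}
  {d : ℝ × UnitAddTorus (Fin n) → ℝ} {ρ₀ : UnitAddTorus (Fin n) → ℝ}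
  {ρ f : ℝ × UnitAddTorus (Fin n) → ℝ}
  {G F : ℝ × UnitAddTorus (Fin n) → EuclideanSpace ℝ (Fin n)}
  {u f' : ℕ → ℝ × UnitAddTorus (Fin n) → ℝ} {F' : ℕ → Fin n → ℝ × UnitAddTorus (Fin n) → ℝ}

theorem tendsto_primitive_sinTrunc {g β : ℝ → ℝ} (hg : Continuous g)
    (hβ : ∀ s, HasDerivAt β (g s) s) (s : ℝ) :
    Tendsto (fun j => β 0 + ∫ x in 0..s, sinTrunc j (g x)) atTop (𝓝 (β s)) := by
  have h1 : ∫ x in 0..s, g x = β s - β 0 :=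
    intervalIntegral.integral_eq_sub_of_hasDerivAt (fun x _ => hβ x) (hg.intervalIntegrable _ _)
  have h2 := intervalIntegral.tendsto_integral_filter_of_dominated_convergence (μ := volume)
    (a := 0) (b := s) (l := atTop) (F := fun j x => sinTrunc j (g x)) (f := g) (fun x => |g x|)
    (Eventually.of_forall fun j => ((contDiff_sinTrunc j).continuous.comp hg).aestronglyMeasurable)
    (Eventually.of_forall fun j => Eventually.of_forall fun x _ => abs_sinTrunc_le_abs j (g x))
    (hg.abs.intervalIntegrable _ _) (Eventually.of_forall fun x _ => tendsto_sinTrunc (g x))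
  have h3 := h2.const_add (β 0)
  rwa [h1, add_sub_cancel] at h3

/-- The function `g` is truncated to `sinTrunc j ∘ g`, and `β` is replaced by the primitive with the
same value at `0`. The linear growth of `g` gives a majorant common to all `j`, its last term being
a multiple of `|d| (1 + ρ²)`. -/
theorem IsDriftData.energy_identity (h : IsDriftData T b d ρ₀ ρ G f F u f' F')
    {g β : ℝ → ℝ} (hg : ContDiff ℝ ∞ g) {L : ℝ} (hL : ∀ s, |deriv g s| ≤ L)
    (hβ : ∀ s, HasDerivAt β (g s) s) {η : ℝ → ℝ}
    (hη : IsInteriorTest T fun z : ℝ × UnitAddTorus (Fin n) => η z.1) :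
    ∫ z, η z.1 * energyDensity d ρ f G F g β z ∂(parabolicCylinder n T) = 0 := by
  obtain ⟨C, hC0, hC⟩ := hη.exists_bound
  have hL0 : 0 ≤ L := (abs_nonneg _).trans (hL 0)
  have hgd : Differentiable ℝ g := hg.differentiable (by simp)
  obtain ⟨i1, i2, i3, i4, -⟩ := h.integrable_energyDensity hg hL hβ
  set gj : ℕ → ℝ → ℝ := fun j s => sinTrunc j (g s) with hgj
  set βj : ℕ → ℝ → ℝ := fun j s => β 0 + ∫ x in 0..s, gj j x with hβj
  have hgjs : ∀ j, ContDiff ℝ ∞ (gj j) := fun j => (contDiff_sinTrunc j).comp hg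
  have hder : ∀ j s, deriv (gj j) s = Real.cos (g s / ((j : ℝ) + 1)) * deriv g s := fun j s =>
    ((hasDerivAt_sinTrunc j (g s)).comp s (hgd s).hasDerivAt).deriv
  have hder2 : ∀ j s, |deriv (gj j) s| ≤ |deriv g s| := fun j s => by
    rw [hder, abs_mul]
    exact mul_le_of_le_one_left (abs_nonneg _) (Real.abs_cos_le_one _)
  have hβd : ∀ j s, HasDerivAt (βj j) (gj j s) s := fun j s =>
    ((hgjs j).continuous.integral_hasStrictDerivAt 0 s).hasDerivAt.const_add _
  have hgl : ∀ s, |g s| ≤ |g 0| + L * |s| := abs_le_of_deriv_le hgd hL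
  have h0 := fun j => h.energy_identity_of_bounded (hgjs j) (fun s => abs_sinTrunc_le j (g s))
    (fun s => (hder2 j s).trans (hL s)) (hβd j) hη
  set K := |β 0| + 2 * |g 0| + 2 * L
  set S : ℝ × UnitAddTorus (Fin n) → ℝ := fun z => C * (|g (ρ z) * f z| +
    ∑ i, |deriv g (ρ z) * G z i * F z i| + ∑ i, |deriv g (ρ z) * G z i * G z i| +
    K * |d z * (1 + ρ z ^ 2)|) with hS
  have hSi : Integrable S (parabolicCylinder n T) :=
    (((i1.abs.add (integrable_finsetSum _ fun i _ => (i2 i).abs)).add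
      (integrable_finsetSum _ fun i _ => (i3 i).abs)).add
      (h.integrable_div.abs.const_mul K)).const_mul C
  refine tendsto_nhds_unique (tendsto_integral_of_dominated_convergence S (fun j => ?_) hSi
    (fun j => Eventually.of_forall fun z => ?_) (Eventually.of_forall fun z => ?_))
    (tendsto_const_nhds.congr fun j => (h0 j).symm)
  · exact hη.1.continuous.aestronglyMeasurable.mul (h.integrable_energyDensity (hgjs j)
      (fun s => (hder2 j s).trans (hL s)) (hβd j)).2.2.2.2.1
  · rw [norm_mul]
    refine mul_le_mul (hC z) ?_ (norm_nonneg _) hC0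
    rw [energyDensity, Real.norm_eq_abs]
    refine (abs_add_le _ _).trans (add_le_add ((abs_add_le _ _).trans (add_le_add
      ((abs_sub _ _).trans (add_le_add ?_ ((Finset.abs_sum_le_sum_abs _ _).trans
        (Finset.sum_le_sum fun i _ => ?_)))) ((Finset.abs_sum_le_sum_abs _ _).trans
        (Finset.sum_le_sum fun i _ => ?_)))) ?_)
    · rw [abs_mul, abs_mul]
      exact mul_le_mul_of_nonneg_right (abs_sinTrunc_le_abs j _) (abs_nonneg _)
    · rw [mul_assoc, mul_assoc, abs_mul, abs_mul (deriv g _)]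
      exact mul_le_mul_of_nonneg_right (hder2 j _) (abs_nonneg _)
    · rw [mul_assoc, mul_assoc, abs_mul, abs_mul (deriv g _)]
      exact mul_le_mul_of_nonneg_right (hder2 j _) (abs_nonneg _)
    · have h1 := abs_mul_sub_primitive_le (hβd j) (abs_nonneg (g 0)) hL0
        (fun s => (abs_sinTrunc_le_abs j (g s)).trans (hgl s)) (B := |β 0|) (by simp [hβj]) (ρ z)
      rw [abs_mul, abs_mul, abs_of_nonneg (by positivity : 0 ≤ 1 + ρ z ^ 2), mul_comm |d z|,
        ← mul_assoc]
      exact mul_le_mul_of_nonneg_right h1 (abs_nonneg _)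
  · refine Tendsto.const_mul _ ?_
    have hgt : Tendsto (fun j => gj j (ρ z)) atTop (𝓝 (g (ρ z))) := tendsto_sinTrunc _
    have hdt : Tendsto (fun j => deriv (gj j) (ρ z)) atTop (𝓝 (deriv g (ρ z))) := by
      simp only [hder]
      simpa using (tendsto_cos_div (g (ρ z))).mul_const (deriv g (ρ z))
    exact (((hgt.mul_const _).sub (tendsto_finsetSum _ fun i _ => (hdt.mul_const _).mul_const _)).add
      (tendsto_finsetSum _ fun i _ => (hdt.mul_const _).mul_const _)).add
      (((hgt.const_mul _).sub (tendsto_primitive_sinTrunc hg.continuous hβ _)).mul_const _)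

theorem isInteriorTest_of_tsupport_subset {η : ℝ → ℝ} (hη : ContDiff ℝ ∞ η) (hc : HasCompactSupport η)
    (hs : tsupport η ⊆ Ioo 0 T) (hT : 0 < T) :
    IsInteriorTest T fun z : ℝ × UnitAddTorus (Fin n) => η z.1 := by
  refine ⟨isSmooth_time hη, ?_⟩
  rcases (tsupport η).eq_empty_or_nonempty with h0 | h0
  · refine ⟨T / 2, T / 2, by linarith, by linarith, fun t x _ => ?_⟩
    exact image_eq_zero_of_notMem_tsupport (by simp [h0])
  · have hc' : IsCompact (tsupport η) := hc
    refine ⟨sInf (tsupport η), sSup (tsupport η), (hs (hc'.sInf_mem h0)).1,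
      (hs (hc'.sSup_mem h0)).2, fun t x ht => image_eq_zero_of_notMem_tsupport fun hmem => ?_⟩
    rcases ht with ht | ht
    · exact absurd (csInf_le hc'.bddBelow hmem) (not_le.2 ht)
    · exact absurd (le_csSup hc'.bddAbove hmem) (not_le.2 ht)

/-- An integrable function on the cylinder which is orthogonal to all functions of time has
vanishing integrals on almost all slices. -/
theorem ae_integral_slice_eq_zero (hT : 0 < T) {e : ℝ × UnitAddTorus (Fin n) → ℝ}
    (he : Integrable e (parabolicCylinder n T))
    (h : ∀ η : ℝ → ℝ, (IsInteriorTest T fun z : ℝ × UnitAddTorus (Fin n) => η z.1) →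
      ∫ z, η z.1 * e z ∂(parabolicCylinder n T) = 0) :
    ∀ᵐ t ∂(volume.restrict (Ioo 0 T)), ∫ x, e (t, x) = 0 := by
  have hi : Integrable (fun t => ∫ x, e (t, x)) (volume.restrict (Ioo 0 T)) := he.integral_prod_left
  rw [ae_restrict_iff' measurableSet_Ioo]
  refine isOpen_Ioo.ae_eq_zero_of_integral_contDiff_smul_eq_zero
    (IntegrableOn.locallyIntegrableOn hi) fun η hη hc hs => ?_
  have h1 := h η (isInteriorTest_of_tsupport_subset hη hc hs hT)
  have hm : Integrable (fun z : ℝ × UnitAddTorus (Fin n) => η z.1 * e z) (parabolicCylinder n T) :=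
    (integrable_mul_continuous he (hη.continuous.comp continuous_fst)).congr
      (Eventually.of_forall fun z => mul_comm _ _)
  rw [parabolicCylinder, integral_prod _ hm] at h1
  simp only [integral_const_mul] at h1
  rw [← h1]
  refine (setIntegral_eq_integral_of_forall_compl_eq_zero fun t ht => ?_).symm
  rw [image_eq_zero_of_notMem_tsupport fun hmem => ht (hs hmem), zero_smul]

/-- The spatial dissipation and drift terms in the energy identity at a fixed time. -/
noncomputable def energyRate (d ρ : ℝ × UnitAddTorus (Fin n) → ℝ)
    (G : ℝ × UnitAddTorus (Fin n) → EuclideanSpace ℝ (Fin n)) (g β : ℝ → ℝ) (t : ℝ) : ℝ :=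
  -∫ x, (∑ i, deriv g (ρ (t, x)) * G (t, x) i * G (t, x) i +
    (ρ (t, x) * g (ρ (t, x)) - β (ρ (t, x))) * d (t, x))

/-- The integrand of the chain rule is `energyDensity` minus dissipation and drift. The former
integrates to zero on almost every slice, so the auxiliary `f` and `F` drop out. -/
theorem IsDriftData.ae_energy_eq (h : IsDriftData T b d ρ₀ ρ G f F u f' F') (hT : 0 < T)
    {g β : ℝ → ℝ} (hg : ContDiff ℝ ∞ g) {L : ℝ} (hL : ∀ s, |deriv g s| ≤ L)
    (hβ : ∀ s, HasDerivAt β (g s) s) :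
    IntegrableOn (energyRate d ρ G g β) (Ioo 0 T) ∧
    ∀ᵐ t ∂(volume.restrict (Ioo 0 T)), Integrable (fun x => β (ρ (t, x))) volume ∧
      (∫ x, β (ρ (t, x))) - ∫ x, β (ρ₀ x) = ∫ s in 0..t, energyRate d ρ G g β s := by
  have hL0 : 0 ≤ L := (abs_nonneg _).trans (hL 0)
  obtain ⟨i1, i2, i3, i4, i5⟩ := h.integrable_energyDensity hg hL hβ
  set R : ℝ × UnitAddTorus (Fin n) → ℝ := fun z => ∑ i, deriv g (ρ z) * G z i * G z i +
    (ρ z * g (ρ z) - β (ρ z)) * d z with hR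
  have hRi : Integrable R (parabolicCylinder n T) := (integrable_finsetSum _ fun i _ => i3 i).add i4
  have hrate : IntegrableOn (energyRate d ρ G g β) (Ioo 0 T) := hRi.integral_prod_left.neg
  refine ⟨hrate, ?_⟩
  have h0 := ae_integral_slice_eq_zero hT i5 fun η hη => h.energy_identity hg hL hβ hη
  filter_upwards [h.approx.ae_integral_comp_sub hg (L := ⟨L, hL0⟩) (fun s => hL s) hβ,
    ae_restrict_mem measurableSet_Ioo] with t ⟨ht1, ht⟩ htT
  refine ⟨ht1, ht.trans ?_⟩
  have hle := parabolicCylinder_mono (n := n) htT.2.le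
  have e1 : ∀ z, g (ρ z) * f z - deriv g (ρ z) * inner ℝ (F z) (G z) =
      energyDensity d ρ f G F g β z - R z := fun z => by
    simp only [energyDensity, hR, PiLp.inner_apply, RCLike.inner_apply, conj_trivial,
      Finset.mul_sum, mul_assoc]
    ring
  simp only [e1]
  rw [integral_sub (i5.mono_measure hle) (hRi.mono_measure hle)]
  have hsub : Ioo 0 t ⊆ Ioo 0 T := Ioo_subset_Ioo_right htT.2.le
  have e2 : ∫ z, energyDensity d ρ f G F g β z ∂(parabolicCylinder n t) = 0 := by
    rw [parabolicCylinder, integral_prod _ (i5.mono_measure hle)]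
    exact integral_eq_zero_of_ae (ae_restrict_of_ae_restrict_of_subset hsub h0)
  rw [e2, zero_sub, parabolicCylinder, integral_prod _ (hRi.mono_measure hle),
    intervalIntegral.integral_of_le htT.1.le, integral_Ioc_eq_integral_Ioo, ← integral_neg]
  rfl

end

/-! ### Regularized and truncated powers -/

section PowerTruncation

/-- Admissible parameters for the regularized powers: `m` is half the exponent minus one, `δ`
regularizes the origin, `κ` truncates at infinity. -/
structure IsPowerParam (m δ κ : ℝ) : Prop where
  exponent : -(1 / 2) < m
  pos : 0 < δ
  nonneg : 0 ≤ κ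
  cases : (0 ≤ m ∧ 0 < κ) ∨ (m < 0 ∧ κ = 0)

/-- The regularization `s² + δ²` of the square. -/
def regSq (δ s : ℝ) : ℝ := s ^ 2 + δ ^ 2

/-- The truncation factor `1 / (1 + κ (s² + δ²))`. -/
noncomputable def truncFactor (δ κ s : ℝ) : ℝ := (1 + κ * regSq δ s)⁻¹

/-- The truncation of `(s² + δ²) ^ m`. -/
noncomputable def truncPow (m δ κ s : ℝ) : ℝ := (regSq δ s * truncFactor δ κ s) ^ m

/-- The truncation of `(s² + δ²) ^ (m + 1)`, of quadratic growth. -/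
noncomputable def powPrimitive (m δ κ s : ℝ) : ℝ := regSq δ s * truncPow m δ κ s

/-- The derivative of `powPrimitive`. -/
noncomputable def powDeriv (m δ κ s : ℝ) : ℝ :=
  2 * s * (truncPow m δ κ s * (1 + m * truncFactor δ κ s))

variable {m δ κ : ℝ}

theorem regSq_pos (h : IsPowerParam m δ κ) (s : ℝ) : 0 < regSq δ s := by
  have := h.pos
  unfold regSq
  positivity

theorem one_add_mul_regSq_pos (h : IsPowerParam m δ κ) (s : ℝ) : 0 < 1 + κ * regSq δ s := by
  have := regSq_pos h s
  have := h.nonneg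
  positivity

theorem truncFactor_pos (h : IsPowerParam m δ κ) (s : ℝ) : 0 < truncFactor δ κ s :=
  inv_pos.2 (one_add_mul_regSq_pos h s)

theorem truncFactor_le_one (h : IsPowerParam m δ κ) (s : ℝ) : truncFactor δ κ s ≤ 1 := by
  have := regSq_pos h s
  have := h.nonneg
  exact inv_le_one_of_one_le₀ (by nlinarith)

theorem truncPow_pos (h : IsPowerParam m δ κ) (s : ℝ) : 0 < truncPow m δ κ s :=
  Real.rpow_pos_of_pos (mul_pos (regSq_pos h s) (truncFactor_pos h s)) m

theorem powPrimitive_pos (h : IsPowerParam m δ κ) (s : ℝ) : 0 < powPrimitive m δ κ s :=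
  mul_pos (regSq_pos h s) (truncPow_pos h s)

theorem contDiff_regSq (δ : ℝ) : ContDiff ℝ ∞ (regSq δ) := by
  unfold regSq
  fun_prop

theorem contDiff_truncFactor (h : IsPowerParam m δ κ) : ContDiff ℝ ∞ (truncFactor δ κ) :=
  (contDiff_const.add (contDiff_const.mul (contDiff_regSq δ))).inv fun s =>
    (one_add_mul_regSq_pos h s).ne'

theorem contDiff_truncPow (h : IsPowerParam m δ κ) : ContDiff ℝ ∞ (truncPow m δ κ) :=
  ((contDiff_regSq δ).mul (contDiff_truncFactor h)).rpow_const_of_ne fun s =>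
    (mul_pos (regSq_pos h s) (truncFactor_pos h s)).ne'

theorem contDiff_powDeriv (h : IsPowerParam m δ κ) : ContDiff ℝ ∞ (powDeriv m δ κ) :=
  (contDiff_const.mul contDiff_id).mul
    ((contDiff_truncPow h).mul (contDiff_const.add (contDiff_const.mul (contDiff_truncFactor h))))

theorem hasDerivAt_regSq (δ s : ℝ) : HasDerivAt (regSq δ) (2 * s) s := by
  have := (hasDerivAt_pow 2 s).add_const (δ ^ 2)
  exact this.congr_deriv (by norm_num)

theorem hasDerivAt_truncFactor (h : IsPowerParam m δ κ) (s : ℝ) :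
    HasDerivAt (truncFactor δ κ) (-(2 * s * κ * truncFactor δ κ s ^ 2)) s := by
  have h1 := (((hasDerivAt_regSq δ s).const_mul κ).const_add 1).inv
    ((one_add_mul_regSq_pos h s).ne')
  refine h1.congr_deriv ?_
  rw [truncFactor, inv_pow]
  ring

theorem mul_regSq_mul_truncFactor (h : IsPowerParam m δ κ) (s : ℝ) :
    κ * regSq δ s * truncFactor δ κ s = 1 - truncFactor δ κ s := by
  have h1 : (1 + κ * regSq δ s) * truncFactor δ κ s = 1 :=
    mul_inv_cancel₀ ((one_add_mul_regSq_pos h s).ne')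
  linarith

theorem hasDerivAt_truncPow (h : IsPowerParam m δ κ) (s : ℝ) :
    HasDerivAt (truncPow m δ κ)
      (2 * s * m * truncPow m δ κ s * truncFactor δ κ s / regSq δ s) s := by
  have hA := regSq_pos h s
  have hl := truncFactor_pos h s
  have h1 := ((hasDerivAt_regSq δ s).mul (hasDerivAt_truncFactor h s)).rpow_const (p := m)
    (Or.inl (mul_pos hA hl).ne')
  refine h1.congr_deriv ?_
  simp only [Pi.mul_apply]
  rw [Real.rpow_sub_one (mul_pos hA hl).ne', ← truncPow]
  have h2 := mul_regSq_mul_truncFactor h s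
  -- The derivative of `regSq * truncFactor` simplifies to `2 s l²`, with `l` the truncation factor,
  -- since `κ (s² + δ²) l = 1 - l`.
  have h3 : 2 * s * truncFactor δ κ s + regSq δ s * -(2 * s * κ * truncFactor δ κ s ^ 2) =
      2 * s * truncFactor δ κ s ^ 2 := by linear_combination -2 * s * truncFactor δ κ s * h2
  rw [h3]
  field_simp

theorem hasDerivAt_powPrimitive (h : IsPowerParam m δ κ) (s : ℝ) :
    HasDerivAt (powPrimitive m δ κ) (powDeriv m δ κ s) s := by
  refine ((hasDerivAt_regSq δ s).mul (hasDerivAt_truncPow h s)).congr_deriv ?_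
  have hA := regSq_pos h s
  rw [powDeriv]
  field_simp

theorem deriv_powDeriv (h : IsPowerParam m δ κ) (s : ℝ) :
    deriv (powDeriv m δ κ) s = truncPow m δ κ s * (2 * (1 + m * truncFactor δ κ s) +
      4 * (s ^ 2 / regSq δ s) * (m * (m + 1)) * truncFactor δ κ s ^ 2) := by
  have hA := regSq_pos h s
  have h1 := ((hasDerivAt_id s).const_mul 2).mul ((hasDerivAt_truncPow h s).mul
    (((hasDerivAt_truncFactor h s).const_mul m).const_add 1))
  refine (HasDerivAt.congr_deriv h1 ?_).deriv
  have h2 := mul_regSq_mul_truncFactor h s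
  simp only [id, Pi.mul_apply]
  field_simp
  linear_combination -4 * s ^ 2 * m * truncPow m δ κ s * truncFactor δ κ s * h2

theorem sq_div_regSq_mem (h : IsPowerParam m δ κ) (s : ℝ) : s ^ 2 / regSq δ s ∈ Icc (0 : ℝ) 1 := by
  have hA := regSq_pos h s
  refine ⟨by positivity, (div_le_one hA).2 ?_⟩
  unfold regSq
  nlinarith [sq_nonneg δ]

/-- The ellipticity constant of the regularized powers. -/
noncomputable def powEllipticity (m : ℝ) : ℝ := min 2 (2 * (1 + m) * (1 + 2 * m))

theorem powEllipticity_pos (hm : -(1 / 2) < m) : 0 < powEllipticity m :=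
  lt_min two_pos (by
    have h1 : 0 < 1 + m := by linarith
    have h2 : 0 < 1 + 2 * m := by linarith
    positivity)

/-- For `m ≥ 0` the terms with `m` are nonnegative. For `m < 0` the worst case is `s² / regSq =
truncFactor = 1`, where the bracket equals `2(1+m)(1+2m) = P(P-1)` with `P = 2(m+1)`; hence the
restriction to `P > 1`. -/
theorem powEllipticity_mul_le_deriv (h : IsPowerParam m δ κ) (s : ℝ) :
    powEllipticity m * truncPow m δ κ s ≤ deriv (powDeriv m δ κ) s := by
  rw [deriv_powDeriv h, mul_comm]
  refine mul_le_mul_of_nonneg_left ?_ (truncPow_pos h s).le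
  obtain ⟨hx0, hx1⟩ := sq_div_regSq_mem h s
  have hl0 := truncFactor_pos h s
  have hl1 := truncFactor_le_one h s
  have hm := h.exponent
  set x := s ^ 2 / regSq δ s
  set l := truncFactor δ κ s
  rcases le_or_gt 0 m with hm0 | hm0
  · refine (min_le_left _ _).trans ?_
    have h1 : 0 ≤ m * l := by positivity
    have h2 : 0 ≤ 4 * x * (m * (m + 1)) * l ^ 2 := by positivity
    linarith
  · refine (min_le_right _ _).trans ?_
    have h1 : x * l ^ 2 ≤ 1 := by nlinarith
    have h2 : 0 ≤ -m * (m + 1) := by nlinarith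
    nlinarith [mul_le_mul_of_nonneg_left h1 h2]

/-- For `m ≥ 0` growth at infinity is stopped by `κ`, and for `m < 0` the singularity at the origin
is removed by `δ`. In the second case no truncation is needed, and a positive `κ` would destroy the
upper bound `truncPow_le_rpow`. -/
theorem exists_truncPow_le (h : IsPowerParam m δ κ) : ∃ B : ℝ, 0 ≤ B ∧ ∀ s, truncPow m δ κ s ≤ B := by
  rcases h.cases with ⟨hm, hκ⟩ | ⟨hm, hκ⟩
  · refine ⟨(1 / κ) ^ m, by positivity, fun s => ?_⟩
    have hA := regSq_pos h s
    have hl := truncFactor_pos h s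
    refine Real.rpow_le_rpow (by positivity) ?_ hm
    rw [le_div_iff₀ hκ]
    linarith [mul_regSq_mul_truncFactor h s]
  · have hδ := h.pos
    refine ⟨(δ ^ 2) ^ m, by positivity, fun s => ?_⟩
    refine Real.rpow_le_rpow_of_nonpos (by positivity) ?_ hm.le
    simp only [truncFactor, regSq, hκ, zero_mul, add_zero, inv_one, mul_one]
    nlinarith [sq_nonneg s]

theorem truncPow_le_rpow (h : IsPowerParam m δ κ) (s : ℝ) : truncPow m δ κ s ≤ regSq δ s ^ m := by
  have hA := regSq_pos h s
  have hl := truncFactor_pos h s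
  rcases h.cases with ⟨hm, -⟩ | ⟨-, hκ⟩
  · exact Real.rpow_le_rpow (by positivity) (mul_le_of_le_one_right hA.le (truncFactor_le_one h s)) hm
  · simp [truncPow, truncFactor, hκ]

theorem powPrimitive_le (h : IsPowerParam m δ κ) (s : ℝ) :
    powPrimitive m δ κ s ≤ regSq δ s ^ (m + 1) := by
  have hA := regSq_pos h s
  rw [Real.rpow_add_one hA.ne', mul_comm (regSq δ s ^ m)]
  exact mul_le_mul_of_nonneg_left (truncPow_le_rpow h s) hA.le

theorem abs_one_add_mul_truncFactor_le (h : IsPowerParam m δ κ) (s : ℝ) :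
    |1 + m * truncFactor δ κ s| ≤ 1 + |m| := by
  have hl0 := truncFactor_pos h s
  have hl1 := truncFactor_le_one h s
  refine (abs_add_le _ _).trans ?_
  rw [abs_one, abs_mul, abs_of_pos hl0]
  nlinarith [abs_nonneg m]

theorem exists_abs_deriv_powDeriv_le (h : IsPowerParam m δ κ) :
    ∃ L : ℝ, ∀ s, |deriv (powDeriv m δ κ) s| ≤ L := by
  obtain ⟨B, hB0, hB⟩ := exists_truncPow_le h
  refine ⟨B * (2 * (1 + |m|) + 4 * |m * (m + 1)|), fun s => ?_⟩
  rw [deriv_powDeriv h, abs_mul, abs_of_pos (truncPow_pos h s)]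
  refine mul_le_mul (hB s) ((abs_add_le _ _).trans (add_le_add ?_ ?_)) (abs_nonneg _) hB0
  · rw [abs_mul, abs_two]
    exact mul_le_mul_of_nonneg_left (abs_one_add_mul_truncFactor_le h s) zero_le_two
  · obtain ⟨hx0, hx1⟩ := sq_div_regSq_mem h s
    have hl0 := truncFactor_pos h s
    have hl1 := truncFactor_le_one h s
    rw [abs_mul, abs_mul, abs_of_nonneg (by positivity : 0 ≤ 4 * (s ^ 2 / regSq δ s)),
      abs_of_nonneg (sq_nonneg (truncFactor δ κ s))]
    have h1 : s ^ 2 / regSq δ s * truncFactor δ κ s ^ 2 ≤ 1 := by nlinarith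
    nlinarith [mul_le_mul_of_nonneg_left h1 (abs_nonneg (m * (m + 1)))]

theorem abs_mul_powDeriv_sub_le (h : IsPowerParam m δ κ) (s : ℝ) :
    |s * powDeriv m δ κ s - powPrimitive m δ κ s| ≤ (3 + 2 * |m|) * powPrimitive m δ κ s := by
  have hA := regSq_pos h s
  have hP := truncPow_pos h s
  have e : s * powDeriv m δ κ s - powPrimitive m δ κ s =
      truncPow m δ κ s * (2 * s ^ 2 * (1 + m * truncFactor δ κ s) - regSq δ s) := by
    rw [powDeriv, powPrimitive]
    ring
  have e2 : (3 + 2 * |m|) * powPrimitive m δ κ s =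
      truncPow m δ κ s * ((2 * (1 + |m|) + 1) * regSq δ s) := by
    rw [powPrimitive]
    ring
  rw [e, e2, abs_mul, abs_of_pos hP]
  refine mul_le_mul_of_nonneg_left ((abs_sub _ _).trans ?_) hP.le
  have h1 : s ^ 2 ≤ regSq δ s := by unfold regSq; nlinarith [sq_nonneg δ]
  rw [abs_mul, abs_of_pos hA, abs_of_nonneg (by positivity : 0 ≤ 2 * s ^ 2)]
  have h2 : 2 * s ^ 2 * |1 + m * truncFactor δ κ s| ≤ 2 * regSq δ s * (1 + |m|) :=
    mul_le_mul (by linarith) (abs_one_add_mul_truncFactor_le h s) (abs_nonneg _) (by positivity)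
  linarith

/-- The square root of `powPrimitive`. -/
noncomputable def powRoot (m δ κ s : ℝ) : ℝ := √(powPrimitive m δ κ s)

theorem powRoot_mul_self (h : IsPowerParam m δ κ) (s : ℝ) :
    powRoot m δ κ s * powRoot m δ κ s = powPrimitive m δ κ s :=
  Real.mul_self_sqrt (powPrimitive_pos h s).le

/-- The derivative of `powRoot`. -/
noncomputable def powRootDeriv (m δ κ s : ℝ) : ℝ := powDeriv m δ κ s / (2 * powRoot m δ κ s)

theorem hasDerivAt_powRoot (h : IsPowerParam m δ κ) (s : ℝ) :
    HasDerivAt (powRoot m δ κ) (powRootDeriv m δ κ s) s :=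
  (hasDerivAt_powPrimitive h s).sqrt (powPrimitive_pos h s).ne'

theorem continuous_powRootDeriv (h : IsPowerParam m δ κ) : Continuous (powRootDeriv m δ κ) := by
  have hβ : Continuous (powPrimitive m δ κ) :=
    continuous_iff_continuousAt.2 fun s => (hasDerivAt_powPrimitive h s).continuousAt
  exact (contDiff_powDeriv h).continuous.div (continuous_const.mul hβ.sqrt) fun s =>
    (mul_pos two_pos (Real.sqrt_pos.2 (powPrimitive_pos h s))).ne'

/-- The quotient `β'²/(4β)` reduces to `s² / regSq` times `(1 + m l)²` times `truncPow`, where `l`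
is the truncation factor, so neither `δ` nor `κ` enters the constant. -/
theorem powRootDeriv_mul_self_le (h : IsPowerParam m δ κ) (s : ℝ) :
    powRootDeriv m δ κ s * powRootDeriv m δ κ s ≤ (1 + |m|) ^ 2 * truncPow m δ κ s := by
  have hA := regSq_pos h s
  have hP := truncPow_pos h s
  obtain ⟨hx0, hx1⟩ := sq_div_regSq_mem h s
  have e : powRootDeriv m δ κ s * powRootDeriv m δ κ s =
      (s ^ 2 / regSq δ s) * |1 + m * truncFactor δ κ s| ^ 2 * truncPow m δ κ s := by
    rw [powRootDeriv, div_mul_div_comm, mul_mul_mul_comm, powRoot_mul_self h, sq_abs, powDeriv,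
      powPrimitive]
    field_simp
  rw [e]
  refine mul_le_mul_of_nonneg_right ?_ hP.le
  have h2 := pow_le_pow_left₀ (abs_nonneg _) (abs_one_add_mul_truncFactor_le h s) 2
  exact (mul_le_of_le_one_left (by positivity) hx1).trans h2

theorem exists_abs_powRootDeriv_le (h : IsPowerParam m δ κ) :
    ∃ L : ℝ≥0, ∀ s, |powRootDeriv m δ κ s| ≤ L := by
  obtain ⟨B, hB0, hB⟩ := exists_truncPow_le h
  refine ⟨⟨√((1 + |m|) ^ 2 * B), Real.sqrt_nonneg _⟩, fun s => Real.abs_le_sqrt ?_⟩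
  rw [sq]
  exact (powRootDeriv_mul_self_le h s).trans (mul_le_mul_of_nonneg_left (hB s) (by positivity))

/-- Multiplied by `|Dρ|²`, this says that the dissipation controls the gradient of `√β(ρ)`,
uniformly in `δ` and `κ`. -/
theorem powRootDeriv_mul_self_le_deriv (h : IsPowerParam m δ κ) (s : ℝ) :
    powRootDeriv m δ κ s * powRootDeriv m δ κ s ≤
      (1 + |m|) ^ 2 / powEllipticity m * deriv (powDeriv m δ κ) s := by
  have hc := powEllipticity_pos h.exponent
  refine (powRootDeriv_mul_self_le h s).trans ?_
  rw [div_mul_eq_mul_div, le_div_iff₀ hc, mul_assoc, mul_comm (truncPow m δ κ s)]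
  exact mul_le_mul_of_nonneg_left (powEllipticity_mul_le_deriv h s) (by positivity)

end PowerTruncation

/-! ### Absolutely continuous functions and damped Gronwall -/

section Gronwall

open AbsolutelyContinuousOnInterval in
theorem LipschitzOnWith.comp_absolutelyContinuousOnInterval {f g : ℝ → ℝ} {K : ℝ≥0} {s : Set ℝ}
    {a b : ℝ} (hg : LipschitzOnWith K g s) (hf : AbsolutelyContinuousOnInterval f a b)
    (hs : MapsTo f (uIcc a b) s) : AbsolutelyContinuousOnInterval (fun x => g (f x)) a b := by
  rw [absolutelyContinuousOnInterval_iff] at hf ⊢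
  intro ε hε
  obtain ⟨δ, hδ, h⟩ := hf (ε / (K + 1)) (by positivity)
  refine ⟨δ, hδ, fun E hE hlt => ?_⟩
  have h1 := h E hE hlt
  rw [lt_div_iff₀ (by positivity), Finset.sum_mul] at h1
  refine (Finset.sum_le_sum fun i hi => ?_).trans_lt h1
  have h2 := hg.dist_le_mul _ (hs (hE.1 i hi).1) _ (hs (hE.1 i hi).2)
  nlinarith [dist_nonneg (x := f (E.2 i).1) (y := f (E.2 i).2)]

theorem AbsolutelyContinuousOnInterval.exp {f : ℝ → ℝ} {a b : ℝ}
    (hf : AbsolutelyContinuousOnInterval f a b) :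
    AbsolutelyContinuousOnInterval (fun x => Real.exp (f x)) a b := by
  obtain ⟨C, hC⟩ := hf.exists_bound
  obtain ⟨K, hK⟩ := (Real.contDiff_exp (n := 1)).contDiffOn.exists_lipschitzOnWith (by decide)
    (convex_Icc (-C) C) isCompact_Icc
  exact hK.comp_absolutelyContinuousOnInterval hf fun x hx => abs_le.1 (hC x hx)

/-- An absolutely continuous function with nonpositive derivative decreases. -/
theorem AbsolutelyContinuousOnInterval.le_of_ae_hasDerivAt_nonpos {f f' : ℝ → ℝ} {a b : ℝ}
    (hf : AbsolutelyContinuousOnInterval f a b) (hab : a ≤ b)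
    (hd : ∀ᵐ x ∂(volume.restrict (Ioo a b)), HasDerivAt f (f' x) x ∧ f' x ≤ 0) : f b ≤ f a := by
  have h1 := hf.integral_deriv_eq_sub
  have h2 : ∫ x in a..b, deriv f x ≤ 0 := by
    rw [intervalIntegral.integral_of_le hab, integral_Ioc_eq_integral_Ioo]
    refine integral_nonpos_of_ae ?_
    filter_upwards [hd] with x hx
    rw [hx.1.deriv]
    exact hx.2
  linarith

/-- Gronwall's inequality with damping: the bound does not depend on the length of the interval. -/
theorem ae_le_of_rate_le {T A C c B Y₀ : ℝ} {φ a Y : ℝ → ℝ} (hφ : IntegrableOn φ (Ioo 0 T))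
    (ha : IntegrableOn a (Ioo 0 T)) (ha0 : ∀ t, 0 ≤ a t) (hA : ∫ t in Ioo 0 T, a t ≤ A)
    (hC : 0 ≤ C) (hc : 0 < c) (hB : 0 ≤ B) (hY₀ : 0 ≤ Y₀)
    (hY : ∀ᵐ t ∂(volume.restrict (Ioo 0 T)), Y t - Y₀ = ∫ s in 0..t, φ s)
    (hr : ∀ᵐ t ∂(volume.restrict (Ioo 0 T)), φ t ≤ C * a t * Y t - c * Y t + B) :
    ∀ᵐ t ∂(volume.restrict (Ioo 0 T)), Y t ≤ Real.exp (C * A) * (Y₀ + B / c) := by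
  filter_upwards [hY, ae_restrict_mem measurableSet_Ioo] with t ht htm
  have hsub : Ioo 0 t ⊆ Ioo 0 T := Ioo_subset_Ioo_right htm.2.le
  have hii : ∀ {h : ℝ → ℝ}, IntegrableOn h (Ioo 0 T) → IntervalIntegrable h volume 0 t := fun hh =>
    (intervalIntegrable_iff_integrableOn_Ioo_of_le htm.1.le).2 (hh.mono_set hsub)
  have hφi := hii hφ
  have hai := hii ha
  set K : ℝ → ℝ := fun s => c * s - C * ∫ x in 0..s, a x with hK
  set X : ℝ → ℝ := fun s => Y₀ + ∫ x in 0..s, φ x with hX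
  have hid : ∀ k : ℝ, AbsolutelyContinuousOnInterval (fun s : ℝ => k * s) 0 t := fun k =>
    (contDiff_const.mul contDiff_id).contDiffOn.absolutelyContinuousOnInterval
  have hconst : AbsolutelyContinuousOnInterval (fun _ : ℝ => Y₀) 0 t :=
    contDiff_const.contDiffOn.absolutelyContinuousOnInterval
  have hKac : AbsolutelyContinuousOnInterval K 0 t := (hid c).sub
    ((hai.absolutelyContinuousOnInterval_intervalIntegral left_mem_uIcc).const_mul C)
  have hXac : AbsolutelyContinuousOnInterval X 0 t :=
    hconst.add (hφi.absolutelyContinuousOnInterval_intervalIntegral left_mem_uIcc)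
  -- The decreasing quantity is `exp K * X - (B/c) exp (c s)`, where `X` is the absolutely
  -- continuous representative of `Y`. Its derivative is at most `B (exp K - exp (c s))`, which is
  -- nonpositive because `a ≥ 0` gives `K ≤ c s`.
  have hZac := (hKac.exp.mul hXac).sub ((hid c).exp.const_mul (B / c))
  have hint : 0 ≤ ∫ x in 0..t, a x := intervalIntegral.integral_nonneg htm.1.le fun x _ => ha0 x
  have key := hZac.le_of_ae_hasDerivAt_nonpos htm.1.le (f' := fun s =>
    Real.exp (K s) * (c * 1 - C * a s) * X s + Real.exp (K s) * φ s -
      B / c * (Real.exp (c * s) * (c * 1))) (by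
    filter_upwards [ae_restrict_of_ae_restrict_of_subset hsub hY,
      ae_restrict_of_ae_restrict_of_subset hsub hr,
      ae_restrict_of_ae hφi.ae_hasDerivAt_integral, ae_restrict_of_ae hai.ae_hasDerivAt_integral,
      ae_restrict_mem measurableSet_Ioo] with s hs1 hs2 hs3 hs4 hs
    have hsI : s ∈ uIcc 0 t := Ioo_subset_Icc_self.trans Icc_subset_uIcc hs
    have dφ := hs3 hsI 0 left_mem_uIcc
    have da := hs4 hsI 0 left_mem_uIcc
    have dK : HasDerivAt K (c * 1 - C * a s) s := ((hasDerivAt_id s).const_mul c).sub (da.const_mul C)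
    have dX : HasDerivAt X (φ s) s := dφ.const_add Y₀
    refine ⟨(dK.exp.mul dX).sub (((hasDerivAt_id s).const_mul c).exp.const_mul (B / c)), ?_⟩
    have e1 : X s = Y s := by simp only [hX]; linarith
    have e2 : B / c * (Real.exp (c * s) * (c * 1)) = Real.exp (c * s) * B := by field_simp
    have hs0 : 0 ≤ ∫ x in 0..s, a x := intervalIntegral.integral_nonneg hs.1.le fun x _ => ha0 x
    have h3 : Real.exp (K s) ≤ Real.exp (c * s) :=
      Real.exp_le_exp.2 (by simp only [hK]; nlinarith)
    rw [e1, e2]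
    have h4 : Real.exp (K s) * (c * 1 - C * a s) * Y s + Real.exp (K s) * φ s ≤
        Real.exp (K s) * B := by
      have := mul_le_mul_of_nonneg_left hs2 (Real.exp_pos (K s)).le
      linarith
    linarith [mul_le_mul_of_nonneg_right h3 hB])
  simp only [Pi.mul_apply, Pi.sub_apply, hK, hX, intervalIntegral.integral_same, mul_zero, sub_zero,
    Real.exp_zero, add_zero, one_mul, mul_one] at key
  rw [← ht, add_sub_cancel] at key
  have hBc : 0 ≤ B / c := by positivity
  -- Everything carries the factor `exp (c t)`, including `Y₀` after a crude bound. It cancels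
  -- against the one in `exp K`, so the length of the interval is lost from the estimate.
  have h5 : Real.exp (c * t - C * ∫ x in 0..t, a x) * Y t ≤ Real.exp (c * t) * (Y₀ + B / c) := by
    have : 1 ≤ Real.exp (c * t) := Real.one_le_exp (by nlinarith [htm.1])
    nlinarith
  have h6 : Y t ≤ Real.exp (C * ∫ x in 0..t, a x) * (Y₀ + B / c) := by
    rw [Real.exp_sub, div_mul_eq_mul_div, div_le_iff₀ (Real.exp_pos _), mul_assoc] at h5
    have := le_of_mul_le_mul_left h5 (Real.exp_pos _)
    linarith
  refine h6.trans (mul_le_mul_of_nonneg_right (Real.exp_le_exp.2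
    (mul_le_mul_of_nonneg_left ?_ hC)) (by positivity))
  refine le_trans ?_ hA
  rw [intervalIntegral.integral_of_le htm.1.le, integral_Ioc_eq_integral_Ioo]
  exact setIntegral_mono_set ha (Eventually.of_forall ha0) hsub.eventuallyLE

end Gronwall

/-! ### Dissipation against drift: the differential inequality -/

section RateBound

variable {n : ℕ} {v' : ℕ → UnitAddTorus (Fin n) → ℝ} {D' : ℕ → Fin n → UnitAddTorus (Fin n) → ℝ}
  {v : UnitAddTorus (Fin n) → ℝ} {D : Fin n → UnitAddTorus (Fin n) → ℝ}

theorem H1Approx.torusEnergy_eq (h : H1Approx v' D' v D) :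
    torusEnergy v D = ENNReal.ofReal ((∫ x, v x * v x) + ∑ i, ∫ x, D i x * D i x) := by
  have h0 : ∀ w : UnitAddTorus (Fin n) → ℝ, 0 ≤ ∫ x, w x * w x := fun w =>
    integral_nonneg fun x => mul_self_nonneg _
  rw [ENNReal.ofReal_add (h0 _) (Finset.sum_nonneg fun i _ => h0 _),
    ENNReal.ofReal_sum_of_nonneg fun i _ => h0 _, MemLp.ofReal_integral_mul_self h.conv.memLp_lim,
    torusEnergy]
  simp_rw [fun i => MemLp.ofReal_integral_mul_self (h.conv_grad i).memLp_lim]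

theorem AdmissibleExponents.exists_integral_formBound {r : ℝ} {q : ℝ≥0∞}
    (hrq : AdmissibleExponents n r q) {η : ℝ} (hη : 0 < η) :
    ∃ K : ℝ, 0 ≤ K ∧ ∀ (v' : ℕ → UnitAddTorus (Fin n) → ℝ) D' v D, H1Approx v' D' v D →
    (∀ j x, 0 ≤ v' j x) → ∀ d : UnitAddTorus (Fin n) → ℝ, AEStronglyMeasurable d volume →
    eLpNorm d q volume ≠ ⊤ → Integrable (fun x => |d x| * (v x * v x)) volume ∧
    ∫ x, |d x| * (v x * v x) ≤ K * ((eLpNorm d q volume ^ r).toReal * ∫ x, v x * v x) +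
      η * ((∫ x, v x * v x) + ∑ i, ∫ x, D i x * D i x) := by
  lift η to ℝ≥0 using hη.le
  obtain ⟨K, hK⟩ := hrq.exists_formBound (η := η) (by exact_mod_cast hη.ne')
  refine ⟨K, (NNReal.coe_nonneg K), fun v' D' v D h h0 d hd hq => ?_⟩
  have h1 := hK v' D' v D h h0 d hd hq
  have hr := hrq.one_le
  have hqr : eLpNorm d q volume ^ r ≠ ⊤ := ENNReal.rpow_ne_top_of_nonneg (by linarith) hq
  have hn : ∀ w : UnitAddTorus (Fin n) → ℝ, 0 ≤ ∫ x, w x * w x := fun w =>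
    integral_nonneg fun x => mul_self_nonneg _
  have hE : 0 ≤ (∫ x, v x * v x) + ∑ i, ∫ x, D i x * D i x :=
    add_nonneg (hn _) (Finset.sum_nonneg fun i _ => hn _)
  rw [← MemLp.ofReal_integral_mul_self h.conv.memLp_lim, h.torusEnergy_eq, ← ENNReal.ofReal_toReal hqr,
    ← ENNReal.ofReal_coe_nnreal, ← ENNReal.ofReal_coe_nnreal, ← ENNReal.ofReal_mul ENNReal.toReal_nonneg,
    ← ENNReal.ofReal_mul (NNReal.coe_nonneg K), ← ENNReal.ofReal_mul (NNReal.coe_nonneg η), ← ENNReal.ofReal_add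
      (mul_nonneg (NNReal.coe_nonneg K) (mul_nonneg ENNReal.toReal_nonneg (hn _))) (mul_nonneg (NNReal.coe_nonneg η) hE)] at h1
  have e : ∀ x, ‖d x‖ₑ * ‖v x‖ₑ ^ 2 = ‖|d x| * (v x * v x)‖ₑ := fun x => by
    rw [enorm_mul, enorm_mul, sq, ← Real.norm_eq_abs, enorm_norm]
  simp_rw [e] at h1
  have hi : Integrable (fun x => |d x| * (v x * v x)) volume :=
    ⟨(continuous_abs.comp_aestronglyMeasurable hd).mul
      (h.conv.memLp_lim.1.mul h.conv.memLp_lim.1), h1.trans_lt ENNReal.ofReal_lt_top⟩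
  refine ⟨hi, ?_⟩
  rw [← ENNReal.ofReal_le_ofReal_iff (add_nonneg
    (mul_nonneg (NNReal.coe_nonneg K) (mul_nonneg ENNReal.toReal_nonneg (hn _))) (mul_nonneg (NNReal.coe_nonneg η) hE)),
    ofReal_integral_eq_lintegral_ofReal hi
      (Eventually.of_forall fun x => mul_nonneg (abs_nonneg _) (mul_self_nonneg _))]
  refine le_trans (le_of_eq (lintegral_congr fun x => ?_)) h1
  rw [Real.enorm_of_nonneg (mul_nonneg (abs_nonneg _) (mul_self_nonneg _))]

/-- Markov's inequality. -/
theorem half_le_measureReal_of_integral_le {α : Type*} [MeasurableSpace α] {μ : Measure α}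
    [IsProbabilityMeasure μ] {v : α → ℝ} (hv : Integrable v μ) (h0 : ∀ᵐ x ∂μ, 0 ≤ v x) {δ : ℝ}
    (hδ : 0 < δ) (h : ∫ x, v x ∂μ ≤ δ) :
    NullMeasurableSet {x | 2 * δ ≤ |v x|}ᶜ μ ∧ 1 / 2 ≤ μ.real {x | 2 * δ ≤ |v x|}ᶜ := by
  have hm : NullMeasurableSet {x | 2 * δ ≤ |v x|} μ :=
    nullMeasurableSet_le aemeasurable_const hv.abs.1.aemeasurable
  refine ⟨hm.compl, ?_⟩
  have h1 := mul_meas_ge_le_integral_of_nonneg (μ := μ) (f := fun x => |v x|)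
    (Eventually.of_forall fun x => abs_nonneg _) hv.abs (2 * δ)
  have h2 : ∫ x, |v x| ∂μ = ∫ x, v x ∂μ := integral_congr_ae (by
    filter_upwards [h0] with x hx using abs_of_nonneg hx)
  rw [probReal_compl_eq_one_sub₀ hm]
  rw [h2] at h1
  have : μ.real {x | 2 * δ ≤ |v x|} ≤ 1 / 2 := by
    by_contra! hlt
    nlinarith
  linarith

/-- The dissipation controls the drift and damps the energy, up to the regularization. -/
theorem AdmissibleExponents.exists_rate_le {r : ℝ} {q : ℝ≥0∞} (hrq : AdmissibleExponents n r q)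
    {m : ℝ} (hm : -(1 / 2) < m) :
    ∃ C c B : ℝ, 0 ≤ C ∧ 0 < c ∧ 0 ≤ B ∧ ∀ δ κ, IsPowerParam m δ κ →
    ∀ (v' : ℕ → UnitAddTorus (Fin n) → ℝ) D' v D, H1Approx v' D' v D →
    (∀ᵐ x, 0 ≤ v x) → ∫ x, v x ≤ δ → ∀ d : UnitAddTorus (Fin n) → ℝ,
    AEStronglyMeasurable d volume → eLpNorm d q volume ≠ ⊤ →
    -∫ x, (∑ i, deriv (powDeriv m δ κ) (v x) * D i x * D i x +
        (v x * powDeriv m δ κ (v x) - powPrimitive m δ κ (v x)) * d x) ≤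
      C * (eLpNorm d q volume ^ r).toReal * (∫ x, powPrimitive m δ κ (v x)) -
        c * (∫ x, powPrimitive m δ κ (v x)) + B * (δ ^ 2) ^ (m + 1) := by
  set k := (1 + |m|) ^ 2 / powEllipticity m with hk
  have hk0 : 0 < k := div_pos (by positivity) (powEllipticity_pos hm)
  set a₀ := 3 + 2 * |m| with ha₀
  have ha0 : 0 < a₀ := by positivity
  -- For `w = √β(v)`, the half-torus Poincaré inequality bounds the `H¹` energy of `w` by `R` times
  -- the dissipation plus `2Q`, with `Q` of order `δ ^ (2(m+1))`. The relative bound `1/(2 a₀ R)`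
  -- below makes the drift consume half of the dissipation; the other half supplies the damping rate
  -- `1/(2R)`.
  set R := (5 * n / 2 + 1) * k with hR
  have hR0 : 0 < R := by positivity
  obtain ⟨K, hK0, hK⟩ := hrq.exists_integral_formBound (η := 1 / (2 * a₀ * R)) (by positivity)
  refine ⟨a₀ * K, 1 / (2 * R), 2 * 5 ^ (m + 1) / R, by positivity, by positivity, by positivity,
    fun δ κ hp v' D' v D h h0 hmass d hd hq => ?_⟩
  obtain ⟨L, hL⟩ := exists_abs_powRootDeriv_le hp
  have hw := h.comp (hasDerivAt_powRoot hp) (continuous_powRootDeriv hp) hL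
  obtain ⟨hi, hform⟩ := hK _ _ _ _ hw (fun j x => Real.sqrt_nonneg _) d hd hq
  have hv := h.conv.memLp_lim
  obtain ⟨hE, hE2⟩ := half_le_measureReal_of_integral_le (hv.integrable one_le_two) h0 hp.pos hmass
  -- On a set of measure at least one half `|v| < 2δ`, so `v² + δ² ≤ 5δ²`; this is the origin of the
  -- `5` in the constant.
  have hpoin := hw.integral_sq_le hE hE2 (c := 5 ^ (m + 1) * (δ ^ 2) ^ (m + 1)) fun x hx => by
    rw [powRoot_mul_self hp, ← Real.mul_rpow (by norm_num) (sq_nonneg _)]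
    have hp1 := hp.exponent
    refine (powPrimitive_le hp _).trans (Real.rpow_le_rpow (regSq_pos hp _).le ?_ (by linarith))
    have hx' : |v x| < 2 * δ := by simpa using hx
    have := sq_lt_sq' (by linarith [neg_abs_le (v x), abs_nonneg (v x)])
      (lt_of_le_of_lt (le_abs_self (v x)) hx')
    unfold regSq
    linarith
  simp only [powRoot_mul_self hp] at hi hform hpoin
  obtain ⟨L', hL'⟩ := exists_abs_deriv_powDeriv_le hp
  have hgc : Continuous (deriv (powDeriv m δ κ)) :=
    (contDiff_powDeriv hp).continuous_deriv (by simp)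
  have hGi : ∀ i, Integrable (fun x => deriv (powDeriv m δ κ) (v x) * D i x * D i x) volume :=
    fun i => by
      simp_rw [mul_assoc]
      exact ((h.conv_grad i).memLp_lim.integrable_fun_mul (h.conv_grad i).memLp_lim).bdd_mul (c := L')
        (hgc.comp_aestronglyMeasurable hv.1) (Eventually.of_forall fun x => hL' _)
  have hβc : Continuous (powPrimitive m δ κ) :=
    continuous_iff_continuousAt.2 fun s => (hasDerivAt_powPrimitive hp s).continuousAt
  have hHb : ∀ x, |(v x * powDeriv m δ κ (v x) - powPrimitive m δ κ (v x)) * d x| ≤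
      a₀ * (|d x| * powPrimitive m δ κ (v x)) := fun x => by
    rw [abs_mul]
    have := mul_le_mul_of_nonneg_right (abs_mul_powDeriv_sub_le hp (v x)) (abs_nonneg (d x))
    linarith
  have hHi : Integrable (fun x => (v x * powDeriv m δ κ (v x) - powPrimitive m δ κ (v x)) * d x)
      volume := (hi.const_mul a₀).mono'
    (((continuous_id.mul (contDiff_powDeriv hp).continuous).sub hβc).comp_aestronglyMeasurable
      hv.1 |>.mul hd) (Eventually.of_forall hHb)
  rw [integral_add (integrable_finsetSum _ fun i _ => hGi i) hHi,
    integral_finsetSum _ fun i _ => hGi i]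
  have h1 : -∫ x, (v x * powDeriv m δ κ (v x) - powPrimitive m δ κ (v x)) * d x ≤
      a₀ * ∫ x, |d x| * powPrimitive m δ κ (v x) := by
    rw [← integral_neg, ← integral_const_mul]
    exact integral_mono hHi.neg (hi.const_mul a₀) fun x => (neg_le_abs _).trans (hHb x)
  have h4 : ∑ i, ∫ x, powRootDeriv m δ κ (v x) * D i x * (powRootDeriv m δ κ (v x) * D i x) ≤
      k * ∑ i, ∫ x, deriv (powDeriv m δ κ) (v x) * D i x * D i x := by
    rw [Finset.mul_sum]
    refine Finset.sum_le_sum fun i _ => ?_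
    rw [← integral_const_mul]
    refine integral_mono ((hw.conv_grad i).memLp_lim.integrable_fun_mul (hw.conv_grad i).memLp_lim)
      ((hGi i).const_mul k) fun x => ?_
    have := mul_le_mul_of_nonneg_right (powRootDeriv_mul_self_le_deriv hp (v x))
      (mul_self_nonneg (D i x))
    linarith
  have hEn : 0 ≤ ∑ i, ∫ x, powRootDeriv m δ κ (v x) * D i x * (powRootDeriv m δ κ (v x) * D i x) :=
    Finset.sum_nonneg fun i _ => integral_nonneg fun x => mul_self_nonneg _
  set Df := ∑ i, ∫ x, deriv (powDeriv m δ κ) (v x) * D i x * D i x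
  set En := ∑ i, ∫ x, powRootDeriv m δ κ (v x) * D i x * (powRootDeriv m δ κ (v x) * D i x)
  set Y := ∫ x, powPrimitive m δ κ (v x)
  set Q := (5 : ℝ) ^ (m + 1) * (δ ^ 2) ^ (m + 1)
  set I := ∫ x, |d x| * powPrimitive m δ κ (v x)
  have h5 : Y + En ≤ R * Df + 2 * Q := by
    have := mul_le_mul_of_nonneg_left h4 (by positivity : (0 : ℝ) ≤ 5 * n / 2 + 1)
    rw [hR, mul_assoc]
    linarith
  have h6 : a₀ * I ≤ a₀ * K * (eLpNorm d q volume ^ r).toReal * Y + 1 / (2 * R) * (Y + En) := by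
    have := mul_le_mul_of_nonneg_left hform ha0.le
    have e : a₀ * (1 / (2 * a₀ * R) * (Y + En)) = 1 / (2 * R) * (Y + En) := by field_simp
    linarith
  have h7 : 1 / (2 * R) * (Y + En) ≤ Df / 2 + Q / R := by
    have := mul_le_mul_of_nonneg_left h5 (by positivity : 0 ≤ 1 / (2 * R))
    have e : 1 / (2 * R) * (R * Df + 2 * Q) = Df / 2 + Q / R := by field_simp
    linarith
  have h8 : 1 / (2 * R) * Y ≤ Df / 2 + Q / R := by
    refine le_trans (mul_le_mul_of_nonneg_left (by linarith) (by positivity)) h7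
  have e9 : 2 * 5 ^ (m + 1) / R * (δ ^ 2) ^ (m + 1) = 2 * (Q / R) := by ring
  rw [e9]
  linarith

end RateBound

/-! ### From the differential inequality to the `L^p` bound -/

section PowerBound

variable {n : ℕ} {T : ℝ} {b : ℝ × UnitAddTorus (Fin n) → EuclideanSpace ℝ (Fin n)}
  {d : ℝ × UnitAddTorus (Fin n) → ℝ} {ρ₀ : UnitAddTorus (Fin n) → ℝ}
  {ρ f : ℝ × UnitAddTorus (Fin n) → ℝ} {G F : ℝ × UnitAddTorus (Fin n) → EuclideanSpace ℝ (Fin n)}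
  {u f' : ℕ → ℝ × UnitAddTorus (Fin n) → ℝ} {F' : ℕ → Fin n → ℝ × UnitAddTorus (Fin n) → ℝ}

/-- Conservation of mass. -/
theorem IsDriftData.ae_integral_eq (h : IsDriftData T b d ρ₀ ρ G f F u f' F') (hT : 0 < T) :
    ∀ᵐ t ∂(volume.restrict (Ioo 0 T)), ∫ x, ρ (t, x) = ∫ x, ρ₀ x := by
  -- For `β = id` the dissipation vanishes and so does the drift coefficient `ρ β' - β`.
  have h1 := (h.ae_energy_eq hT (g := fun _ => 1) (β := fun s => s) contDiff_const (L := 0)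
    (by simp) hasDerivAt_id).2
  filter_upwards [h1] with t ht
  have e : ∀ s, energyRate d ρ G (fun _ => 1) (fun s => s) s = 0 := fun s => by simp [energyRate]
  simp only [e, intervalIntegral.integral_zero] at ht
  linarith [ht.2]

/-- Damped Gronwall with `a(t) = ‖d(t)‖_q^r`, whose integral is at most `M ^ r`. The time horizon
enters neither this bound nor the constants of the rate estimate, so `A` and `B` can be chosen
before `T`. -/
theorem AdmissibleExponents.exists_energy_le {r : ℝ} {q : ℝ≥0∞} (hrq : AdmissibleExponents n r q)
    {m : ℝ} (hm : -(1 / 2) < m) (M : ℝ≥0) :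
    ∃ A B : ℝ, 1 ≤ A ∧ 0 ≤ B ∧ ∀ T, 0 < T → ∀ b d ρ₀ ρ G f F u f' F',
    IsDriftData (n := n) T b d ρ₀ ρ G f F u f' F' → mixedNorm T r q d ≤ M →
    (∀ᵐ z ∂(parabolicCylinder n T), 0 ≤ ρ z) → ∀ δ κ, IsPowerParam m δ κ → ∫ x, ρ₀ x ≤ δ →
    ∀ᵐ t ∂(volume.restrict (Ioo 0 T)), Integrable (fun x => powPrimitive m δ κ (ρ (t, x))) volume ∧
      ∫ x, powPrimitive m δ κ (ρ (t, x)) ≤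
        A * ((∫ x, powPrimitive m δ κ (ρ₀ x)) + B * (δ ^ 2) ^ (m + 1)) := by
  obtain ⟨C, c, B, hC, hc, hB, hrate⟩ := hrq.exists_rate_le hm
  refine ⟨Real.exp (C * ((M : ℝ≥0∞) ^ r).toReal), B / c, Real.one_le_exp (by positivity),
    by positivity, fun T hT b d ρ₀ ρ G f F u f' F' h hM h0 δ κ hp hmass => ?_⟩
  obtain ⟨L, hL⟩ := exists_abs_deriv_powDeriv_le hp
  obtain ⟨hφ, hY⟩ := h.ae_energy_eq hT (contDiff_powDeriv hp) hL (hasDerivAt_powPrimitive hp)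
  have hr := hrq.one_le
  have hlin := lintegral_rpow_le_of_mixedNorm_le hr hM
  have hMr : (M : ℝ≥0∞) ^ r ≠ ⊤ := ENNReal.rpow_ne_top_of_nonneg (by linarith) ENNReal.coe_ne_top
  have ham : AEMeasurable (fun t => eLpNorm (fun x => d (t, x)) q volume ^ r)
      (volume.restrict (Ioo 0 T)) := (aemeasurable_eLpNorm_slice h.measurable_div q).pow_const r
  have hfin := ae_lt_top' ham (hlin.trans_lt hMr.lt_top).ne
  have ha := integrable_toReal_of_lintegral_ne_top ham (hlin.trans_lt hMr.lt_top).ne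
  have hA : ∫ t in Ioo 0 T, (eLpNorm (fun x => d (t, x)) q volume ^ r).toReal ≤
      ((M : ℝ≥0∞) ^ r).toReal := by
    rw [integral_toReal ham hfin]
    exact ENNReal.toReal_mono hMr hlin
  have key := ae_le_of_rate_le (B := B * (δ ^ 2) ^ (m + 1)) (Y₀ := ∫ x, powPrimitive m δ κ (ρ₀ x))
    (Y := fun t => ∫ x, powPrimitive m δ κ (ρ (t, x))) hφ ha (fun _ => ENNReal.toReal_nonneg) hA
    hC hc (by positivity) (integral_nonneg fun x => (powPrimitive_pos hp _).le)
    (hY.mono fun t ht => ht.2) (by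
      filter_upwards [h.approx.ae_h1Approx, hfin, h.ae_integral_eq hT, Measure.ae_ae_of_ae_prod h0,
        h.measurable_div.prodMk_left] with t h1 h2 h3 h4 h5
      refine hrate δ κ hp _ _ _ _ h1 h4 (h3.trans_le hmass) (fun x => d (t, x)) h5 fun htop => ?_
      rw [htop, ENNReal.top_rpow_of_pos (by linarith)] at h2
      exact h2.ne rfl)
  filter_upwards [key, hY] with t h1 h2
  refine ⟨h2.1, h1.trans (le_of_eq ?_)⟩
  ring

/-- Truncations tending to the regularized power. -/
noncomputable def truncSeq (m : ℝ) (j : ℕ) : ℝ := if 0 ≤ m then 1 / ((j : ℝ) + 1) else 0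

theorem isPowerParam_truncSeq {m δ : ℝ} (hm : -(1 / 2) < m) (hδ : 0 < δ) (j : ℕ) :
    IsPowerParam m δ (truncSeq m j) := by
  unfold truncSeq
  split_ifs with h
  · exact ⟨hm, hδ, by positivity, Or.inl ⟨h, by positivity⟩⟩
  · exact ⟨hm, hδ, le_rfl, Or.inr ⟨not_le.1 h, rfl⟩⟩

theorem tendsto_truncSeq (m : ℝ) : Tendsto (truncSeq m) atTop (𝓝 0) := by
  unfold truncSeq
  split_ifs
  · exact tendsto_one_div_add_atTop_nhds_zero_nat
  · exact tendsto_const_nhds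

theorem tendsto_powPrimitive {m δ : ℝ} (hm : -(1 / 2) < m) (hδ : 0 < δ) (s : ℝ) :
    Tendsto (fun j => powPrimitive m δ (truncSeq m j) s) atTop (𝓝 (regSq δ s ^ (m + 1))) := by
  have hA := regSq_pos (isPowerParam_truncSeq hm hδ 0) s
  have h1 : Tendsto (fun j => truncFactor δ (truncSeq m j) s) atTop (𝓝 1) := by
    have := (((tendsto_truncSeq m).mul_const (regSq δ s)).const_add 1).inv₀ (by simp)
    simp only [zero_mul, add_zero, inv_one] at this
    exact this
  have h2 : Tendsto (fun j => truncPow m δ (truncSeq m j) s) atTop (𝓝 (regSq δ s ^ m)) := by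
    have := (h1.const_mul (regSq δ s)).rpow_const (p := m) (Or.inl (by simpa using hA.ne'))
    simp only [mul_one] at this
    exact this
  rw [Real.rpow_add_one hA.ne', mul_comm]
  exact h2.const_mul _

/-- The truncation at infinity is removed at fixed `δ`, with `m = P/2 - 1`: Fatou's lemma applies at
time `t`, and at time zero the truncated power is below the full one. -/
theorem AdmissibleExponents.exists_lintegral_rpow_le {r : ℝ} {q : ℝ≥0∞}
    (hrq : AdmissibleExponents n r q) {P : ℝ} (hP : 1 < P) (M : ℝ≥0) :
    ∃ A B : ℝ, 1 ≤ A ∧ 0 ≤ B ∧ ∀ T, 0 < T → ∀ b d ρ₀ ρ G f F u f' F',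
    IsDriftData (n := n) T b d ρ₀ ρ G f F u f' F' → mixedNorm T r q d ≤ M →
    (∀ᵐ z ∂(parabolicCylinder n T), 0 ≤ ρ z) → ∀ δ : ℝ, 0 < δ → ∫ x, ρ₀ x ≤ δ →
    Integrable (fun x => regSq δ (ρ₀ x) ^ (P / 2)) volume →
    ∀ᵐ t ∂(volume.restrict (Ioo 0 T)), ∫⁻ x, ‖ρ (t, x)‖ₑ ^ P ≤
      ENNReal.ofReal (A * ((∫ x, regSq δ (ρ₀ x) ^ (P / 2)) + B * δ ^ P)) := by
  have hm : -(1 / 2) < P / 2 - 1 := by linarith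
  obtain ⟨A, B, hA, hB, H⟩ := hrq.exists_energy_le hm M
  refine ⟨A, B, hA, hB, fun T hT b d ρ₀ ρ G f F u f' F' h hM h0 δ hδ hmass hint => ?_⟩
  have hp := isPowerParam_truncSeq hm hδ
  filter_upwards [ae_all_iff.2 fun j => H T hT b d ρ₀ ρ G f F u f' F' h hM h0 δ _ (hp j) hmass]
    with t ht
  have e1 : P / 2 - 1 + 1 = P / 2 := by ring
  have e2 : (δ ^ 2) ^ (P / 2) = δ ^ P := by
    rw [← Real.rpow_natCast, ← Real.rpow_mul hδ.le]
    congr 1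
    push_cast
    ring
  have hlim : ∀ s : ℝ, ‖s‖ₑ ^ P ≤
      liminf (fun j => ENNReal.ofReal (powPrimitive (P / 2 - 1) δ (truncSeq (P / 2 - 1) j) s)) atTop := by
    intro s
    have h1 := (ENNReal.continuous_ofReal.tendsto _).comp (tendsto_powPrimitive hm hδ s)
    rw [e1] at h1
    refine le_of_le_of_eq ?_ h1.liminf_eq.symm
    rw [← ofReal_norm, Real.norm_eq_abs, ENNReal.ofReal_rpow_of_nonneg (abs_nonneg _) (by linarith)]
    refine ENNReal.ofReal_le_ofReal ?_
    have e3 : |s| ^ P = (s ^ 2) ^ (P / 2) := by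
      rw [← sq_abs, ← Real.rpow_natCast, ← Real.rpow_mul (abs_nonneg _)]
      congr 1
      push_cast
      ring
    rw [e3]
    refine Real.rpow_le_rpow (sq_nonneg _) ?_ (by linarith)
    unfold regSq
    nlinarith [sq_nonneg δ]
  refine (lintegral_mono fun x => hlim (ρ (t, x))).trans ?_
  refine (lintegral_liminf_le' fun j => (ht j).1.1.aemeasurable.ennreal_ofReal).trans ?_
  refine liminf_le_of_le (by isBoundedDefault) fun a ha => ?_
  obtain ⟨j, hj⟩ := ha.exists
  refine hj.trans ?_
  rw [← ofReal_integral_eq_lintegral_ofReal (ht j).1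
    (Eventually.of_forall fun x => (powPrimitive_pos (hp j) _).le)]
  refine ENNReal.ofReal_le_ofReal ((ht j).2.trans ?_)
  rw [e1, e2]
  refine mul_le_mul_of_nonneg_left (add_le_add ?_ le_rfl) (by linarith)
  refine integral_mono_of_nonneg (Eventually.of_forall fun x => (powPrimitive_pos (hp j) _).le) hint
    (Eventually.of_forall fun x => ?_)
  have := powPrimitive_le (hp j) (ρ₀ x)
  rwa [e1] at this

theorem regSq_rpow_le {P δ : ℝ} (hP : 0 ≤ P) (hδ : 0 ≤ δ) (s : ℝ) :
    regSq δ s ^ (P / 2) ≤ 2 ^ P * (|s| ^ P + δ ^ P) := by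
  set y := max |s| δ with hy
  have hy0 : 0 ≤ y := (abs_nonneg s).trans (le_max_left _ _)
  have h1 : regSq δ s ≤ (2 * y) ^ 2 := by
    have h2 : |s| ^ 2 ≤ y ^ 2 := pow_le_pow_left₀ (abs_nonneg s) (le_max_left _ _) 2
    have h3 : δ ^ 2 ≤ y ^ 2 := pow_le_pow_left₀ hδ (le_max_right _ _) 2
    rw [sq_abs] at h2
    unfold regSq
    nlinarith
  have h0 : 0 ≤ regSq δ s := by unfold regSq; positivity
  refine (Real.rpow_le_rpow h0 h1 (by linarith)).trans ?_
  rw [← Real.rpow_natCast, ← Real.rpow_mul (by positivity), Real.mul_rpow two_pos.le hy0]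
  have e : ((2 : ℕ) : ℝ) * (P / 2) = P := by push_cast; ring
  rw [e]
  refine mul_le_mul_of_nonneg_left ?_ (by positivity)
  rcases max_choice |s| δ with h | h <;> rw [hy, h]
  · exact le_add_of_nonneg_right (by positivity)
  · exact le_add_of_nonneg_left (by positivity)

/-- The parameter `δ` does not tend to zero, as it has to dominate the mass. On a probability space
the mass is at most `N = ‖ρ₀‖_p`, so `δ` may decrease to `N`, and the errors of order `δ ^ P` become
comparable to `N ^ P`. -/
theorem AdmissibleExponents.exists_eLpNorm_le {r : ℝ} {q : ℝ≥0∞}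
    (hrq : AdmissibleExponents n r q) {p : ℝ≥0∞} (hp1 : 1 < p) (hp : p < ⊤) (M : ℝ≥0) :
    ∃ C : ℝ≥0, ∀ T, 0 < T → ∀ b d ρ₀ ρ G f F u f' F',
    IsDriftData (n := n) T b d ρ₀ ρ G f F u f' F' → mixedNorm T r q d ≤ M →
    (∀ᵐ z ∂(parabolicCylinder n T), 0 ≤ ρ z) →
    ∀ᵐ t ∂(volume.restrict (Ioo 0 T)),
      eLpNorm (fun x => ρ (t, x)) p volume ≤ C * eLpNorm ρ₀ p volume := by
  set P := p.toReal with hPdef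
  have hP : 1 < P := by
    have := (ENNReal.toReal_lt_toReal ENNReal.one_ne_top hp.ne).2 hp1
    simpa using this
  have hp0 : p ≠ 0 := (zero_lt_one.trans hp1).ne'
  obtain ⟨A, B, hA, hB, H⟩ := hrq.exists_lintegral_rpow_le hP M
  -- The factor `2 ^ P` comes from `regSq_rpow_le`, and the `2` from estimating `N ^ P + δ ^ P` by
  -- `2 δ ^ P`.
  set C₁ := A * (2 ^ P * 2 + B) with hC₁
  have hC₁0 : 0 < C₁ := by positivity
  refine ⟨(C₁ ^ (1 / P)).toNNReal, fun T hT b d ρ₀ ρ G f F u f' F' h hM h0 => ?_⟩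
  have hcoe : ((C₁ ^ (1 / P)).toNNReal : ℝ≥0∞) = ENNReal.ofReal C₁ ^ (1 / P) :=
    (ENNReal.ofReal_rpow_of_pos hC₁0).symm
  rw [hcoe]
  have hρ₀ := h.approx.initial.memLp_lim
  rcases eq_or_ne (eLpNorm ρ₀ p volume) ⊤ with htop | hfin
  -- If the datum is not in `L^p` the bound is trivial, provided the constant is nonzero so that its
  -- product with `∞` is `∞`.
  · refine Eventually.of_forall fun t => ?_
    rw [htop, ENNReal.mul_top]
    · exact le_top
    · exact (ENNReal.rpow_pos (ENNReal.ofReal_pos.2 hC₁0) ENNReal.ofReal_ne_top).ne'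
  have hmem : MemLp ρ₀ p volume := ⟨hρ₀.1, hfin.lt_top⟩
  set N := (eLpNorm ρ₀ p volume).toReal with hN
  have hN0 : 0 ≤ N := ENNReal.toReal_nonneg
  have hpow : Integrable (fun x => |ρ₀ x| ^ P) volume := hmem.integrable_norm_rpow hp0 hp.ne
  have hpowN : ∫ x, |ρ₀ x| ^ P = N ^ P := by
    have h1 := eLpNorm_eq_lintegral_rpow_enorm_toReal hp0 hp.ne (f := ρ₀) (μ := volume)
    rw [hN, h1, ENNReal.toReal_rpow, ← ENNReal.rpow_mul, one_div, inv_mul_cancel₀ (by positivity),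
      ENNReal.rpow_one, integral_eq_lintegral_of_nonneg_ae
        (Eventually.of_forall fun x => by positivity) hpow.1]
    congr 1
    refine lintegral_congr fun x => ?_
    rw [← ofReal_norm, Real.norm_eq_abs, ENNReal.ofReal_rpow_of_nonneg (abs_nonneg _) (by linarith)]
  have hmass : ∫ x, ρ₀ x ≤ N := by
    have h1 : eLpNorm ρ₀ 1 volume ≤ eLpNorm ρ₀ p volume :=
      eLpNorm_le_eLpNorm_of_exponent_le hp1.le hρ₀.1
    have h2 := ENNReal.toReal_mono hfin h1
    refine ((Real.le_norm_self _).trans (norm_integral_le_integral_norm _)).trans ?_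
    rw [eLpNorm_one_eq_lintegral_enorm] at h2
    rwa [integral_norm_eq_lintegral_enorm hρ₀.1]
  -- The shift keeps `δ` positive even if `N = 0`; it is removed by letting `k` tend to infinity.
  have hδ : ∀ k : ℕ, 0 < N + 1 / ((k : ℝ) + 1) := fun k => by positivity
  have hle : ∀ k : ℕ, N ≤ N + 1 / ((k : ℝ) + 1) := fun k => le_add_of_nonneg_right (by positivity)
  have hmaj : ∀ k : ℕ, Integrable (fun x => (2 : ℝ) ^ P * (|ρ₀ x| ^ P + (N + 1 / ((k : ℝ) + 1)) ^ P))
      (volume : Measure (UnitAddTorus (Fin n))) := fun k => (hpow.add (integrable_const _)).const_mul _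
  have hreg : ∀ k : ℕ, Integrable (fun x => regSq (N + 1 / ((k : ℝ) + 1)) (ρ₀ x) ^ (P / 2))
      (volume : Measure (UnitAddTorus (Fin n))) := fun k => by
    refine (hmaj k).mono' ?_ (Eventually.of_forall fun x => ?_)
    · exact (((contDiff_regSq _).continuous.rpow_const
        fun _ => Or.inr (by positivity)).comp_aestronglyMeasurable hρ₀.1)
    · rw [Real.norm_of_nonneg (Real.rpow_nonneg (by unfold regSq; positivity) _)]
      exact regSq_rpow_le (by positivity) (hδ k).le _
  filter_upwards [ae_all_iff.2 fun k : ℕ => H T hT b d ρ₀ ρ G f F u f' F' h hM h0 _ (hδ k)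
    (hmass.trans (hle k)) (hreg k)] with t ht
  have hk : ∀ k : ℕ, ∫⁻ x, ‖ρ (t, x)‖ₑ ^ P ≤
      ENNReal.ofReal (C₁ * (N + 1 / ((k : ℝ) + 1)) ^ P) := fun k => by
    refine (ht k).trans (ENNReal.ofReal_le_ofReal ?_)
    rw [hC₁, mul_assoc]
    refine mul_le_mul_of_nonneg_left ?_ (by linarith)
    have h1 := integral_mono (hreg k) (hmaj k) fun x => regSq_rpow_le (by positivity) (hδ k).le _
    rw [integral_const_mul, integral_add hpow (integrable_const _), integral_const, hpowN] at h1
    simp only [probReal_univ, one_smul] at h1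
    have h2 : N ^ P ≤ (N + 1 / ((k : ℝ) + 1)) ^ P := Real.rpow_le_rpow hN0 (hle k) (by positivity)
    have h3 := mul_le_mul_of_nonneg_left h2 (by positivity : (0 : ℝ) ≤ 2 ^ P)
    linarith
  have hlim : Tendsto (fun k : ℕ => ENNReal.ofReal (C₁ * (N + 1 / ((k : ℝ) + 1)) ^ P)) atTop
      (𝓝 (ENNReal.ofReal (C₁ * N ^ P))) := by
    refine (ENNReal.continuous_ofReal.tendsto _).comp (Tendsto.const_mul _ ?_)
    have := tendsto_one_div_add_atTop_nhds_zero_nat (𝕜 := ℝ) |>.const_add N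
    rw [add_zero] at this
    exact this.rpow_const (Or.inr (by positivity))
  have hfinal := ge_of_tendsto' hlim hk
  rw [eLpNorm_eq_lintegral_rpow_enorm_toReal hp0 hp.ne]
  refine (ENNReal.rpow_le_rpow hfinal (by positivity)).trans (le_of_eq ?_)
  rw [ENNReal.ofReal_mul hC₁0.le, ENNReal.mul_rpow_of_nonneg _ _ (by positivity),
    ← ENNReal.ofReal_rpow_of_nonneg hN0 (by positivity), ← ENNReal.rpow_mul, ← hPdef, one_div,
    mul_inv_cancel₀ (by positivity), ENNReal.rpow_one, hN, ENNReal.ofReal_toReal hfin]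

end PowerBound

/-! ### The bound at every time -/

section ContinuousRepresentative

/-- A full-measure subset of a bounded interval is dense in its closure. -/
theorem exists_seq_tendsto_of_ae_restrict {T : ℝ} (hT : 0 < T) {P : ℝ → Prop}
    (h : ∀ᵐ t ∂(volume.restrict (Ioo 0 T)), P t) {t : ℝ} (ht : t ∈ Icc 0 T) :
    ∃ s : ℕ → ℝ, (∀ k, s k ∈ Ioo 0 T ∧ P (s k)) ∧ Tendsto s atTop (𝓝 t) := by
  have hcl : t ∈ closure {s | s ∈ Ioo 0 T ∧ P s} := by
    rw [_root_.mem_closure_iff]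
    intro U hU htU
    by_contra hne
    rw [← closure_Ioo hT.ne, _root_.mem_closure_iff] at ht
    have hpos := (hU.inter isOpen_Ioo).measure_pos volume (ht U hU htU)
    rw [ae_restrict_iff' measurableSet_Ioo, ae_iff] at h
    refine hpos.ne' (measure_mono_null (fun s hs => ?_) h)
    intro hP
    exact hne ⟨s, hs.1, hs.2, hP hs.2⟩
  obtain ⟨s, hs, hlim⟩ := mem_closure_iff_seq_limit.1 hcl
  exact ⟨s, hs, hlim⟩

/-- A subsequence converges almost everywhere, and Fatou's lemma makes the `L^p` norm lower
semicontinuous along it, even though convergence is known only in `L²`. -/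
theorem Lp.eLpNorm_le_of_tendsto {α : Type*} [MeasurableSpace α] {μ : Measure α} {p : ℝ≥0∞}
    {v : ℕ → Lp ℝ 2 μ} {w : Lp ℝ 2 μ} (h : Tendsto v atTop (𝓝 w)) {C : ℝ≥0∞}
    (hC : ∀ k, eLpNorm (v k) p μ ≤ C) : eLpNorm w p μ ≤ C := by
  obtain ⟨ns, -, hns⟩ := (tendstoInMeasure_of_tendsto_Lp h).exists_seq_tendsto_ae
  refine (MeasureTheory.Lp.eLpNorm_lim_le_liminf_eLpNorm
    (fun k => (MeasureTheory.Lp.aestronglyMeasurable (v (ns k)))) _ hns).trans ?_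
  refine liminf_le_of_le (by isBoundedDefault) fun a ha => ?_
  obtain ⟨k, hk⟩ := ha.exists
  exact hk.trans (hC _)

end ContinuousRepresentative

theorem mainTheorem2 (n : ℕ) (r : ℝ) (q : ℝ≥0∞) (hrq : AdmissibleExponents n r q)
    (p : ℝ≥0∞) (hp1 : 1 < p) (hp : p < ⊤) (M : ℝ≥0) :
    ∃ C : ℝ≥0, ∀ (T : ℝ), 0 < T →
      ∀ (b : ℝ × UnitAddTorus (Fin n) → EuclideanSpace ℝ (Fin n))
        (d : ℝ × UnitAddTorus (Fin n) → ℝ),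
        MemLp b 2 (parabolicCylinder n T) →
        AEStronglyMeasurable d (parabolicCylinder n T) → mixedNorm T r q d ≤ M → IsWeakDiv T b d →
      ∀ (ρ₀ : UnitAddTorus (Fin n) → ℝ) (ρ : ℝ × UnitAddTorus (Fin n) → ℝ),
        MemLp ρ₀ 2 volume → IsParabolicSolution T b ρ₀ ρ → (∀ᵐ z ∂(parabolicCylinder n T), 0 ≤ ρ z) →
        (∀ᵐ t ∂(volume.restrict (Ioo 0 T)),
          eLpNorm (fun x => ρ (t, x)) p volume ≤ C * eLpNorm ρ₀ p volume) ∧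
        (∀ u : ℝ → Lp ℝ 2 (volume : Measure (UnitAddTorus (Fin n))),
          ContinuousOn u (Icc 0 T) →
          (∀ᵐ t ∂(volume.restrict (Ioo 0 T)), u t =ᵐ[volume] fun x => ρ (t, x)) →
          ∀ t ∈ Icc 0 T, eLpNorm (u t) p volume ≤ C * eLpNorm ρ₀ p volume) := by
  obtain ⟨C, hC⟩ := hrq.exists_eLpNorm_le hp1 hp M
  refine ⟨C, fun T hT b d hb hd hM hdiv ρ₀ ρ hρ₀ hs h0 => ?_⟩
  obtain ⟨G, f, F, hdata, heq⟩ := hs.exists_isEnergyData hb hρ₀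
  obtain ⟨u', f', F', ha⟩ := hdata.exists_isApproxSeq
  have key := hC T hT b d ρ₀ ρ G f F u' f' F'
    ⟨ha, hb, hd, ha.integrable_mul_sq hrq hd hM, hdiv, heq⟩ hM h0
  refine ⟨key, fun u hu hae t ht => ?_⟩
  -- The times at which both the bound and the identity of `u` with `ρ` hold are dense in the closed
  -- interval, so every `t`, endpoints included, is a limit of such times.
  obtain ⟨s, hs, hlim⟩ := exists_seq_tendsto_of_ae_restrict hT (key.and hae) ht
  have hlim' : Tendsto s atTop (𝓝[Icc 0 T] t) := tendsto_nhdsWithin_iff.2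
    ⟨hlim, Eventually.of_forall fun k => Ioo_subset_Icc_self (hs k).1⟩
  exact Lp.eLpNorm_le_of_tendsto ((hu t ht).tendsto.comp hlim') fun k =>
    (eLpNorm_congr_ae (hs k).2.2).trans_le (hs k).2.1
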